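/- Let $\mathbb N=\{1,2,3,\dots\}$, let $e(x)=e^{2\pi i x}$, and for $a\colon\mathbb N\to\mathbb C$ write $\mathbb E_{n\in[N]}a(n)=\frac1N\sum_{n=1}^N a(n)$. Let $f\colon\mathbb N\to\mathbb C$ satisfy $|f(n)|\le 1$ for all $n$ and be multiplicative, i.e. $f(mn)=f(m)f(n)$ whenever $\gcd(m,n)=1$. For functions $g,h\colon\mathbb N\to\mathbb C$ of modulus at most $1$ let $\mathbb D(g,h)\in[0,\infty]$ be defined by $\mathbb D(g,h)^2=\sum_{p\ \mathrm{prime}}\frac1p\bigl(1-\mathrm{Re}(g(p)\overline{h(p)})\bigr)$. By a Dirichlet character we mean a Dirichlet character $\chi$ to any modulus $q\in\mathbb N$, primitive or not. Then the following are equivalent: 1. $f$ is aperiodic, i.e. $\lim_{N\to\infty}\mathbb E_{n\in[N]}f(an+b)=0$ for all $a,b\in\mathbb N$. 2. $\lim_{N\to\infty}\mathbb E_{n\in[N]}f(n)\,e(np/q)=0$ for all $p,q\in\mathbb N$. 3. $\lim_{N\to\infty}\mathbb E_{n\in[N]}f(n)\chi(n)=0$ for every Dirichlet character $\chi$. 4.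 For every $t\in\mathbb R$ and every Dirichlet character $\chi$, either $\mathbb D(f,\chi(n)n^{it})=\infty$, or $f(2^m)\chi(2^m)=-2^{-imt}$ for every $m\in\mathbb N$. -/

import Mathlib

open Filter Topology

/-! A function on the positive integers is given by
`f : ℕ → ℂ`, whose value at `0` is never used. -/

/-- The multiplicative functions on the positive integers of modulus at most `1`.
(The zero function is included.) -/
structure IsMultOfModulusLeOne (f : ℕ → ℂ) : Prop where
  map_mul : ∀ m n : ℕ, 0 < m → 0 < n → Nat.Coprime m n → f (m * n) = f m * f n
  norm_le_one : ∀ n : ℕ, 0 < n → ‖f n‖ ≤ 1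

/-- The average `(1 / N) ∑_{n = 1}^N a n`. -/
noncomputable def avg (a : ℕ → ℂ) (N : ℕ) : ℂ :=
  (∑ n ∈ Finset.Icc 1 N, a n) / (N : ℂ)

/-- Zero average on every infinite arithmetic progression. -/
def IsAperiodic (f : ℕ → ℂ) : Prop :=
  ∀ a b : ℕ, 0 < a → 0 < b → Tendsto (avg fun n => f (a * n + b)) atTop (𝓝 0)

/-- `e(x) = exp (2 π i x)`. -/
noncomputable def expChar (x : ℝ) : ℂ :=
  Complex.exp (2 * Real.pi * Complex.I * x)

/-- The distance `D(f, g) = (∑_p (1 - Re (f(p) conj (g(p)))) / p) ^ (1/2)`, with values in `[0, ∞]`.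
For `f` and `g` of modulus at most `1` all the terms are nonnegative. -/
noncomputable def mulDist (f g : ℕ → ℂ) : ENNReal :=
  (∑' p : Nat.Primes,
    ENNReal.ofReal ((1 / (p : ℝ)) * (1 - (f p * starRingEnd ℂ (g p)).re))) ^ (1 / 2 : ℝ)

/-! Conditions 1, 2 and 3 say in three ways that `f` has mean zero on every residue class
(`HasZeroClassMeans`). Additive characters recover all classes by finite Fourier inversion.
Dirichlet characters give only the invertible classes modulo `a`; for the others write `n = m * k`
with every prime factor of `m` dividing `a` and `k` coprime to `a`. Then `f n = f m * f k`, the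
class of `n` is determined by those of `m` and `k`, and the sum over `m` converges because `∑ 1 / m`
over such `m` is finite (`hasZeroClassMeans_of_characters`).

The analytic core is Halász's criterion, `tendsto_avg_zero_of_not_summable`: a multiplicative `g` at
infinite distance from every `n ^ {it}` has mean value zero. Let `M u` be the mean of `g` up to `e ^
u`. The dual Turán–Kubilius inequality yields `M u ≈ g p * M (u - log p)` on average over primes `p
≤ e ^ {u / 2}` with weights `1 / p` (`sum_norm_logMean_sub_sq_le`). Under the Fourier transform in
`u` this relation multiplies the transform of `M` by `1 - g p * p ^ {-iξ}`, so the spectrum of `M`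
is small wherever `∑ |1 - g p * p ^ {-iξ}| ^ 2 / p` is large. By compactness that happens uniformly
on bounded sets of `ξ`; high frequencies carry little energy because `M` varies slowly. Hence the
mean square of `M` over `[0, U]` tends to zero (`tendsto_logMean_sq_zero`). If instead `∑ (1 - |g
p|) / p` diverges, the same follows from an Euler product bound (`tendsto_logMean_sq_zero_of_norm`).
A second use of the approximate relation, with Chebyshev's estimates, turns mean square decay into
decay of `M` itself (`tendsto_avg_zero_of_logMean_sq`).

Conversely, if `∑ (1 - Re G p) / p` converges and `G` vanishes at powers of `2`, the Dirichlet
series of `G` is at least a constant times zeta near `1`, so `G` does not have mean zero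
(`not_tendsto_avg_zero`).

The prime `2` is special since its Euler factor may vanish at `1`. As imprimitive characters are
allowed, every `χ` can be replaced by `evenLift χ`, which kills the powers of `2` and alters one
term of the distance. So 3 always gives the first alternative of 4, and the second alternative of 4
fails for the lifted characters. -/

/-! ### The Turán–Kubilius inequality and its dual -/

/-- The indicator of the multiples of `p`, centred by its density. -/
noncomputable def centredDvd (p n : ℕ) : ℝ := (if p ∣ n then 1 else 0) - 1 / p

lemma sum_dvd_indicator (N p : ℕ) :
    ∑ n ∈ Finset.Icc 1 N, (if p ∣ n then (1 : ℝ) else 0) = ((N / p : ℕ) : ℝ) := by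
  rw [Finset.sum_boole, ← Nat.Ioc_filter_dvd_card_eq_div]
  rfl

lemma natCast_div_bounds (N : ℕ) {d : ℕ} (hd : 0 < d) :
    ((N / d : ℕ) : ℝ) ≤ N / d ∧ (N : ℝ) / d - 1 ≤ ((N / d : ℕ) : ℝ) := by
  refine ⟨Nat.cast_div_le, ?_⟩
  have hd' : (0 : ℝ) < d := by exact_mod_cast hd
  have h := Nat.div_add_mod N d
  have h2 := Nat.mod_lt N hd
  have h3 : (N : ℝ) = d * ((N / d : ℕ) : ℝ) + ((N % d : ℕ) : ℝ) := by exact_mod_cast h.symm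
  have h4 : ((N % d : ℕ) : ℝ) < d := by exact_mod_cast h2
  rw [sub_le_iff_le_add, div_le_iff₀ hd']
  nlinarith

lemma sum_centredDvd_mul (N : ℕ) {p q : ℕ} :
    ∑ n ∈ Finset.Icc 1 N, centredDvd p n * centredDvd q n =
      ((N / Nat.lcm p q : ℕ) : ℝ) - ((N / p : ℕ) : ℝ) / q - ((N / q : ℕ) : ℝ) / p
        + N / (p * q) := by
  have h : ∀ n, centredDvd p n * centredDvd q n =
      (if Nat.lcm p q ∣ n then (1 : ℝ) else 0) - (if p ∣ n then (1 : ℝ) else 0) * (1 / q)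
        - (if q ∣ n then (1 : ℝ) else 0) * (1 / p) + 1 / (p * q) := by
    intro n
    unfold centredDvd
    by_cases h1 : p ∣ n <;> by_cases h2 : q ∣ n <;> simp [h1, h2, Nat.lcm_dvd_iff] <;> ring
  simp only [h, Finset.sum_add_distrib, Finset.sum_sub_distrib, ← Finset.sum_mul,
    sum_dvd_indicator]
  simp
  ring

/-- Divisibility by distinct primes is independent up to rounding: the main terms cancel, leaving
the fractional part of `N / (p * q)` and two fractional parts weighted by `1 / p, 1 / q ≤ 1 / 2`. On
the diagonal the variance term `N / p` remains. -/
lemma abs_sum_centredDvd_mul_le (N : ℕ) {p q : ℕ} (hp : p.Prime) (hq : q.Prime) :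
    |∑ n ∈ Finset.Icc 1 N, centredDvd p n * centredDvd q n| ≤
      1 + if p = q then (N : ℝ) / p else 0 := by
  rw [sum_centredDvd_mul]
  have hp2 : (2 : ℝ) ≤ p := by exact_mod_cast hp.two_le
  have hq2 : (2 : ℝ) ≤ q := by exact_mod_cast hq.two_le
  have hN : (0 : ℝ) ≤ N := Nat.cast_nonneg N
  obtain ⟨hp1, hp3⟩ := natCast_div_bounds N hp.pos
  obtain ⟨hq1, hq3⟩ := natCast_div_bounds N hq.pos
  by_cases h : p = q
  · subst h
    simp only [Nat.lcm_self, if_true]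
    set A : ℝ := ((N / p : ℕ) : ℝ) with hA
    have hA0 : 0 ≤ A := Nat.cast_nonneg _
    have e1 : (N : ℝ) / (p * p) = N / p * (1 / p) := by field_simp
    have e2 : A / p = A * (1 / p) := by ring
    have hi : (1 : ℝ) / p ≤ 1 / 2 := one_div_le_one_div_of_le (by norm_num) hp2
    have hi0 : (0 : ℝ) ≤ 1 / p := by positivity
    rw [e1, e2]
    generalize (1 : ℝ) / p = r at *
    generalize (N : ℝ) / p = M at *
    rw [abs_le]
    constructor <;> nlinarith
  · rw [if_neg h, (Nat.coprime_primes hp hq).2 h |>.lcm_eq_mul]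
    obtain ⟨hm1, hm3⟩ := natCast_div_bounds N (Nat.mul_pos hp.pos hq.pos)
    push_cast at hm1 hm3
    have hip : (1 : ℝ) / p ≤ 1 / 2 := one_div_le_one_div_of_le (by norm_num) hp2
    have hiq : (1 : ℝ) / q ≤ 1 / 2 := one_div_le_one_div_of_le (by norm_num) hq2
    have hip0 : (0 : ℝ) ≤ 1 / p := by positivity
    have hiq0 : (0 : ℝ) ≤ 1 / q := by positivity
    have e1 : (N : ℝ) / p = N * (1 / p) := by ring
    have e2 : (N : ℝ) / q = N * (1 / q) := by ring
    have e3 : (N : ℝ) / (p * q) = N * (1 / p) * (1 / q) := by field_simp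
    have e4 : ((N / p : ℕ) : ℝ) / q = ((N / p : ℕ) : ℝ) * (1 / q) := by ring
    have e5 : ((N / q : ℕ) : ℝ) / p = ((N / q : ℕ) : ℝ) * (1 / p) := by ring
    rw [e3] at hm1 hm3
    rw [e1] at hp1 hp3
    rw [e2] at hq1 hq3
    rw [e3, e4, e5]
    generalize (1 : ℝ) / p = r at *
    generalize (1 : ℝ) / q = s at *
    rw [abs_le]
    constructor <;> nlinarith

lemma sum_le_of_sq_le {P : Finset ℕ} {N : ℕ} (hpos : ∀ p ∈ P, 0 < p) (hsq : ∀ p ∈ P, p ^ 2 ≤ N) :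
    ∑ p ∈ P, (p : ℝ) ≤ N := by
  have hle : ∀ p ∈ P, p ≤ Nat.sqrt N := fun p hp => Nat.le_sqrt'.2 (hsq p hp)
  have hsub : P ⊆ Finset.Icc 1 (Nat.sqrt N) := fun p hp =>
    Finset.mem_Icc.2 ⟨hpos p hp, hle p hp⟩
  have hcard : P.card ≤ Nat.sqrt N := by simpa using Finset.card_le_card hsub
  have h1 : ∑ p ∈ P, p ≤ P.card * Nat.sqrt N := by
    simpa using Finset.sum_le_card_nsmul P id _ hle
  have h2 : ∑ p ∈ P, p ≤ N :=
    h1.trans ((Nat.mul_le_mul_right _ hcard).trans (Nat.sqrt_le N))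
  rw [← Nat.cast_sum]
  exact Nat.cast_le.2 h2

/-- The Turán–Kubilius inequality for the primes up to `√N`. -/
theorem turan_kubilius (w : ℕ → ℂ) (N : ℕ) (P : Finset ℕ) (hP : ∀ p ∈ P, p.Prime)
    (hsq : ∀ p ∈ P, p ^ 2 ≤ N) :
    ∑ n ∈ Finset.Icc 1 N, ‖∑ p ∈ P, w p * (centredDvd p n : ℂ)‖ ^ 2 ≤
      2 * N * ∑ p ∈ P, ‖w p‖ ^ 2 / p := by
  have hexp : (((∑ n ∈ Finset.Icc 1 N, ‖∑ p ∈ P, w p * (centredDvd p n : ℂ)‖ ^ 2 : ℝ)) : ℂ) =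
      ∑ p ∈ P, ∑ q ∈ P, w p * starRingEnd ℂ (w q) *
        ((∑ n ∈ Finset.Icc 1 N, centredDvd p n * centredDvd q n : ℝ) : ℂ) := by
    push_cast
    simp_rw [← Complex.mul_conj', map_sum, map_mul, Complex.conj_ofReal, Finset.sum_mul_sum,
      Finset.mul_sum]
    rw [Finset.sum_comm]
    refine Finset.sum_congr rfl fun p _ => ?_
    rw [Finset.sum_comm]
    refine Finset.sum_congr rfl fun q _ => Finset.sum_congr rfl fun n _ => ?_
    ring
  have hnn : 0 ≤ ∑ n ∈ Finset.Icc 1 N, ‖∑ p ∈ P, w p * (centredDvd p n : ℂ)‖ ^ 2 :=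
    Finset.sum_nonneg fun _ _ => by positivity
  have h1 : ∑ n ∈ Finset.Icc 1 N, ‖∑ p ∈ P, w p * (centredDvd p n : ℂ)‖ ^ 2 ≤
      ∑ p ∈ P, ∑ q ∈ P, ‖w p‖ * ‖w q‖ * (1 + if p = q then (N : ℝ) / p else 0) := by
    rw [← abs_of_nonneg hnn, ← Real.norm_eq_abs, ← Complex.norm_real, hexp]
    refine (norm_sum_le _ _).trans (Finset.sum_le_sum fun p hp => ?_)
    refine (norm_sum_le _ _).trans (Finset.sum_le_sum fun q hq => ?_)
    rw [norm_mul, norm_mul, RCLike.norm_conj, Complex.norm_real, Real.norm_eq_abs]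
    exact mul_le_mul_of_nonneg_left (abs_sum_centredDvd_mul_le N (hP p hp) (hP q hq))
      (by positivity)
  have h2 : ∑ p ∈ P, ∑ q ∈ P, ‖w p‖ * ‖w q‖ * (1 + if p = q then (N : ℝ) / p else 0) =
      (∑ p ∈ P, ‖w p‖) ^ 2 + N * ∑ p ∈ P, ‖w p‖ ^ 2 / p := by
    simp_rw [mul_add, Finset.sum_add_distrib, mul_one, sq, Finset.sum_mul_sum, mul_ite, mul_zero,
      Finset.sum_ite_eq]
    congr 1
    rw [Finset.mul_sum]
    refine Finset.sum_congr rfl fun p hp => ?_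
    rw [if_pos hp]
    ring
  -- The rounding errors are absorbed by Cauchy–Schwarz with weights `p` and `1 / p`. The
  -- restriction to `p ≤ √N` serves to give `∑ p ≤ N`.
  have h3 : (∑ p ∈ P, ‖w p‖) ^ 2 ≤ N * ∑ p ∈ P, ‖w p‖ ^ 2 / p := by
    have hcs := Finset.sum_sq_le_sum_mul_sum_of_sq_le_mul P (r := fun p => ‖w p‖)
      (f := fun p => (p : ℝ)) (g := fun p => ‖w p‖ ^ 2 / p) (fun p _ => by positivity)
      (fun p _ => by positivity) (fun p hp => by
        have : (p : ℝ) ≠ 0 := by exact_mod_cast (hP p hp).ne_zero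
        refine le_of_eq ?_
        field_simp)
    refine hcs.trans (mul_le_mul_of_nonneg_right
      (sum_le_of_sq_le (fun p hp => (hP p hp).pos) hsq) ?_)
    exact Finset.sum_nonneg fun _ _ => by positivity
  linarith

/-- The dual form of the Turán–Kubilius inequality. -/
theorem turan_kubilius_dual (a : ℕ → ℂ) (N : ℕ) (P : Finset ℕ) (hP : ∀ p ∈ P, p.Prime)
    (hsq : ∀ p ∈ P, p ^ 2 ≤ N) :
    ∑ p ∈ P, (p : ℝ) * ‖∑ n ∈ Finset.Icc 1 N, a n * (centredDvd p n : ℂ)‖ ^ 2 ≤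
      2 * N * ∑ n ∈ Finset.Icc 1 N, ‖a n‖ ^ 2 := by
  set A : ℕ → ℂ := fun p => ∑ n ∈ Finset.Icc 1 N, a n * (centredDvd p n : ℂ) with hA
  -- Duality: with this choice the bilinear form equals `T`, and so does the weighted norm of `w`.
  -- Cauchy–Schwarz then bounds `T ^ 2` by a multiple of `T`.
  set w : ℕ → ℂ := fun p => p * starRingEnd ℂ (A p) with hw
  set T : ℝ := ∑ p ∈ P, (p : ℝ) * ‖A p‖ ^ 2 with hT
  have hT0 : 0 ≤ T := Finset.sum_nonneg fun _ _ => by positivity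
  have hTw : ∑ p ∈ P, ‖w p‖ ^ 2 / p = T := by
    refine Finset.sum_congr rfl fun p hp => ?_
    have : (p : ℝ) ≠ 0 := by exact_mod_cast (hP p hp).ne_zero
    simp only [hw, norm_mul, RCLike.norm_conj, Complex.norm_natCast]
    field_simp
  have hsum : (T : ℂ) = ∑ n ∈ Finset.Icc 1 N, a n * ∑ p ∈ P, w p * (centredDvd p n : ℂ) := by
    simp only [hT]
    push_cast
    simp_rw [← Complex.mul_conj', Finset.mul_sum]
    rw [Finset.sum_comm]
    refine Finset.sum_congr rfl fun p _ => ?_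
    rw [hw]
    simp only
    rw [mul_left_comm, hA]
    simp only
    rw [Finset.sum_mul]
    refine Finset.sum_congr rfl fun n _ => ?_
    ring
  have h1 : T ^ 2 ≤ (∑ n ∈ Finset.Icc 1 N, ‖a n‖ ^ 2) * (2 * N * T) := by
    have h2 : T ≤ ∑ n ∈ Finset.Icc 1 N, ‖a n‖ * ‖∑ p ∈ P, w p * (centredDvd p n : ℂ)‖ := by
      have : T = ‖(T : ℂ)‖ := by rw [Complex.norm_real, Real.norm_of_nonneg hT0]
      rw [this, hsum]
      refine (norm_sum_le _ _).trans (Finset.sum_le_sum fun n _ => (norm_mul _ _).le)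
    have h3 := Finset.sum_mul_sq_le_sq_mul_sq (Finset.Icc 1 N) (fun n => ‖a n‖)
      (fun n => ‖∑ p ∈ P, w p * (centredDvd p n : ℂ)‖)
    have h4 := turan_kubilius w N P hP hsq
    rw [hTw] at h4
    calc T ^ 2 ≤ _ := pow_le_pow_left₀ hT0 h2 2
      _ ≤ _ := h3
      _ ≤ _ := mul_le_mul_of_nonneg_left h4 (Finset.sum_nonneg fun _ _ => by positivity)
  by_cases hz : T = 0
  · rw [hz]
    have : 0 ≤ ∑ n ∈ Finset.Icc 1 N, ‖a n‖ ^ 2 := Finset.sum_nonneg fun _ _ => by positivity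
    positivity
  · have hTpos : 0 < T := lt_of_le_of_ne hT0 (Ne.symm hz)
    nlinarith

/-! ### The approximate relation between mean values at `x` and `x / p` -/

/-- The partial sums of `g` up to a real number. -/
noncomputable def partialSum (g : ℕ → ℂ) (x : ℝ) : ℂ := ∑ n ∈ Finset.Icc 1 ⌊x⌋₊, g n

/-- The mean value of `g` up to `e ^ u`, as a function of `u`. -/
noncomputable def logMean (g : ℕ → ℂ) (u : ℝ) : ℂ :=
  partialSum g (Real.exp u) * (Real.exp (-u) : ℂ)

lemma norm_sum_le_card {g : ℕ → ℂ} (hg : ∀ n, 0 < n → ‖g n‖ ≤ 1) (s : Finset ℕ)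
    (hs : ∀ n ∈ s, 0 < n) : ‖∑ n ∈ s, g n‖ ≤ s.card := by
  refine (norm_sum_le _ _).trans ((Finset.sum_le_sum fun n hn => hg n (hs n hn)).trans ?_)
  simp

lemma norm_partialSum_le {g : ℕ → ℂ} (hg : ∀ n, 0 < n → ‖g n‖ ≤ 1) {x : ℝ} (hx : 0 ≤ x) :
    ‖partialSum g x‖ ≤ x := by
  refine (norm_sum_le_card hg _ fun n hn => (Finset.mem_Icc.1 hn).1).trans ?_
  simpa using Nat.floor_le hx

lemma norm_logMean_le {g : ℕ → ℂ} (hg : ∀ n, 0 < n → ‖g n‖ ≤ 1) (u : ℝ) :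
    ‖logMean g u‖ ≤ 1 := by
  unfold logMean
  rw [norm_mul, Complex.norm_real, Real.norm_of_nonneg (Real.exp_pos _).le]
  calc _ ≤ Real.exp u * Real.exp (-u) :=
        mul_le_mul_of_nonneg_right (norm_partialSum_le hg (Real.exp_pos _).le) (Real.exp_pos _).le
    _ = 1 := by rw [← Real.exp_add]; simp

lemma measurable_logMean (g : ℕ → ℂ) : Measurable (logMean g) := by
  have h1 : Measurable fun n : ℕ => ∑ k ∈ Finset.Icc 1 n, g k := measurable_of_countable _
  have h2 : Measurable fun u : ℝ => ⌊Real.exp u⌋₊ := Real.measurable_exp.nat_floor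
  have h3 : Measurable fun u : ℝ => (Real.exp (-u) : ℂ) := by fun_prop
  exact (h1.comp h2).mul h3

/-- For multiplicative `g`, the sum over the multiples of `p` is nearly `g p` times a shorter
sum. -/
lemma norm_sum_multiples_sub_le {g : ℕ → ℂ} (hg : IsMultOfModulusLeOne g) (N : ℕ) {p : ℕ}
    (hp : p.Prime) :
    ‖∑ n ∈ Finset.Icc 1 N, (if p ∣ n then g n else 0) - g p * ∑ n ∈ Finset.Icc 1 (N / p), g n‖ ≤
      2 * N / p ^ 2 := by
  have h1 : ∑ n ∈ Finset.Icc 1 N, (if p ∣ n then g n else 0) =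
      ∑ m ∈ Finset.Icc 1 (N / p), g (p * m) := by
    rw [← Finset.sum_filter]
    symm
    refine Finset.sum_nbij' (fun m => p * m) (fun n => n / p) ?_ ?_ ?_ ?_ ?_
    · intro m hm
      rw [Finset.mem_Icc] at hm
      simp only [Finset.mem_filter, Finset.mem_Icc, dvd_mul_right, and_true]
      refine ⟨Nat.mul_pos hp.pos hm.1, ?_⟩
      rw [mul_comm]
      exact (Nat.le_div_iff_mul_le hp.pos).1 hm.2
    · intro n hn
      simp only [Finset.mem_filter, Finset.mem_Icc] at hn ⊢
      exact ⟨Nat.div_pos (Nat.le_of_dvd hn.1.1 hn.2) hp.pos, Nat.div_le_div_right hn.1.2⟩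
    · intro m _
      exact Nat.mul_div_cancel_left m hp.pos
    · intro n hn
      exact Nat.mul_div_cancel' (Finset.mem_filter.1 hn).2
    · intro m _
      rfl
  rw [h1, Finset.mul_sum, ← Finset.sum_sub_distrib]
  -- Multiplicativity can fail only when `p ∣ m`, which leaves at most `N / p ^ 2` exceptional
  -- terms.
  have h2 : ∀ m ∈ Finset.Icc 1 (N / p), ‖g (p * m) - g p * g m‖ ≤ 2 * if p ∣ m then 1 else 0 := by
    intro m hm
    have hm0 : 0 < m := (Finset.mem_Icc.1 hm).1
    by_cases hd : p ∣ m
    · simp only [hd, if_true]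
      have e1 := hg.norm_le_one (p * m) (Nat.mul_pos hp.pos hm0)
      have e2 := hg.norm_le_one p hp.pos
      have e3 := hg.norm_le_one m hm0
      calc _ ≤ ‖g (p * m)‖ + ‖g p * g m‖ := norm_sub_le _ _
        _ ≤ 1 + 1 * 1 := by
          rw [norm_mul]
          gcongr
        _ = _ := by norm_num
    · simp [hd, hg.map_mul p m hp.pos hm0 ((Nat.Prime.coprime_iff_not_dvd hp).2 hd)]
  refine (norm_sum_le _ _).trans ((Finset.sum_le_sum h2).trans ?_)
  rw [← Finset.mul_sum, sum_dvd_indicator]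
  have hp0 : (0 : ℝ) < p := by exact_mod_cast hp.pos
  have e1 : ((N / p / p : ℕ) : ℝ) ≤ N / p / p :=
    Nat.cast_div_le.trans (div_le_div_of_nonneg_right Nat.cast_div_le hp0.le)
  calc _ ≤ 2 * ((N : ℝ) / p / p) := by gcongr
    _ = _ := by field_simp

lemma sum_inv_cube_le (P : Finset ℕ) : ∑ p ∈ P, 1 / (p : ℝ) ^ 3 ≤ ∑' n : ℕ, 1 / (n : ℝ) ^ 3 :=
  (Real.summable_one_div_nat_pow.2 (by norm_num)).sum_le_tsum P fun _ _ => by positivity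

/-- A constant in the Turán–Kubilius inequality for the mean values of a multiplicative
function. -/
noncomputable def tkConst : ℝ := 4 + 8 * ∑' n : ℕ, 1 / (n : ℝ) ^ 3

lemma tkConst_pos : 0 < tkConst := by
  have : 0 ≤ ∑' n : ℕ, 1 / (n : ℝ) ^ 3 := tsum_nonneg fun _ => by positivity
  unfold tkConst
  linarith

/-- The mean values of a multiplicative function `g` at `x` and `x / p` nearly differ by the factor
`g p`, for most primes `p ≤ √x`. -/
theorem sum_norm_logMean_sub_sq_le {g : ℕ → ℂ} (hg : IsMultOfModulusLeOne g) (u : ℝ)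
    (P : Finset ℕ) (hP : ∀ p ∈ P, p.Prime) (hsq : ∀ p ∈ P, (p : ℝ) ^ 2 ≤ Real.exp u) :
    ∑ p ∈ P, (1 / p : ℝ) * ‖logMean g u - g p * logMean g (u - Real.log p)‖ ^ 2 ≤ tkConst := by
  set N := ⌊Real.exp u⌋₊ with hN
  have hNx : (N : ℝ) ≤ Real.exp u := Nat.floor_le (Real.exp_pos _).le
  set x := Real.exp u with hx
  have hx0 : 0 < x := Real.exp_pos _
  have hsq' : ∀ p ∈ P, p ^ 2 ≤ N := fun p hp => Nat.le_floor (by exact_mod_cast hsq p hp)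
  have htk := turan_kubilius_dual g N P hP hsq'
  have hone : ∑ n ∈ Finset.Icc 1 N, ‖g n‖ ^ 2 ≤ N := by
    refine (Finset.sum_le_sum fun n hn => pow_le_one₀ (norm_nonneg _)
      (hg.norm_le_one n (Finset.mem_Icc.1 hn).1)).trans ?_
    simp
  have hterm : ∀ p ∈ P, (1 / p : ℝ) * ‖logMean g u - g p * logMean g (u - Real.log p)‖ ^ 2 ≤
      2 / x ^ 2 * ((p : ℝ) * ‖∑ n ∈ Finset.Icc 1 N, g n * (centredDvd p n : ℂ)‖ ^ 2)
        + 8 * (1 / (p : ℝ) ^ 3) := by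
    intro p hp
    have hpp := hP p hp
    have hp0 : (0 : ℝ) < p := by exact_mod_cast hpp.pos
    set A := ∑ n ∈ Finset.Icc 1 N, g n * (centredDvd p n : ℂ) with hA
    set B := ∑ n ∈ Finset.Icc 1 N, (if p ∣ n then g n else 0) -
      g p * ∑ n ∈ Finset.Icc 1 (N / p), g n with hB
    have hAeq : A = ∑ n ∈ Finset.Icc 1 N, (if p ∣ n then g n else 0) -
        (1 / p : ℂ) * ∑ n ∈ Finset.Icc 1 N, g n := by
      rw [hA, Finset.mul_sum, ← Finset.sum_sub_distrib]
      refine Finset.sum_congr rfl fun n _ => ?_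
      unfold centredDvd
      by_cases hd : p ∣ n <;> simp [hd] <;> ring
    have hxc : (Real.exp u : ℂ) ≠ 0 := by
      exact_mod_cast hx0.ne'
    have hpc : (p : ℂ) ≠ 0 := by exact_mod_cast hpp.ne_zero
    -- `A` is the fluctuation controlled by the dual Turán–Kubilius inequality, `B` the defect of
    -- multiplicativity. Squaring and summing with weights `1 / p`, they contribute the `4` and the
    -- `8 * ∑ 1 / n ^ 3` of `tkConst`.
    have hdiff : logMean g u - g p * logMean g (u - Real.log p) = (p / x : ℂ) * (B - A) := by
      have e1 : Real.exp (u - Real.log p) = x / p := by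
        rw [Real.exp_sub, Real.exp_log hp0]
      have e2 : Real.exp (-(u - Real.log p)) = p / x := by
        rw [Real.exp_neg, e1, inv_div]
      have e3 : Real.exp (-u) = 1 / x := by rw [Real.exp_neg, hx, one_div]
      unfold logMean partialSum
      rw [e2, e3, e1, Nat.floor_div_natCast, ← hx, ← hN, hAeq, hB]
      have hxc' : (x : ℂ) ≠ 0 := by exact_mod_cast hx0.ne'
      push_cast
      field_simp
      ring
    have hBle : ‖B‖ ≤ 2 * x / p ^ 2 := by
      refine (norm_sum_multiples_sub_le hg N hpp).trans ?_
      gcongr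
    have hBA : ‖B - A‖ ^ 2 ≤ 2 * (2 * x / p ^ 2) ^ 2 + 2 * ‖A‖ ^ 2 := by
      have h1 : ‖B - A‖ ≤ 2 * x / p ^ 2 + ‖A‖ := (norm_sub_le _ _).trans (by gcongr)
      have h2 := pow_le_pow_left₀ (norm_nonneg _) h1 2
      nlinarith [sq_nonneg (2 * x / p ^ 2 - ‖A‖)]
    rw [hdiff, norm_mul, mul_pow, norm_div, Complex.norm_natCast, Complex.norm_real,
      Real.norm_of_nonneg hx0.le]
    calc (1 / p : ℝ) * ((p / x : ℝ) ^ 2 * ‖B - A‖ ^ 2)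
        ≤ (1 / p : ℝ) * ((p / x : ℝ) ^ 2 * (2 * (2 * x / p ^ 2) ^ 2 + 2 * ‖A‖ ^ 2)) := by gcongr
      _ = _ := by
        field_simp
        ring
  refine (Finset.sum_le_sum hterm).trans ?_
  rw [Finset.sum_add_distrib, ← Finset.mul_sum, ← Finset.mul_sum]
  have h1 : 2 / x ^ 2 * ∑ p ∈ P, (p : ℝ) *
      ‖∑ n ∈ Finset.Icc 1 N, g n * (centredDvd p n : ℂ)‖ ^ 2 ≤ 4 := by
    calc _ ≤ 2 / x ^ 2 * (2 * x * x) := by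
          refine mul_le_mul_of_nonneg_left (htk.trans ?_) (by positivity)
          gcongr
          exact hone.trans hNx
      _ = 4 := by field_simp; norm_num
  have h2 := sum_inv_cube_le P
  unfold tkConst
  linarith

/-! ### Plancherel with a Gaussian weight -/

open MeasureTheory in
/-- The Fourier transform `∫ e^{-iξu} ψ(u) du`. -/
noncomputable def fourierTr (ψ : ℝ → ℂ) (ξ : ℝ) : ℂ :=
  ∫ u : ℝ, Complex.exp (-(Complex.I * ξ * u)) * ψ u

open MeasureTheory in
/-- The autocorrelation `∫ ψ(u) conj ψ(u + h) du`. -/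
noncomputable def autocorr (ψ : ℝ → ℂ) (h : ℝ) : ℂ :=
  ∫ u, ψ u * starRingEnd ℂ (ψ (u + h))

open MeasureTheory in
/-- The energy of `ψ` weighted by the Gaussian `e^{-aξ²}` in frequency. -/
noncomputable def gaussEnergy (a : ℝ) (ψ : ℝ → ℂ) : ℝ :=
  ∫ ξ, Real.exp (-a * ξ ^ 2) * ‖fourierTr ψ ξ‖ ^ 2

lemma norm_exp_neg_I_mul (ξ u : ℝ) : ‖Complex.exp (-(Complex.I * ξ * u))‖ = 1 := by
  rw [show -(Complex.I * ξ * u) = ((-(ξ * u) : ℝ) : ℂ) * Complex.I by push_cast; ring,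
    Complex.norm_exp_ofReal_mul_I]

lemma norm_exp_I_mul (ξ u : ℝ) : ‖Complex.exp (Complex.I * ξ * u)‖ = 1 := by
  rw [show Complex.I * ξ * u = ((ξ * u : ℝ) : ℂ) * Complex.I by push_cast; ring,
    Complex.norm_exp_ofReal_mul_I]

section
open MeasureTheory

variable {ψ : ℝ → ℂ}

lemma integrable_exp_mul (hψ : Integrable ψ) (ξ : ℝ) :
    Integrable fun u : ℝ => Complex.exp (-(Complex.I * ξ * u)) * ψ u :=
  hψ.bdd_mul (c := 1) (by fun_prop) (Eventually.of_forall fun u => (norm_exp_neg_I_mul ξ u).le)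

lemma norm_fourierTr_le (ψ : ℝ → ℂ) (ξ : ℝ) : ‖fourierTr ψ ξ‖ ≤ ∫ u, ‖ψ u‖ := by
  refine (norm_integral_le_integral_norm _).trans (le_of_eq ?_)
  simp only [norm_mul, norm_exp_neg_I_mul, one_mul]

lemma continuous_fourierTr (hψ : Integrable ψ) : Continuous (fourierTr ψ) := by
  unfold fourierTr
  refine continuous_of_dominated (bound := fun u => ‖ψ u‖) (fun ξ => ?_) (fun ξ => ?_) hψ.norm ?_
  · exact (integrable_exp_mul hψ ξ).aestronglyMeasurable
  · exact Eventually.of_forall fun u => by rw [norm_mul, norm_exp_neg_I_mul, one_mul]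
  · exact Eventually.of_forall fun u => by fun_prop

lemma integrable_gauss_mul_sq {a : ℝ} (ha : 0 < a) (hψ : Integrable ψ) :
    Integrable fun ξ : ℝ => Real.exp (-a * ξ ^ 2) * ‖fourierTr ψ ξ‖ ^ 2 := by
  refine (integrable_exp_neg_mul_sq ha).mul_bdd (c := (∫ u, ‖ψ u‖) ^ 2) ?_ ?_
  · exact ((continuous_fourierTr hψ).norm.pow 2).aestronglyMeasurable
  · refine Eventually.of_forall fun ξ => ?_
    rw [Real.norm_of_nonneg (by positivity)]
    exact pow_le_pow_left₀ (norm_nonneg _) (norm_fourierTr_le ψ ξ) 2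

/-- The shear `(u, h) ↦ (u, u + h)` preserves measure and carries this function to a product of
integrable functions. It justifies the uses of Fubini below. -/
lemma integrable_shear (hψ : Integrable ψ) :
    Integrable (fun z : ℝ × ℝ => ψ z.1 * starRingEnd ℂ (ψ (z.1 + z.2)))
      ((volume : Measure ℝ).prod volume) := by
  have hc : Integrable fun u => starRingEnd ℂ (ψ u) :=
    (Complex.conjCLE.toContinuousLinearMap.integrable_comp hψ)
  have h1 := Integrable.mul_prod hψ hc
  exact ((measurePreserving_prod_add volume volume).integrable_comp h1.aestronglyMeasurable).2 h1

lemma integrable_autocorr (hψ : Integrable ψ) : Integrable (autocorr ψ) :=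
  (integrable_shear hψ).integral_prod_right

/-- Wiener–Khinchin: expand the square as a double integral and substitute `v = u + h`. -/
lemma norm_fourierTr_sq (hψ : Integrable ψ) (ξ : ℝ) :
    ((‖fourierTr ψ ξ‖ ^ 2 : ℝ) : ℂ) = ∫ h : ℝ, Complex.exp (Complex.I * ξ * h) * autocorr ψ h := by
  have hconj : starRingEnd ℂ (fourierTr ψ ξ) =
      ∫ v : ℝ, Complex.exp (Complex.I * ξ * v) * starRingEnd ℂ (ψ v) := by
    unfold fourierTr
    rw [← integral_conj]
    refine integral_congr_ae (Eventually.of_forall fun v => ?_)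
    simp only [map_mul, ← Complex.exp_conj, map_neg, Complex.conj_I, Complex.conj_ofReal]
    ring_nf
  have h1 : ((‖fourierTr ψ ξ‖ ^ 2 : ℝ) : ℂ) = ∫ u : ℝ, ∫ h : ℝ,
      Complex.exp (Complex.I * ξ * h) * (ψ u * starRingEnd ℂ (ψ (u + h))) := by
    push_cast
    rw [← Complex.mul_conj', hconj]
    conv_lhs => rw [fourierTr]
    rw [← integral_mul_const]
    refine integral_congr_ae (Eventually.of_forall fun u => ?_)
    simp only
    rw [← integral_add_left_eq_self (fun v : ℝ =>
      Complex.exp (Complex.I * ξ * v) * starRingEnd ℂ (ψ v)) u, ← integral_const_mul]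
    refine integral_congr_ae (Eventually.of_forall fun h => ?_)
    simp only
    have : Complex.exp (-(Complex.I * ξ * u)) * Complex.exp (Complex.I * ξ * (u + h : ℝ)) =
        Complex.exp (Complex.I * ξ * h) := by
      rw [← Complex.exp_add]
      congr 1
      push_cast
      ring
    rw [← this]
    ring
  rw [h1, integral_integral_swap]
  · refine integral_congr_ae (Eventually.of_forall fun h => ?_)
    simp only
    rw [integral_const_mul, autocorr]
  · refine (integrable_shear hψ).bdd_mul (c := 1) ?_ ?_
    · exact Continuous.aestronglyMeasurable (by fun_prop)
    · exact Eventually.of_forall fun z => (norm_exp_I_mul ξ z.2).le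

lemma integral_gauss_fourier {a : ℝ} (ha : 0 < a) (h : ℝ) :
    ∫ ξ : ℝ, ((Real.exp (-a * ξ ^ 2) : ℝ) : ℂ) * Complex.exp (Complex.I * ξ * h) =
      ((√(Real.pi / a) * Real.exp (-(1 / (4 * a)) * h ^ 2) : ℝ) : ℂ) := by
  have h1 := fourierIntegral_gaussian (b := (a : ℂ)) (by simpa using ha) (h : ℂ)
  have h2 : ∫ ξ : ℝ, ((Real.exp (-a * ξ ^ 2) : ℝ) : ℂ) * Complex.exp (Complex.I * ξ * h) =
      ∫ x : ℝ, Complex.exp (Complex.I * h * x) * Complex.exp (-(a : ℂ) * x ^ 2) := by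
    refine integral_congr_ae (Eventually.of_forall fun ξ => ?_)
    simp only
    push_cast
    rw [mul_comm]
    congr 2
    ring
  rw [h2, h1, Real.sqrt_eq_rpow]
  push_cast
  rw [Complex.ofReal_cpow (by positivity)]
  push_cast
  congr 2
  field_simp

/-- The Gaussian makes the double integral in `ξ` and `h` absolutely convergent, so that Fubini and
the explicit transform of the Gaussian suffice. Both bounds on the energy are read off from the
autocorrelation. -/
lemma gaussEnergy_eq_autocorr {a : ℝ} (ha : 0 < a) (hψ : Integrable ψ) :
    gaussEnergy a ψ =
      √(Real.pi / a) * ∫ h, Real.exp (-(1 / (4 * a)) * h ^ 2) * (autocorr ψ h).re := by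
  have h1 : ((gaussEnergy a ψ : ℝ) : ℂ) = ∫ h : ℝ,
      ((√(Real.pi / a) * Real.exp (-(1 / (4 * a)) * h ^ 2) : ℝ) : ℂ) * autocorr ψ h := by
    unfold gaussEnergy
    rw [← integral_complex_ofReal]
    have e1 : ∀ ξ : ℝ, ((Real.exp (-a * ξ ^ 2) * ‖fourierTr ψ ξ‖ ^ 2 : ℝ) : ℂ) =
        ∫ h : ℝ, ((Real.exp (-a * ξ ^ 2) : ℝ) : ℂ) *
          (Complex.exp (Complex.I * ξ * h) * autocorr ψ h) := by
      intro ξ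
      rw [integral_const_mul, ← norm_fourierTr_sq hψ ξ]
      push_cast
      ring
    simp_rw [e1]
    rw [integral_integral_swap]
    · refine integral_congr_ae (Eventually.of_forall fun h => ?_)
      simp only
      rw [← integral_gauss_fourier ha h, ← integral_mul_const]
      refine integral_congr_ae (Eventually.of_forall fun ξ => ?_)
      simp only
      ring
    · have h2 : Integrable (fun z : ℝ × ℝ => ((Real.exp (-a * z.1 ^ 2) : ℝ) : ℂ) * autocorr ψ z.2)
          ((volume : Measure ℝ).prod volume) :=
        Integrable.mul_prod (integrable_exp_neg_mul_sq ha).ofReal (integrable_autocorr hψ)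
      have h3 := h2.bdd_mul (c := 1) (f := fun z : ℝ × ℝ => Complex.exp (Complex.I * z.1 * z.2))
        (Continuous.aestronglyMeasurable (by fun_prop))
        (Eventually.of_forall fun z => (norm_exp_I_mul z.1 z.2).le)
      refine h3.congr (Eventually.of_forall fun z => ?_)
      simp only [Function.uncurry]
      ring
  have hint : Integrable fun h : ℝ =>
      ((√(Real.pi / a) * Real.exp (-(1 / (4 * a)) * h ^ 2) : ℝ) : ℂ) * autocorr ψ h := by
    refine (integrable_autocorr hψ).bdd_mul (c := √(Real.pi / a)) (by fun_prop) ?_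
    refine Eventually.of_forall fun h => ?_
    rw [Complex.norm_real, Real.norm_of_nonneg (by positivity)]
    refine mul_le_of_le_one_right (by positivity) (Real.exp_le_one_iff.2 ?_)
    have : 0 ≤ 1 / (4 * a) * h ^ 2 := by positivity
    linarith
  have h2 := congrArg Complex.re h1
  rw [Complex.ofReal_re] at h2
  rw [h2, ← integral_const_mul]
  have h3 := integral_re (𝕜 := ℂ) hint
  simp only [RCLike.re_to_complex] at h3
  rw [← h3]
  refine integral_congr_ae (Eventually.of_forall fun h => ?_)
  simp only [Complex.re_ofReal_mul]
  ring

lemma integrable_sq_of_bdd (hψ : Integrable ψ) {M : ℝ} (hM : ∀ u, ‖ψ u‖ ≤ M) :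
    Integrable fun u => ‖ψ u‖ ^ 2 := by
  have := hψ.norm.bdd_mul (c := M) (f := fun u => ‖ψ u‖) hψ.norm.aestronglyMeasurable
    (Eventually.of_forall fun u => by simpa using hM u)
  simpa only [sq] using this

/-- Polarisation and translation invariance. It shows both that the autocorrelation is at most its
value at `0` and that it is close to it when `ψ` is nearly invariant under translation by `h`. -/
lemma autocorr_re (hψ : Integrable ψ) {M : ℝ} (hM : ∀ u, ‖ψ u‖ ≤ M) (h : ℝ) :
    (autocorr ψ h).re = (∫ u, ‖ψ u‖ ^ 2) - 1 / 2 * ∫ u, ‖ψ (u + h) - ψ u‖ ^ 2 := by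
  have hsh : Integrable fun u => ψ (u + h) := hψ.comp_add_right h
  have hc : Integrable fun u => starRingEnd ℂ (ψ (u + h)) :=
    Complex.conjCLE.toContinuousLinearMap.integrable_comp hsh
  have hint : Integrable fun u => ψ u * starRingEnd ℂ (ψ (u + h)) :=
    hc.bdd_mul (c := M) hψ.aestronglyMeasurable (Eventually.of_forall hM)
  have h2 : Integrable fun u => ‖ψ u‖ ^ 2 := integrable_sq_of_bdd hψ hM
  have h3 : Integrable fun u => ‖ψ (u + h)‖ ^ 2 := h2.comp_add_right h
  have hre : Integrable fun u => (ψ u * starRingEnd ℂ (ψ (u + h))).re := hint.re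
  have h4 : ∫ u, ‖ψ (u + h) - ψ u‖ ^ 2 = (∫ u, ‖ψ (u + h)‖ ^ 2) + (∫ u, ‖ψ u‖ ^ 2)
      - 2 * ∫ u, (ψ u * starRingEnd ℂ (ψ (u + h))).re := by
    have e := integral_sub (h3.add h2) (hre.const_mul 2)
    simp only [Pi.add_apply] at e
    rw [← integral_add h3 h2, ← integral_const_mul, ← e]
    refine integral_congr_ae (Eventually.of_forall fun u => ?_)
    simp only [← Complex.normSq_eq_norm_sq, Complex.normSq_sub]
    have : (ψ (u + h) * starRingEnd ℂ (ψ u)).re = (ψ u * starRingEnd ℂ (ψ (u + h))).re := by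
      simp only [Complex.mul_re, Complex.conj_re, Complex.conj_im]
      ring
    rw [this]
  have h5 : ∫ u, ‖ψ (u + h)‖ ^ 2 = ∫ u, ‖ψ u‖ ^ 2 :=
    integral_add_right_eq_self (fun u => ‖ψ u‖ ^ 2) h
  have h6 := integral_re (𝕜 := ℂ) hint
  simp only [RCLike.re_to_complex] at h6
  rw [h4, h5, autocorr, ← h6]
  ring

lemma sqrt_mul_integral_gauss {a : ℝ} (ha : 0 < a) :
    √(Real.pi / a) * ∫ h : ℝ, Real.exp (-(1 / (4 * a)) * h ^ 2) = 2 * Real.pi := by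
  rw [integral_gaussian, ← Real.sqrt_mul (by positivity)]
  rw [show Real.pi / a * (Real.pi / (1 / (4 * a))) = (2 * Real.pi) ^ 2 by field_simp; ring]
  exact Real.sqrt_sq (by positivity)

/-- The upper half of Plancherel, uniform in `a`. The factor `2 * π` comes from the unnormalised
transform. -/
lemma gaussEnergy_le {a : ℝ} (ha : 0 < a) (hψ : Integrable ψ) {M : ℝ} (hM : ∀ u, ‖ψ u‖ ≤ M) :
    gaussEnergy a ψ ≤ 2 * Real.pi * ∫ u, ‖ψ u‖ ^ 2 := by
  have ha4 : 0 < 1 / (4 * a) := by positivity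
  rw [gaussEnergy_eq_autocorr ha hψ, ← sqrt_mul_integral_gauss ha, mul_assoc, ← integral_mul_const]
  refine mul_le_mul_of_nonneg_left (integral_mono ?_ ?_ fun h => ?_) (by positivity)
  · refine ((integrable_autocorr hψ).re).bdd_mul (c := 1)
      (f := fun h : ℝ => Real.exp (-(1 / (4 * a)) * h ^ 2)) (by fun_prop) ?_
    refine Eventually.of_forall fun h => ?_
    rw [Real.norm_of_nonneg (by positivity), Real.exp_le_one_iff]
    have : 0 ≤ 1 / (4 * a) * h ^ 2 := by positivity
    linarith
  · exact (integrable_exp_neg_mul_sq ha4).mul_const _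
  · simp only
    rw [autocorr_re hψ hM]
    have : 0 ≤ ∫ u, ‖ψ (u + h) - ψ u‖ ^ 2 := integral_nonneg fun u => by positivity
    exact mul_le_mul_of_nonneg_left (by linarith) (by positivity)

/-- Use `|h| ≤ √a + h ^ 2 / √a` and let half of the Gaussian's exponent absorb `h ^ 2`. This bounds
the first absolute moment by Gaussian integrals alone. -/
lemma abs_mul_gauss_le {a : ℝ} (ha : 0 < a) (h : ℝ) :
    |h| * Real.exp (-(1 / (4 * a)) * h ^ 2) ≤ √a * Real.exp (-(1 / (4 * a)) * h ^ 2)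
      + 8 * √a * Real.exp (-(1 / (4 * (2 * a))) * h ^ 2) := by
  set s := √a with hs
  have hs0 : 0 < s := Real.sqrt_pos.2 ha
  have hsq : s ^ 2 = a := Real.sq_sqrt ha.le
  set E := Real.exp (-(1 / (4 * (2 * a))) * h ^ 2) with hE
  have hE0 : 0 < E := Real.exp_pos _
  have hEE : Real.exp (-(1 / (4 * a)) * h ^ 2) = E * E := by
    rw [hE, ← Real.exp_add]
    congr 1
    field_simp
    ring
  have h1 : |h| ≤ s + h ^ 2 / s := by
    have : |h| * s ≤ s ^ 2 + h ^ 2 := by nlinarith [sq_abs h, sq_nonneg (|h| - s), abs_nonneg h]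
    calc |h| = |h| * s / s := by field_simp
      _ ≤ (s ^ 2 + h ^ 2) / s := by gcongr
      _ = _ := by field_simp
  have h2 : h ^ 2 * E ≤ 8 * a := by
    have h3 : h ^ 2 / (8 * a) ≤ Real.exp (h ^ 2 / (8 * a)) :=
      (by linarith [Real.add_one_le_exp (h ^ 2 / (8 * a))])
    have h4 : E = (Real.exp (h ^ 2 / (8 * a)))⁻¹ := by
      rw [hE, ← Real.exp_neg]
      congr 1
      ring
    rw [h4, ← div_eq_mul_inv, div_le_iff₀ (Real.exp_pos _)]
    rw [div_le_iff₀ (by positivity)] at h3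
    linarith
  rw [hEE]
  calc |h| * (E * E) ≤ (s + h ^ 2 / s) * (E * E) := by gcongr
    _ = s * (E * E) + (h ^ 2 * E) / s * E := by ring
    _ ≤ s * (E * E) + (8 * a) / s * E := by gcongr
    _ = _ := by
      rw [← hsq]
      field_simp

lemma sqrt_mul_integral_abs_gauss_le {a : ℝ} (ha : 0 < a) :
    √(Real.pi / a) * ∫ h : ℝ, |h| * Real.exp (-(1 / (4 * a)) * h ^ 2) ≤ 36 * Real.pi * √a := by
  have h1 : Integrable fun h : ℝ => √a * Real.exp (-(1 / (4 * a)) * h ^ 2) :=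
    (integrable_exp_neg_mul_sq (by positivity)).const_mul _
  have h2 : Integrable fun h : ℝ => 8 * √a * Real.exp (-(1 / (4 * (2 * a))) * h ^ 2) :=
    (integrable_exp_neg_mul_sq (by positivity)).const_mul _
  have h3 : ∫ h : ℝ, |h| * Real.exp (-(1 / (4 * a)) * h ^ 2) ≤
      √a * (∫ h : ℝ, Real.exp (-(1 / (4 * a)) * h ^ 2)) +
        8 * √a * ∫ h : ℝ, Real.exp (-(1 / (4 * (2 * a))) * h ^ 2) := by
    rw [← integral_const_mul, ← integral_const_mul, ← integral_add h1 h2]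
    refine integral_mono_of_nonneg (Eventually.of_forall fun h => by positivity) (h1.add h2)
      (Eventually.of_forall fun h => abs_mul_gauss_le ha h)
  have h4 := sqrt_mul_integral_gauss ha
  have h5 := sqrt_mul_integral_gauss (a := 2 * a) (by positivity)
  have h6 : √(Real.pi / a) ≤ 2 * √(Real.pi / (2 * a)) := by
    rw [show (2 : ℝ) = √4 by rw [show (4 : ℝ) = 2 ^ 2 by norm_num]; simp, ← Real.sqrt_mul (by norm_num)]
    refine Real.sqrt_le_sqrt ?_
    rw [show √4 = (2 : ℝ) by rw [show (4 : ℝ) = 2 ^ 2 by norm_num]; simp]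
    rw [show 4 * (Real.pi / (2 * a)) = 2 * (Real.pi / a) by field_simp; norm_num]
    have : 0 ≤ Real.pi / a := by positivity
    linarith
  have hG : 0 ≤ ∫ h : ℝ, Real.exp (-(1 / (4 * (2 * a))) * h ^ 2) :=
    integral_nonneg fun h => by positivity
  have h7 : √(Real.pi / a) * ∫ h : ℝ, Real.exp (-(1 / (4 * (2 * a))) * h ^ 2) ≤ 4 * Real.pi := by
    calc _ ≤ 2 * √(Real.pi / (2 * a)) * ∫ h : ℝ, Real.exp (-(1 / (4 * (2 * a))) * h ^ 2) := by
          gcongr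
      _ = 4 * Real.pi := by rw [mul_assoc, h5]; ring
  calc _ ≤ √(Real.pi / a) * (√a * (∫ h : ℝ, Real.exp (-(1 / (4 * a)) * h ^ 2)) +
        8 * √a * ∫ h : ℝ, Real.exp (-(1 / (4 * (2 * a))) * h ^ 2)) := by gcongr
    _ = √a * (√(Real.pi / a) * ∫ h : ℝ, Real.exp (-(1 / (4 * a)) * h ^ 2)) +
        8 * √a * (√(Real.pi / a) * ∫ h : ℝ, Real.exp (-(1 / (4 * (2 * a))) * h ^ 2)) := by ring
    _ ≤ √a * (2 * Real.pi) + 8 * √a * (4 * Real.pi) := by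
      rw [h4]
      gcongr
    _ ≤ _ := by
      have : 0 ≤ √a * Real.pi := by positivity
      nlinarith

/-- A function that is nearly invariant under small translations has nearly all of its energy at
low frequencies. -/
lemma le_gaussEnergy {a : ℝ} (ha : 0 < a) (hψ : Integrable ψ) {M : ℝ} (hM : ∀ u, ‖ψ u‖ ≤ M)
    {A B : ℝ} (hAB : ∀ h, ∫ u, ‖ψ (u + h) - ψ u‖ ^ 2 ≤ A * |h| + B) (hA : 0 ≤ A) :
    2 * Real.pi * ∫ u, ‖ψ u‖ ^ 2 ≤
      gaussEnergy a ψ + 18 * Real.pi * √a * A + Real.pi * B := by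
  set I := ∫ u, ‖ψ u‖ ^ 2 with hI
  have ha4 : 0 < 1 / (4 * a) := by positivity
  have i1 : Integrable fun h : ℝ => Real.exp (-(1 / (4 * a)) * h ^ 2) := integrable_exp_neg_mul_sq ha4
  have i2 : Integrable fun h : ℝ => |h| * Real.exp (-(1 / (4 * a)) * h ^ 2) := by
    have := (integrable_mul_exp_neg_mul_sq ha4).norm
    refine this.congr (Eventually.of_forall fun h => ?_)
    simp
  have i3 : Integrable fun h : ℝ => Real.exp (-(1 / (4 * a)) * h ^ 2) * (autocorr ψ h).re := by
    refine ((integrable_autocorr hψ).re).bdd_mul (c := 1)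
      (f := fun h : ℝ => Real.exp (-(1 / (4 * a)) * h ^ 2)) (by fun_prop) ?_
    refine Eventually.of_forall fun h => ?_
    rw [Real.norm_of_nonneg (by positivity), Real.exp_le_one_iff]
    have : 0 ≤ 1 / (4 * a) * h ^ 2 := by positivity
    linarith
  -- The translation bound is inserted in `autocorr_re` and averaged over `h`. After normalisation
  -- the Gaussian has mass `2 * π` and first absolute moment at most `36 * π * √a`, of which half
  -- enters.
  have h1 : (I - 1 / 2 * B) * (∫ h : ℝ, Real.exp (-(1 / (4 * a)) * h ^ 2)) -
      1 / 2 * A * (∫ h : ℝ, |h| * Real.exp (-(1 / (4 * a)) * h ^ 2)) ≤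
      ∫ h, Real.exp (-(1 / (4 * a)) * h ^ 2) * (autocorr ψ h).re := by
    rw [← integral_const_mul, ← integral_const_mul, ← integral_sub (i1.const_mul _) (i2.const_mul _)]
    refine integral_mono ((i1.const_mul _).sub (i2.const_mul _)) i3 fun h => ?_
    simp only
    rw [autocorr_re hψ hM, ← hI]
    have h2 := hAB h
    have h3 : I - 1 / 2 * B - 1 / 2 * A * |h| ≤ I - 1 / 2 * ∫ u, ‖ψ (u + h) - ψ u‖ ^ 2 := by linarith
    have h4 := mul_le_mul_of_nonneg_left h3 (Real.exp_pos (-(1 / (4 * a)) * h ^ 2)).le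
    linarith
  have h2 := mul_le_mul_of_nonneg_left h1 (Real.sqrt_nonneg (Real.pi / a))
  rw [← gaussEnergy_eq_autocorr ha hψ] at h2
  have h3 := sqrt_mul_integral_gauss ha
  have h4 := mul_le_mul_of_nonneg_left (sqrt_mul_integral_abs_gauss_le ha) hA
  have h5 : √(Real.pi / a) * ((I - 1 / 2 * B) * (∫ h : ℝ, Real.exp (-(1 / (4 * a)) * h ^ 2)) -
      1 / 2 * A * (∫ h : ℝ, |h| * Real.exp (-(1 / (4 * a)) * h ^ 2))) =
      (I - 1 / 2 * B) * (√(Real.pi / a) * ∫ h : ℝ, Real.exp (-(1 / (4 * a)) * h ^ 2)) -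
      1 / 2 * (A * (√(Real.pi / a) * ∫ h : ℝ, |h| * Real.exp (-(1 / (4 * a)) * h ^ 2))) := by ring
  rw [h5, h3] at h2
  linarith

end

/-! ### Mean square decay of the mean values -/

lemma norm_partialSum_sub_le {g : ℕ → ℂ} (hg : ∀ n, 0 < n → ‖g n‖ ≤ 1) {x y : ℝ} (hx : 0 ≤ x)
    (hxy : x ≤ y) : ‖partialSum g y - partialSum g x‖ ≤ y - x + 1 := by
  have hfl : ⌊x⌋₊ ≤ ⌊y⌋₊ := Nat.floor_le_floor hxy
  have h1 : partialSum g y - partialSum g x = ∑ n ∈ Finset.Ioc ⌊x⌋₊ ⌊y⌋₊, g n := by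
    unfold partialSum
    rw [sub_eq_iff_eq_add, add_comm]
    exact (Finset.sum_Ioc_consecutive g (Nat.zero_le _) hfl).symm
  rw [h1]
  refine (norm_sum_le_card hg _ fun n hn => (Nat.zero_le _).trans_lt (Finset.mem_Ioc.1 hn).1).trans ?_
  rw [Nat.card_Ioc, Nat.cast_sub hfl]
  have h2 := Nat.floor_le (hx.trans hxy)
  have h3 := Nat.lt_floor_add_one x
  linarith

/-- The mean value varies slowly on the logarithmic scale. -/
lemma norm_logMean_add_sub_le {g : ℕ → ℂ} (hg : ∀ n, 0 < n → ‖g n‖ ≤ 1) (u : ℝ) {h : ℝ}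
    (hh : 0 ≤ h) : ‖logMean g (u + h) - logMean g u‖ ≤ 2 * h + Real.exp (-u) := by
  set x := Real.exp u with hx
  set y := Real.exp (u + h) with hy
  have hx0 : 0 < x := Real.exp_pos _
  have hy0 : 0 < y := Real.exp_pos _
  have hxy : x ≤ y := Real.exp_le_exp.2 (by linarith)
  have hxe : Real.exp (-u) = x⁻¹ := by rw [Real.exp_neg]
  have hye : Real.exp (-(u + h)) = y⁻¹ := by rw [Real.exp_neg]
  have h1 : logMean g (u + h) - logMean g u =
      (partialSum g y - partialSum g x) * (y⁻¹ : ℝ) - partialSum g x * ((x⁻¹ - y⁻¹ : ℝ) : ℂ) := by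
    unfold logMean
    rw [hxe, hye, ← hx, ← hy]
    push_cast
    ring
  have hinv : y⁻¹ ≤ x⁻¹ := inv_anti₀ hx0 hxy
  have hratio : 1 - h ≤ x / y := by
    rw [hx, hy, ← Real.exp_sub]
    have := Real.add_one_le_exp (u - (u + h))
    linarith
  rw [h1, hxe]
  calc _ ≤ ‖(partialSum g y - partialSum g x) * ((y⁻¹ : ℝ) : ℂ)‖ +
        ‖partialSum g x * ((x⁻¹ - y⁻¹ : ℝ) : ℂ)‖ := norm_sub_le _ _
    _ ≤ (y - x + 1) * y⁻¹ + x * (x⁻¹ - y⁻¹) := by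
      rw [norm_mul, norm_mul, Complex.norm_real, Complex.norm_real,
        Real.norm_of_nonneg (by positivity), Real.norm_of_nonneg (sub_nonneg.2 hinv)]
      gcongr
      · exact norm_partialSum_sub_le hg hx0.le hxy
      · exact norm_partialSum_le hg hx0.le
    _ = 2 * (1 - x / y) + y⁻¹ := by
      field_simp
      ring
    _ ≤ 2 * h + x⁻¹ := by linarith

/-- The mean value of `g`, cut off to logarithmic scales in `[0, U]`. -/
noncomputable def truncMean (g : ℕ → ℂ) (U : ℝ) : ℝ → ℂ := (Set.Icc 0 U).indicator (logMean g)

section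
open MeasureTheory

variable {g : ℕ → ℂ}

lemma norm_truncMean_le (hg : ∀ n, 0 < n → ‖g n‖ ≤ 1) (U u : ℝ) : ‖truncMean g U u‖ ≤ 1 := by
  unfold truncMean
  by_cases h : u ∈ Set.Icc 0 U
  · rw [Set.indicator_of_mem h]
    exact norm_logMean_le hg u
  · rw [Set.indicator_of_notMem h]
    simp

lemma integrable_indicator_Icc_const (a b c : ℝ) :
    Integrable ((Set.Icc a b).indicator fun _ => c) :=
  (integrable_indicator_iff measurableSet_Icc).2 (by simp)

lemma integral_indicator_Icc_const {a b : ℝ} (hab : a ≤ b) (c : ℝ) :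
    ∫ u, (Set.Icc a b).indicator (fun _ => c) u = (b - a) * c := by
  rw [integral_indicator measurableSet_Icc]
  simp [hab]

lemma integrable_truncMean (hg : ∀ n, 0 < n → ‖g n‖ ≤ 1) (U : ℝ) : Integrable (truncMean g U) := by
  refine (integrable_indicator_Icc_const 0 U 1).mono'
    ((measurable_logMean g).indicator measurableSet_Icc).aestronglyMeasurable
    (Eventually.of_forall fun u => ?_)
  unfold truncMean
  by_cases h : u ∈ Set.Icc 0 U
  · rw [Set.indicator_of_mem h, Set.indicator_of_mem h]
    exact norm_logMean_le hg u
  · rw [Set.indicator_of_notMem h, Set.indicator_of_notMem h]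
    simp

lemma fourierTr_sub_shift {ψ : ℝ → ℂ} (hψ : Integrable ψ) (c : ℂ) (s ξ : ℝ) :
    fourierTr (fun u => ψ u - c * ψ (u - s)) ξ =
      (1 - c * Complex.exp (-(Complex.I * ξ * s))) * fourierTr ψ ξ := by
  have h1 : Integrable fun u : ℝ => Complex.exp (-(Complex.I * ξ * u)) * (c * ψ (u - s)) :=
    integrable_exp_mul ((hψ.comp_sub_right s).const_mul c) ξ
  have h2 : ∫ u : ℝ, Complex.exp (-(Complex.I * ξ * u)) * (c * ψ (u - s)) =
      c * Complex.exp (-(Complex.I * ξ * s)) * fourierTr ψ ξ := by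
    rw [← integral_add_right_eq_self _ s, fourierTr, ← integral_const_mul]
    refine integral_congr_ae (Eventually.of_forall fun u => ?_)
    simp only [add_sub_cancel_right]
    rw [show -(Complex.I * ξ * (u + s : ℝ)) =
      -(Complex.I * ξ * s) + -(Complex.I * ξ * u) by push_cast; ring, Complex.exp_add]
    ring
  have h3 := integral_sub (integrable_exp_mul hψ ξ) h1
  rw [h2] at h3
  rw [fourierTr]
  simp only [mul_sub]
  rw [h3, ← fourierTr]
  ring

lemma integral_norm_truncMean_shift_sq_le (hg : ∀ n, 0 < n → ‖g n‖ ≤ 1) {U : ℝ} (hU : 0 ≤ U)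
    {h : ℝ} (hh : 0 ≤ h) :
    ∫ u, ‖truncMean g U (u + h) - truncMean g U u‖ ^ 2 ≤ (4 * U + 2) * h + 2 := by
  set F : ℝ → ℝ := ((Set.Icc (-h) 0).indicator (fun _ => (1 : ℝ)) +
    (Set.Icc (U - h) U).indicator (fun _ => (1 : ℝ))) +
    ((Set.Icc 0 U).indicator (fun _ => 4 * h) +
      (Set.Ici 0).indicator (fun u => 2 * Real.exp (-u))) with hF
  have hexp : IntegrableOn (fun u : ℝ => 2 * Real.exp (-u)) (Set.Ici 0) := by
    rw [integrableOn_Ici_iff_integrableOn_Ioi]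
    exact (integrableOn_exp_neg_Ioi 0).const_mul 2
  have i1 := integrable_indicator_Icc_const (-h) 0 1
  have i2 := integrable_indicator_Icc_const (U - h) U 1
  have i3 := integrable_indicator_Icc_const 0 U (4 * h)
  have i4 := (integrable_indicator_iff measurableSet_Ici).2 hexp
  have hint : ∫ u, F u = (4 * U + 2) * h + 2 := by
    rw [hF, integral_add' (i1.add i2) (i3.add i4), integral_add' i1 i2, integral_add' i3 i4,
      integral_indicator_Icc_const (by linarith), integral_indicator_Icc_const (by linarith),
      integral_indicator_Icc_const hU, integral_indicator measurableSet_Ici,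
      integral_Ici_eq_integral_Ioi, integral_const_mul, integral_exp_neg_Ioi]
    simp
    ring
  rw [← hint]
  refine integral_mono_of_nonneg (Eventually.of_forall fun u => by positivity)
    ((i1.add i2).add (i3.add i4)) (Eventually.of_forall fun u => ?_)
  have n1 : 0 ≤ (Set.Icc (-h) 0).indicator (fun _ => (1 : ℝ)) u :=
    Set.indicator_nonneg (fun _ _ => zero_le_one) _
  have n2 : 0 ≤ (Set.Icc (U - h) U).indicator (fun _ => (1 : ℝ)) u :=
    Set.indicator_nonneg (fun _ _ => zero_le_one) _
  have n3 : 0 ≤ (Set.Icc 0 U).indicator (fun _ => 4 * h) u :=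
    Set.indicator_nonneg (fun _ _ => by linarith) _
  have n4 : 0 ≤ (Set.Ici 0).indicator (fun u => 2 * Real.exp (-u)) u :=
    Set.indicator_nonneg (fun _ _ => by positivity) _
  simp only [hF, Pi.add_apply]
  by_cases h0 : u ∈ Set.Icc 0 U
  · by_cases h1 : u + h ∈ Set.Icc 0 U
    · have e3 := Set.indicator_of_mem h0 (fun _ : ℝ => 4 * h)
      have e4 := Set.indicator_of_mem (s := Set.Ici (0 : ℝ)) h0.1 (fun u => 2 * Real.exp (-u))
      have e : ‖truncMean g U (u + h) - truncMean g U u‖ ≤ 2 * h + Real.exp (-u) := by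
        unfold truncMean
        rw [Set.indicator_of_mem h0, Set.indicator_of_mem h1]
        exact norm_logMean_add_sub_le hg u hh
      have e2 : ‖truncMean g U (u + h) - truncMean g U u‖ ≤ 2 := by
        refine (norm_sub_le _ _).trans ?_
        linarith [norm_truncMean_le hg U (u + h), norm_truncMean_le hg U u]
      rw [e3, e4]
      nlinarith [norm_nonneg (truncMean g U (u + h) - truncMean g U u)]
    · have h2 : u ∈ Set.Icc (U - h) U := by
        refine ⟨?_, h0.2⟩
        by_contra hc
        exact h1 ⟨by linarith [h0.1], by linarith⟩
      rw [Set.indicator_of_mem h2]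
      rw [show truncMean g U (u + h) = 0 from Set.indicator_of_notMem h1 _, zero_sub, norm_neg]
      have := pow_le_one₀ (n := 2) (norm_nonneg _) (norm_truncMean_le hg U u)
      linarith
  · rw [show truncMean g U u = 0 from Set.indicator_of_notMem h0 _, sub_zero]
    by_cases h1 : u + h ∈ Set.Icc 0 U
    · have h2 : u ∈ Set.Icc (-h) 0 := by
        refine ⟨by linarith [h1.1], ?_⟩
        by_contra hc
        exact h0 ⟨by linarith, by linarith [h1.2]⟩
      rw [Set.indicator_of_mem h2]
      have := pow_le_one₀ (n := 2) (norm_nonneg _) (norm_truncMean_le hg U (u + h))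
      linarith
    · rw [show truncMean g U (u + h) = 0 from Set.indicator_of_notMem h1 _]
      simp only [norm_zero, ne_eq, OfNat.ofNat_ne_zero, not_false_eq_true, zero_pow]
      linarith

lemma integral_norm_truncMean_shift_sq_le_abs (hg : ∀ n, 0 < n → ‖g n‖ ≤ 1) {U : ℝ} (hU : 0 ≤ U)
    (h : ℝ) :
    ∫ u, ‖truncMean g U (u + h) - truncMean g U u‖ ^ 2 ≤ (4 * U + 2) * |h| + 2 := by
  rcases le_total 0 h with hh | hh
  · rw [abs_of_nonneg hh]
    exact integral_norm_truncMean_shift_sq_le hg hU hh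
  · rw [abs_of_nonpos hh]
    have h1 := integral_norm_truncMean_shift_sq_le hg hU (neg_nonneg.2 hh)
    rw [← integral_add_right_eq_self _ h] at h1
    refine le_trans (le_of_eq ?_) h1
    refine integral_congr_ae (Eventually.of_forall fun u => ?_)
    simp only [add_neg_cancel_right]
    rw [norm_sub_rev]

lemma integral_sum_norm_truncMean_sub_sq_le (hg : IsMultOfModulusLeOne g) (P : Finset ℕ)
    (hP : ∀ p ∈ P, p.Prime) {L : ℝ} (hL : 0 ≤ L) (hPL : ∀ p ∈ P, Real.log p ≤ L) {U : ℝ}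
    (hU : 0 ≤ U) :
    ∫ u, ∑ p ∈ P, (1 / p : ℝ) * ‖truncMean g U u - g p * truncMean g U (u - Real.log p)‖ ^ 2 ≤
      tkConst * U + 12 * L * P.card := by
  have hg1 := hg.norm_le_one
  -- Where the cutoff and the condition `p ^ 2 ≤ e ^ u` cause no trouble the sum is at most
  -- `tkConst`. The trivial bound `4 * P.card` is used for `u ≤ 2 * L`, where that condition may
  -- fail, and on `[U, U + L]`, where only the shifted term may survive.
  set F : ℝ → ℝ := (Set.Icc 0 U).indicator (fun _ => tkConst) +
    ((Set.Icc 0 (2 * L)).indicator (fun _ => (4 * P.card : ℝ)) +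
      (Set.Icc U (U + L)).indicator (fun _ => (4 * P.card : ℝ))) with hF
  have i1 := integrable_indicator_Icc_const 0 U tkConst
  have i2 := integrable_indicator_Icc_const 0 (2 * L) (4 * P.card)
  have i3 := integrable_indicator_Icc_const U (U + L) (4 * P.card)
  have hint : ∫ u, F u = tkConst * U + 12 * L * P.card := by
    rw [hF, integral_add' i1 (i2.add i3), integral_add' i2 i3,
      integral_indicator_Icc_const (by linarith), integral_indicator_Icc_const (by linarith),
      integral_indicator_Icc_const (by linarith)]
    ring
  rw [← hint]
  refine integral_mono_of_nonneg (Eventually.of_forall fun u =>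
    Finset.sum_nonneg fun p _ => by positivity) (i1.add (i2.add i3))
    (Eventually.of_forall fun u => ?_)
  have n1 : 0 ≤ (Set.Icc 0 U).indicator (fun _ => tkConst) u :=
    Set.indicator_nonneg (fun _ _ => tkConst_pos.le) _
  have n2 : 0 ≤ (Set.Icc 0 (2 * L)).indicator (fun _ => (4 * P.card : ℝ)) u :=
    Set.indicator_nonneg (fun _ _ => by positivity) _
  have n3 : 0 ≤ (Set.Icc U (U + L)).indicator (fun _ => (4 * P.card : ℝ)) u :=
    Set.indicator_nonneg (fun _ _ => by positivity) _
  have hlog0 : ∀ p ∈ P, 0 ≤ Real.log p := fun p hp => Real.log_natCast_nonneg p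
  have htriv : ∑ p ∈ P, (1 / p : ℝ) *
      ‖truncMean g U u - g p * truncMean g U (u - Real.log p)‖ ^ 2 ≤ 4 * P.card := by
    rw [mul_comm, ← nsmul_eq_mul]
    refine Finset.sum_le_card_nsmul _ _ _ fun p hp => ?_
    have hp1 : (1 : ℝ) ≤ p := by exact_mod_cast (hP p hp).one_lt.le
    have e1 : (1 / p : ℝ) ≤ 1 := by
      rw [div_le_one (by linarith)]
      exact hp1
    have e2 : ‖truncMean g U u - g p * truncMean g U (u - Real.log p)‖ ≤ 2 := by
      refine (norm_sub_le _ _).trans ?_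
      rw [norm_mul]
      have := mul_le_one₀ (hg1 p (hP p hp).pos) (norm_nonneg _)
        (norm_truncMean_le hg1 U (u - Real.log p))
      linarith [norm_truncMean_le hg1 U u]
    have e3 := pow_le_pow_left₀ (norm_nonneg _) e2 2
    calc _ ≤ 1 * (2 : ℝ) ^ 2 := by gcongr
      _ = 4 := by norm_num
  simp only [hF, Pi.add_apply]
  by_cases h1 : u ∈ Set.Icc 0 (2 * L)
  · rw [Set.indicator_of_mem h1]
    linarith
  by_cases h2 : u ∈ Set.Icc U (U + L)
  · rw [Set.indicator_of_mem h2]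
    linarith
  by_cases h3 : u ∈ Set.Icc 0 U
  · rw [Set.indicator_of_mem h3]
    have hu2 : 2 * L ≤ u := by
      by_contra hc
      exact h1 ⟨h3.1, by linarith⟩
    have htk := sum_norm_logMean_sub_sq_le hg u P hP fun p hp => by
      have hp0 : (0 : ℝ) < p := by exact_mod_cast (hP p hp).pos
      rw [← Real.log_le_iff_le_exp (by positivity), Real.log_pow]
      have := hPL p hp
      push_cast
      linarith
    refine le_trans (le_of_eq (Finset.sum_congr rfl fun p hp => ?_)) (htk.trans (by linarith))
    have h4 : u - Real.log p ∈ Set.Icc 0 U :=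
      ⟨by linarith [hPL p hp], by linarith [hlog0 p hp, h3.2]⟩
    unfold truncMean
    rw [Set.indicator_of_mem h3, Set.indicator_of_mem h4]
  · have : ∑ p ∈ P, (1 / p : ℝ) *
        ‖truncMean g U u - g p * truncMean g U (u - Real.log p)‖ ^ 2 = 0 := by
      refine Finset.sum_eq_zero fun p hp => ?_
      have h4 : u - Real.log p ∉ Set.Icc 0 U := by
        intro h5
        refine h3 ⟨by linarith [hlog0 p hp, h5.1], ?_⟩
        by_contra hc
        exact h2 ⟨by linarith, by linarith [h5.2, hPL p hp]⟩
      unfold truncMean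
      rw [Set.indicator_of_notMem h3, Set.indicator_of_notMem h4]
      simp
    rw [this]
    linarith

/-- The square distance from `g p` to `p ^ {iξ}`, summed over the primes `p ∈ P` with weights
`1 / p`. -/
noncomputable def sqDist (g : ℕ → ℂ) (P : Finset ℕ) (ξ : ℝ) : ℝ :=
  ∑ p ∈ P, (1 / p : ℝ) * ‖1 - g p * Complex.exp (-(Complex.I * ξ * Real.log p))‖ ^ 2

/-- On the Fourier side the relations for `p ∈ P` bound the energy weighted by `sqDist g P`.
Dividing by `K` handles `|ξ| ≤ T`. Beyond `T`, half of the Gaussian gives the factor `exp (-(a / 2)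
* T ^ 2)`, and the other half leaves an energy bounded by Plancherel. -/
lemma gaussEnergy_truncMean_le (hg : IsMultOfModulusLeOne g) (P : Finset ℕ)
    (hP : ∀ p ∈ P, p.Prime) {L : ℝ} (hL : 0 ≤ L) (hPL : ∀ p ∈ P, Real.log p ≤ L) {U : ℝ}
    (hU : 0 ≤ U) {K T a : ℝ} (hK : 0 < K) (hT : 0 ≤ T) (ha : 0 < a)
    (hKT : ∀ ξ : ℝ, |ξ| ≤ T → K ≤ sqDist g P ξ) :
    gaussEnergy a (truncMean g U) ≤
      2 * Real.pi / K * (tkConst * U + 12 * L * P.card) +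
        Real.exp (-(a / 2) * T ^ 2) * (2 * Real.pi * U) := by
  have hg1 := hg.norm_le_one
  set ψ := truncMean g U with hψ
  have hint : Integrable ψ := integrable_truncMean hg1 U
  have hbd : ∀ u, ‖ψ u‖ ≤ 1 := norm_truncMean_le hg1 U
  have ha2 : 0 < a / 2 := by positivity
  set D : ℕ → ℝ → ℂ := fun p u => ψ u - g p * ψ (u - Real.log p) with hD
  have hDint : ∀ p, Integrable (D p) := fun p =>
    hint.sub ((hint.comp_sub_right _).const_mul _)
  have hDbd : ∀ p ∈ P, ∀ u, ‖D p u‖ ≤ 2 := fun p hp u => by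
    refine (norm_sub_le _ _).trans ?_
    rw [norm_mul]
    have := mul_le_one₀ (hg1 p (hP p hp).pos) (norm_nonneg _) (hbd (u - Real.log p))
    linarith [hbd u]
  have hDsum : ∑ p ∈ P, (1 / p : ℝ) * gaussEnergy a (D p) ≤
      2 * Real.pi * (tkConst * U + 12 * L * P.card) := by
    calc _ ≤ ∑ p ∈ P, (1 / p : ℝ) * (2 * Real.pi * ∫ u, ‖D p u‖ ^ 2) :=
          Finset.sum_le_sum fun p hp =>
            mul_le_mul_of_nonneg_left (gaussEnergy_le ha (hDint p) (hDbd p hp)) (by positivity)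
      _ = 2 * Real.pi * ∫ u, ∑ p ∈ P, (1 / p : ℝ) * ‖D p u‖ ^ 2 := by
          rw [integral_finsetSum _ fun p hp =>
            (integrable_sq_of_bdd (hDint p) (hDbd p hp)).const_mul _, Finset.mul_sum]
          refine Finset.sum_congr rfl fun p _ => ?_
          rw [integral_const_mul]
          ring
      _ ≤ _ := mul_le_mul_of_nonneg_left
          (integral_sum_norm_truncMean_sub_sq_le hg P hP hL hPL hU) (by positivity)
  have hWeq : ∑ p ∈ P, (1 / p : ℝ) * gaussEnergy a (D p) =
      ∫ ξ, Real.exp (-a * ξ ^ 2) * (sqDist g P ξ * ‖fourierTr ψ ξ‖ ^ 2) := by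
    unfold gaussEnergy
    simp_rw [← integral_const_mul]
    rw [← integral_finsetSum _ fun p _ => (integrable_gauss_mul_sq ha (hDint p)).const_mul _]
    refine integral_congr_ae (Eventually.of_forall fun ξ => ?_)
    simp only [sqDist, Finset.sum_mul, Finset.mul_sum]
    refine Finset.sum_congr rfl fun p _ => ?_
    rw [hD]
    simp only
    rw [fourierTr_sub_shift hint, norm_mul, mul_pow]
    ring
  have hWint : Integrable fun ξ => Real.exp (-a * ξ ^ 2) * (sqDist g P ξ * ‖fourierTr ψ ξ‖ ^ 2) := by
    have := integrable_finsetSum P fun p _ =>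
      (integrable_gauss_mul_sq ha (hDint p)).const_mul (1 / p : ℝ)
    refine this.congr (Eventually.of_forall fun ξ => ?_)
    simp only [sqDist, Finset.sum_mul, Finset.mul_sum]
    refine Finset.sum_congr rfl fun p _ => ?_
    rw [hD]
    simp only
    rw [fourierTr_sub_shift hint, norm_mul, mul_pow]
    ring
  have hhalf : gaussEnergy (a / 2) ψ ≤ 2 * Real.pi * U := by
    refine (gaussEnergy_le ha2 hint hbd).trans (mul_le_mul_of_nonneg_left ?_ (by positivity))
    have h1 : ∫ u, ‖ψ u‖ ^ 2 ≤ ∫ u, (Set.Icc 0 U).indicator (fun _ => (1 : ℝ)) u := by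
      refine integral_mono_of_nonneg (Eventually.of_forall fun u => by positivity)
        (integrable_indicator_Icc_const 0 U 1) (Eventually.of_forall fun u => ?_)
      by_cases h : u ∈ Set.Icc 0 U
      · rw [Set.indicator_of_mem h]
        exact pow_le_one₀ (norm_nonneg _) (hbd u)
      · rw [Set.indicator_of_notMem h]
        simp only
        rw [hψ, truncMean, Set.indicator_of_notMem h]
        simp
    rw [integral_indicator_Icc_const hU] at h1
    linarith
  have hkey : gaussEnergy a ψ ≤ 1 / K * (∑ p ∈ P, (1 / p : ℝ) * gaussEnergy a (D p)) +
      Real.exp (-(a / 2) * T ^ 2) * gaussEnergy (a / 2) ψ := by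
    rw [hWeq]
    unfold gaussEnergy
    rw [← integral_const_mul, ← integral_const_mul,
      ← integral_add (hWint.const_mul _) ((integrable_gauss_mul_sq ha2 hint).const_mul _)]
    refine integral_mono (integrable_gauss_mul_sq ha hint) ((hWint.const_mul _).add
      ((integrable_gauss_mul_sq ha2 hint).const_mul _)) fun ξ => ?_
    simp only
    have hW0 : 0 ≤ sqDist g P ξ := Finset.sum_nonneg fun p _ => by positivity
    have hF0 : 0 ≤ ‖fourierTr ψ ξ‖ ^ 2 := by positivity
    by_cases hξ : |ξ| ≤ T
    · have h1 : 1 ≤ 1 / K * sqDist g P ξ := by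
        rw [one_div, inv_mul_eq_div, le_div_iff₀ hK, one_mul]
        exact hKT ξ hξ
      have h2 : 0 ≤ Real.exp (-(a / 2) * T ^ 2) *
          (Real.exp (-(a / 2) * ξ ^ 2) * ‖fourierTr ψ ξ‖ ^ 2) := by positivity
      have h3 : 0 ≤ Real.exp (-a * ξ ^ 2) * ‖fourierTr ψ ξ‖ ^ 2 := by positivity
      nlinarith
    · have h1 : Real.exp (-a * ξ ^ 2) ≤ Real.exp (-(a / 2) * T ^ 2) *
          Real.exp (-(a / 2) * ξ ^ 2) := by
        rw [← Real.exp_add, Real.exp_le_exp]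
        have h2 : T ^ 2 ≤ ξ ^ 2 := by
          rw [← sq_abs ξ]
          exact pow_le_pow_left₀ hT (not_le.1 hξ).le 2
        nlinarith
      have h2 : 0 ≤ 1 / K * (Real.exp (-a * ξ ^ 2) * (sqDist g P ξ * ‖fourierTr ψ ξ‖ ^ 2)) := by
        positivity
      have h3 := mul_le_mul_of_nonneg_right h1 hF0
      linarith
  refine hkey.trans (add_le_add ?_ ?_)
  · calc _ ≤ 1 / K * (2 * Real.pi * (tkConst * U + 12 * L * P.card)) := by gcongr
      _ = _ := by ring
  · exact mul_le_mul_of_nonneg_left hhalf (Real.exp_pos _).le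

lemma integral_norm_truncMean_sq (U : ℝ) :
    ∫ u, ‖truncMean g U u‖ ^ 2 = ∫ u in Set.Icc 0 U, ‖logMean g u‖ ^ 2 := by
  rw [← integral_indicator measurableSet_Icc]
  refine integral_congr_ae (Eventually.of_forall fun u => ?_)
  simp only [truncMean]
  by_cases h : u ∈ Set.Icc 0 U
  · rw [Set.indicator_of_mem h, Set.indicator_of_mem h]
  · rw [Set.indicator_of_notMem h, Set.indicator_of_notMem h]
    simp

/-- A Dini argument: the partial sums are continuous in `ξ` and increase with the set of primes, so
the open sets where they exceed `K` form a directed cover of the compact `[-T, T]`. -/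
lemma exists_finset_le_sqDist
    (hdiv : ∀ t : ℝ, ¬ Summable fun p : Nat.Primes =>
      (1 / (p : ℕ) : ℝ) * ‖1 - g p * Complex.exp (-(Complex.I * t * Real.log (p : ℕ)))‖ ^ 2)
    (K T : ℝ) : ∃ P : Finset ℕ, (∀ p ∈ P, p.Prime) ∧ ∀ ξ : ℝ, |ξ| ≤ T → K ≤ sqDist g P ξ := by
  let G : Finset Nat.Primes → ℝ → ℝ := fun s ξ => ∑ p ∈ s,
    (1 / (p : ℕ) : ℝ) * ‖1 - g p * Complex.exp (-(Complex.I * ξ * Real.log (p : ℕ)))‖ ^ 2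
  have hmono : ∀ s t : Finset Nat.Primes, s ⊆ t → ∀ ξ, G s ξ ≤ G t ξ := fun s t hst ξ =>
    Finset.sum_le_sum_of_subset_of_nonneg hst fun _ _ _ => by positivity
  obtain ⟨s, hs⟩ := (isCompact_Icc (a := -T) (b := T)).elim_directed_cover
    (fun s => {ξ | K < G s ξ}) (fun s => isOpen_lt continuous_const (by
      simp only [G]
      fun_prop)) (fun ξ _ => by
      simp only [Set.mem_iUnion, Set.mem_ofPred_eq]
      by_contra! hc
      exact hdiv ξ (summable_of_sum_le (fun p => by positivity) hc))
    (fun s t => ⟨s ∪ t, fun ξ hξ => lt_of_lt_of_le hξ (hmono _ _ Finset.subset_union_left ξ),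
      fun ξ hξ => lt_of_lt_of_le hξ (hmono _ _ Finset.subset_union_right ξ)⟩)
  refine ⟨s.map (Function.Embedding.subtype _), fun p hp => ?_, fun ξ hξ => ?_⟩
  · obtain ⟨q, _, rfl⟩ := Finset.mem_map.1 hp
    exact q.2
  · have h1 : K < G s ξ := hs (Set.mem_Icc.2 (abs_le.1 hξ))
    refine h1.le.trans (le_of_eq ?_)
    exact (Finset.sum_map s (Function.Embedding.subtype _) fun p : ℕ =>
      (1 / p : ℝ) * ‖1 - g p * Complex.exp (-(Complex.I * ξ * Real.log p))‖ ^ 2).symm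

/-- The logarithmic mean square of the mean values of `g` vanishes if `g p` is far from every
`p ^ {it}`. -/
theorem tendsto_logMean_sq_zero (hg : IsMultOfModulusLeOne g)
    (hdiv : ∀ t : ℝ, ¬ Summable fun p : Nat.Primes =>
      (1 / (p : ℕ) : ℝ) * ‖1 - g p * Complex.exp (-(Complex.I * t * Real.log (p : ℕ)))‖ ^ 2) :
    Tendsto (fun U : ℝ => (∫ u in Set.Icc 0 U, ‖logMean g u‖ ^ 2) / U) atTop (𝓝 0) := by
  have hg1 := hg.norm_le_one
  rw [Metric.tendsto_atTop]
  intro ε hε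
  -- The order of choices matters: the Gaussian width `a = s ^ 2` makes the translation error small,
  -- then `T` controls the tail for this `a`, then `K` and `P` control `[-T, T]`. Each of these
  -- costs `ε / 5`; a fourth `ε / 5` covers the constant `C`, which depends on `P` but not on `U`.
  obtain ⟨s, hs0, hs⟩ : ∃ s : ℝ, 0 < s ∧ 36 * s ≤ ε / 5 :=
    ⟨ε / 180, by positivity, by linarith⟩
  set a := s ^ 2 with ha
  have ha0 : 0 < a := by positivity
  have hsa : √a = s := Real.sqrt_sq hs0.le
  obtain ⟨T, hT0, hT⟩ : ∃ T : ℝ, 0 ≤ T ∧ Real.exp (-(a / 2) * T ^ 2) ≤ ε / 5 := by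
    have h1 : Tendsto (fun T : ℝ => Real.exp (-(a / 2 * T ^ 2))) atTop (𝓝 0) :=
      Real.tendsto_exp_neg_atTop_nhds_zero.comp
        ((tendsto_pow_atTop two_ne_zero).const_mul_atTop (by positivity))
    obtain ⟨T, hT, hT2⟩ := ((h1.eventually (ge_mem_nhds (show 0 < ε / 5 by positivity))).and
      (eventually_ge_atTop 0)).exists
    exact ⟨T, hT2, by rwa [neg_mul]⟩
  obtain ⟨K, hK0, hK⟩ : ∃ K : ℝ, 0 < K ∧ tkConst / K ≤ ε / 5 :=
    ⟨5 * tkConst / ε, by have := tkConst_pos; positivity, by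
      have := tkConst_pos.ne'
      apply le_of_eq
      field_simp⟩
  obtain ⟨P, hP, hKT⟩ := exists_finset_le_sqDist hdiv K T
  obtain ⟨L, hL0, hPL⟩ : ∃ L : ℝ, 0 ≤ L ∧ ∀ p ∈ P, Real.log p ≤ L :=
    ⟨∑ p ∈ P, Real.log p, Finset.sum_nonneg fun p _ => Real.log_natCast_nonneg p, fun p hp =>
      Finset.single_le_sum (f := fun p : ℕ => Real.log p)
        (fun p _ => Real.log_natCast_nonneg p) hp⟩
  set C := 12 * L * P.card / K + 18 * s + 1 with hC
  have hC0 : 0 < C := by positivity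
  refine ⟨5 * C / ε + 1, fun U hU => ?_⟩
  have hU0 : 0 < U := lt_of_lt_of_le (by positivity) hU
  have h1 := gaussEnergy_truncMean_le hg P hP hL0 hPL hU0.le hK0 hT0 ha0 hKT
  have h2 := le_gaussEnergy ha0 (integrable_truncMean hg1 U) (norm_truncMean_le hg1 U)
    (integral_norm_truncMean_shift_sq_le_abs hg1 hU0.le) (by positivity)
  rw [integral_norm_truncMean_sq, hsa] at h2
  set J := ∫ u in Set.Icc 0 U, ‖logMean g u‖ ^ 2 with hJ
  have hJ0 : 0 ≤ J := integral_nonneg fun u => by positivity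
  have hCU : C ≤ ε / 5 * U := by
    have : 5 * C / ε ≤ U := by linarith
    rw [div_le_iff₀ hε] at this
    linarith
  have hJle : J ≤ (tkConst * U + 12 * L * P.card) / K + Real.exp (-(a / 2) * T ^ 2) * U +
      9 * s * (4 * U + 2) + 1 := by
    have hpi := Real.pi_pos
    have h3 : 2 * Real.pi * J ≤ 2 * Real.pi * ((tkConst * U + 12 * L * P.card) / K +
        Real.exp (-(a / 2) * T ^ 2) * U + 9 * s * (4 * U + 2) + 1) := by
      refine (h2.trans (add_le_add_left (add_le_add_left h1 _) _)).trans (le_of_eq ?_)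
      ring
    exact le_of_mul_le_mul_left h3 (by positivity)
  have h5 : J ≤ tkConst / K * U + Real.exp (-(a / 2) * T ^ 2) * U + 36 * s * U + C := by
    refine hJle.trans (le_of_eq ?_)
    rw [hC]
    ring
  have h6 : J ≤ ε / 5 * U + ε / 5 * U + ε / 5 * U + ε / 5 * U := by
    refine h5.trans ?_
    gcongr
  rw [Real.dist_eq, sub_zero, abs_of_nonneg (by positivity), div_lt_iff₀ hU0]
  nlinarith [mul_pos hε hU0]

end

/-! ### Chebyshev estimates for sums over primes -/

/-- The primes `p` with `s < log p ≤ t`. -/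
noncomputable def logPrimes (s t : ℝ) : Finset ℕ :=
  (Finset.Icc 1 ⌊Real.exp t⌋₊).filter fun p => p.Prime ∧ s < Real.log p

lemma mem_logPrimes {s t : ℝ} {p : ℕ} :
    p ∈ logPrimes s t ↔ p.Prime ∧ s < Real.log p ∧ Real.log p ≤ t := by
  unfold logPrimes
  simp only [Finset.mem_filter, Finset.mem_Icc]
  constructor
  · rintro ⟨⟨h1, h2⟩, hp, hs⟩
    refine ⟨hp, hs, ?_⟩
    rw [Real.log_le_iff_le_exp (by exact_mod_cast hp.pos)]
    exact (Nat.le_floor_iff (Real.exp_pos _).le).1 h2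
  · rintro ⟨hp, hs, ht⟩
    refine ⟨⟨hp.pos, Nat.le_floor ?_⟩, hp, hs⟩
    rwa [← Real.log_le_iff_le_exp (by exact_mod_cast hp.pos)]

lemma sum_logPrimes_add {s t r : ℝ} (hst : s ≤ t) (htr : t ≤ r) (F : ℕ → ℝ) :
    ∑ p ∈ logPrimes s t, F p + ∑ p ∈ logPrimes t r, F p = ∑ p ∈ logPrimes s r, F p := by
  rw [← Finset.sum_union]
  · refine Finset.sum_congr ?_ fun _ _ => rfl
    ext p
    simp only [Finset.mem_union, mem_logPrimes]
    constructor
    · rintro (⟨h1, h2, h3⟩ | ⟨h1, h2, h3⟩)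
      · exact ⟨h1, h2, h3.trans htr⟩
      · exact ⟨h1, hst.trans_lt h2, h3⟩
    · rintro ⟨h1, h2, h3⟩
      rcases le_or_gt (Real.log p) t with h | h
      · exact Or.inl ⟨h1, h2, h⟩
      · exact Or.inr ⟨h1, h, h3⟩
  · rw [Finset.disjoint_left]
    intro p h1 h2
    exact absurd (mem_logPrimes.1 h1).2.2 (not_le.2 (mem_logPrimes.1 h2).2.1)

lemma theta_eq_sum_logPrimes (t : ℝ) :
    Chebyshev.theta (Real.exp t) = ∑ p ∈ logPrimes 0 t, Real.log p := by
  rw [Chebyshev.theta_eq_sum_Icc]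
  refine Finset.sum_congr ?_ fun _ _ => rfl
  ext p
  simp only [Finset.mem_filter, Finset.mem_Icc, mem_logPrimes, Nat.zero_le, true_and]
  constructor
  · rintro ⟨h1, hp⟩
    refine ⟨hp, Real.log_pos (by exact_mod_cast hp.one_lt), ?_⟩
    rw [Real.log_le_iff_le_exp (by exact_mod_cast hp.pos)]
    exact (Nat.le_floor_iff (Real.exp_pos _).le).1 h1
  · rintro ⟨hp, _, h2⟩
    refine ⟨Nat.le_floor ?_, hp⟩
    rwa [← Real.log_le_iff_le_exp (by exact_mod_cast hp.pos)]

/-- Chebyshev's lower bound, over an interval. -/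
lemma exists_le_theta_sub :
    ∃ s₀ : ℝ, 0 < s₀ ∧ ∀ s, s₀ ≤ s → Real.exp s * (Real.log 2 / 2) ≤
      Chebyshev.theta (Real.exp (s + Real.log 4)) - Chebyshev.theta (Real.exp s) := by
  have hlog2 : 0 < Real.log 2 := Real.log_pos (by norm_num)
  have h4 : Real.log 4 = 2 * Real.log 2 := by
    rw [show (4 : ℝ) = 2 ^ 2 by norm_num, Real.log_pow]
    norm_num
  have hlim : Tendsto (fun x : ℝ => (Real.log 2 + Real.log (x + 2) + 2 * √x * Real.log x) / x)
      atTop (𝓝 0) := by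
    have e1 : Tendsto (fun x : ℝ => Real.log 2 / x) atTop (𝓝 0) := tendsto_const_nhds.div_atTop tendsto_id
    have e2 : Tendsto (fun x : ℝ => Real.log (x + 2) / x) atTop (𝓝 0) := by
      have a1 := (Real.isLittleO_log_id_atTop.tendsto_div_nhds_zero).comp
        (tendsto_atTop_add_const_right atTop (2 : ℝ) tendsto_id)
      have a2 : Tendsto (fun x : ℝ => (x + 2) / x) atTop (𝓝 1) := by
        have : Tendsto (fun x : ℝ => 1 + 2 / x) atTop (𝓝 (1 + 0)) :=
          tendsto_const_nhds.add (tendsto_const_nhds.div_atTop tendsto_id)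
        rw [add_zero] at this
        refine this.congr' ?_
        filter_upwards [eventually_gt_atTop 0] with x hx
        field_simp
      have a3 := a1.mul a2
      rw [zero_mul] at a3
      refine a3.congr' ?_
      filter_upwards [eventually_gt_atTop 0] with x hx
      simp only [Function.comp, id]
      field_simp
    have e3 : Tendsto (fun x : ℝ => 2 * (Real.log x / x ^ (1 / 2 : ℝ))) atTop (𝓝 (2 * 0)) :=
      ((isLittleO_log_rpow_atTop (by norm_num : (0 : ℝ) < 1 / 2)).tendsto_div_nhds_zero).const_mul 2
    have e4 := (e1.add e2).add e3
    simp only [mul_zero, add_zero] at e4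
    refine e4.congr' ?_
    filter_upwards [eventually_gt_atTop 0] with x hx
    rw [← Real.sqrt_eq_rpow]
    have hs : √x ≠ 0 := (Real.sqrt_pos.2 hx).ne'
    have hx' : x = √x * √x := (Real.mul_self_sqrt hx.le).symm
    have : 2 * (Real.log x / √x) = 2 * √x * Real.log x / x := by
      rw [eq_div_iff hx.ne']
      calc 2 * (Real.log x / √x) * x = 2 * (Real.log x / √x) * (√x * √x) := by rw [← hx']
        _ = _ := by field_simp
    rw [this]
    ring
  obtain ⟨x₀, hx₀⟩ := eventually_atTop.1
    (hlim.eventually (ge_mem_nhds (show (0 : ℝ) < Real.log 2 / 8 by positivity)))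
  refine ⟨max 1 x₀, by positivity, fun s hs => ?_⟩
  set x := Real.exp s with hx
  have hx1 : 1 ≤ x := Real.one_le_exp (le_trans zero_le_one ((le_max_left _ _).trans hs))
  have hxx : x₀ ≤ 4 * x := by
    have h1 := Real.add_one_le_exp s
    have h2 := (le_max_right 1 x₀).trans hs
    linarith
  have h3 : Real.exp (s + Real.log 4) = 4 * x := by
    rw [Real.exp_add, Real.exp_log (by norm_num)]
    ring
  have h5 := hx₀ (4 * x) hxx
  rw [div_le_iff₀ (by positivity)] at h5
  -- The lower bound at `4 * x` has main term `4 * x * log 2`, the upper bound at `x` is `2 * x *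
  -- log 2`. A ratio of `4` thus leaves a gain, where a ratio of `2` would not.
  have h6 := Chebyshev.theta_ge' (x := 4 * x) (by linarith)
  have h7 := Chebyshev.theta_le_log4_mul_x (x := x) (by linarith)
  rw [h3]
  rw [h4] at h7
  nlinarith

lemma exists_le_sum_log_div :
    ∃ s₀ : ℝ, 0 < s₀ ∧ ∀ s, s₀ ≤ s →
      Real.log 2 / 8 ≤ ∑ p ∈ logPrimes s (s + Real.log 4), Real.log p / p := by
  obtain ⟨s₀, hs₀, h⟩ := exists_le_theta_sub
  refine ⟨s₀, hs₀, fun s hs => ?_⟩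
  have hl4 : 0 ≤ Real.log 4 := Real.log_nonneg (by norm_num)
  have h1 := h s hs
  rw [theta_eq_sum_logPrimes, theta_eq_sum_logPrimes,
    ← sum_logPrimes_add (hs₀.le.trans hs) (le_add_of_nonneg_right hl4), add_sub_cancel_left] at h1
  have h2 : (∑ p ∈ logPrimes s (s + Real.log 4), Real.log p) / (4 * Real.exp s) ≤
      ∑ p ∈ logPrimes s (s + Real.log 4), Real.log p / p := by
    rw [Finset.sum_div]
    refine Finset.sum_le_sum fun p hp => ?_
    obtain ⟨hpp, _, hp2⟩ := mem_logPrimes.1 hp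
    have hp0 : (0 : ℝ) < p := by exact_mod_cast hpp.pos
    have h3 : (p : ℝ) ≤ 4 * Real.exp s := by
      rw [Real.log_le_iff_le_exp hp0, Real.exp_add, Real.exp_log (by norm_num)] at hp2
      linarith
    exact div_le_div_of_nonneg_left (Real.log_natCast_nonneg p) hp0 h3
  refine le_trans ?_ h2
  rw [le_div_iff₀ (by positivity)]
  linarith

lemma exists_le_sum_log_div_iterate :
    ∃ s₀ : ℝ, 0 < s₀ ∧ ∀ (k : ℕ) (s : ℝ), s₀ ≤ s →
      k * (Real.log 2 / 8) ≤ ∑ p ∈ logPrimes s (s + k * Real.log 4), Real.log p / p := by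
  obtain ⟨s₀, hs₀, h⟩ := exists_le_sum_log_div
  have hl4 : 0 ≤ Real.log 4 := Real.log_nonneg (by norm_num)
  refine ⟨s₀, hs₀, fun k => ?_⟩
  induction k with
  | zero => intro s _; simpa using Finset.sum_nonneg fun (p : ℕ) _ =>
      div_nonneg (Real.log_natCast_nonneg p) (Nat.cast_nonneg p)
  | succ k ih =>
    intro s hs
    have h1 := ih s hs
    have h2 := h (s + k * Real.log 4) (hs.trans (le_add_of_nonneg_right (by positivity)))
    have h3 := sum_logPrimes_add (s := s) (t := s + k * Real.log 4)
      (r := s + k * Real.log 4 + Real.log 4) (le_add_of_nonneg_right (by positivity))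
      (le_add_of_nonneg_right hl4) fun p => Real.log p / p
    rw [show s + ((k + 1 : ℕ) : ℝ) * Real.log 4 = s + k * Real.log 4 + Real.log 4 by
      push_cast; ring, ← h3]
    push_cast
    linarith

lemma sum_inv_logPrimes_nonneg (s t : ℝ) : 0 ≤ ∑ p ∈ logPrimes s t, (1 / p : ℝ) :=
  Finset.sum_nonneg fun p _ => by positivity

/-- A substitute for Mertens: about `s / log 4` consecutive intervals of ratio `4` fit between `e ^
s` and `e ^ {2 * s}`, each adding at least `log 2 / 8` to `∑ log p / p`, and `log p ≤ 2 * s` there.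
-/
lemma exists_le_sum_inv_logPrimes_two :
    ∃ s₀ c : ℝ, 0 < s₀ ∧ 0 < c ∧ ∀ s, s₀ ≤ s → c ≤ ∑ p ∈ logPrimes s (2 * s), (1 / p : ℝ) := by
  obtain ⟨s₀, hs₀, h⟩ := exists_le_sum_log_div_iterate
  have hl4 : 0 < Real.log 4 := Real.log_pos (by norm_num)
  have hl2 : 0 < Real.log 2 := Real.log_pos (by norm_num)
  refine ⟨max s₀ (2 * Real.log 4), Real.log 2 / (32 * Real.log 4), by positivity, by positivity,
    fun s hs => ?_⟩
  have hs1 := (le_max_left _ _).trans hs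
  have hs2 := (le_max_right _ _).trans hs
  have hs0 : 0 < s := hs₀.trans_le hs1
  set k := ⌊s / Real.log 4⌋₊ with hk
  have hk1 : k * Real.log 4 ≤ s := by
    rw [← le_div_iff₀ hl4]
    exact Nat.floor_le (by positivity)
  have hk2 : s / 2 ≤ k * Real.log 4 := by
    have h1 : s / Real.log 4 < k + 1 := Nat.lt_floor_add_one _
    rw [div_lt_iff₀ hl4] at h1
    linarith
  have h1 := h k s hs1
  have h2 : ∑ p ∈ logPrimes s (s + k * Real.log 4), Real.log p / p ≤
      ∑ p ∈ logPrimes s (2 * s), Real.log p / p := by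
    rw [← sum_logPrimes_add (s := s) (t := s + k * Real.log 4) (r := 2 * s)
      (le_add_of_nonneg_right (by positivity)) (by linarith)]
    exact le_add_of_nonneg_right (Finset.sum_nonneg fun p _ =>
      div_nonneg (Real.log_natCast_nonneg p) (Nat.cast_nonneg p))
  have h3 : ∑ p ∈ logPrimes s (2 * s), Real.log p / p ≤
      2 * s * ∑ p ∈ logPrimes s (2 * s), (1 / p : ℝ) := by
    rw [Finset.mul_sum]
    refine Finset.sum_le_sum fun p hp => ?_
    rw [div_eq_mul_one_div]
    exact mul_le_mul_of_nonneg_right (mem_logPrimes.1 hp).2.2 (by positivity)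
  have h4 : s / (2 * Real.log 4) ≤ k := by
    rw [div_le_iff₀ (by positivity)]
    linarith
  have h5 : s / (2 * Real.log 4) * (Real.log 2 / 8) ≤
      2 * s * ∑ p ∈ logPrimes s (2 * s), (1 / p : ℝ) :=
    (mul_le_mul_of_nonneg_right h4 (by positivity)).trans (h1.trans (h2.trans h3))
  refine le_of_mul_le_mul_left (le_trans (le_of_eq ?_) h5) (show 0 < 2 * s by positivity)
  field_simp
  norm_num

/-- The sum of `1 / p` over the primes in `(Y, Y ^ 2 ^ J]` grows at least linearly in `J`. -/
lemma exists_le_sum_inv_logPrimes :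
    ∃ s₀ c : ℝ, 0 < s₀ ∧ 0 < c ∧ ∀ (J : ℕ) (s : ℝ), s₀ ≤ s →
      J * c ≤ ∑ p ∈ logPrimes s (2 ^ J * s), (1 / p : ℝ) := by
  obtain ⟨s₀, c, hs₀, hc, h⟩ := exists_le_sum_inv_logPrimes_two
  refine ⟨s₀, c, hs₀, hc, fun J => ?_⟩
  induction J with
  | zero => intro s _; simpa using sum_inv_logPrimes_nonneg s s
  | succ J ih =>
    intro s hs
    have hs0 : 0 < s := hs₀.trans_le hs
    have hJ : (1 : ℝ) ≤ 2 ^ J := one_le_pow₀ (by norm_num)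
    have hJs : s ≤ 2 ^ J * s := le_mul_of_one_le_left hs0.le hJ
    have h1 := ih s hs
    have h2 := h (2 ^ J * s) (hs.trans hJs)
    rw [pow_succ, show (2 : ℝ) ^ J * 2 * s = 2 * (2 ^ J * s) by ring,
      ← sum_logPrimes_add hJs (by linarith)]
    push_cast
    linarith

/-- Chebyshev's upper bound for the primes in a short multiplicative interval. -/
lemma sum_inv_logPrimes_window_le {s t : ℝ} (hs : 0 < s) (r : ℝ) :
    ∑ p ∈ (logPrimes s t).filter (fun p : ℕ => r ≤ Real.log p ∧ Real.log p ≤ r + 1), (1 / p : ℝ) ≤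
      4 / s := by
  set Q := (logPrimes s t).filter (fun p : ℕ => r ≤ Real.log p ∧ Real.log p ≤ r + 1) with hQ
  have h1 : ∑ p ∈ Q, (1 / p : ℝ) ≤ ∑ p ∈ Q, Real.log p * (1 / (s * Real.exp r)) := by
    refine Finset.sum_le_sum fun p hp => ?_
    obtain ⟨hp1, hp2, hp3⟩ := Finset.mem_filter.1 hp
    obtain ⟨hpp, hps, _⟩ := mem_logPrimes.1 hp1
    have hp0 : (0 : ℝ) < p := by exact_mod_cast hpp.pos
    have h2 : Real.exp r ≤ p := (Real.le_log_iff_exp_le hp0).1 hp2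
    rw [← div_eq_mul_one_div, div_le_div_iff₀ hp0 (by positivity)]
    nlinarith [Real.exp_pos r]
  have h2 : ∑ p ∈ Q, Real.log p ≤ Chebyshev.theta (Real.exp (r + 1)) := by
    rw [theta_eq_sum_logPrimes]
    refine Finset.sum_le_sum_of_subset_of_nonneg (fun p hp => ?_) fun p _ _ =>
      Real.log_natCast_nonneg p
    obtain ⟨hp1, _, hp3⟩ := Finset.mem_filter.1 hp
    obtain ⟨hpp, hps, _⟩ := mem_logPrimes.1 hp1
    exact mem_logPrimes.2 ⟨hpp, hs.trans hps, hp3⟩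
  have h3 := Chebyshev.theta_le_log4_mul_x (Real.exp_pos (r + 1)).le
  have h4 : Real.log 4 * Real.exp (r + 1) ≤ 4 * Real.exp r := by
    have e1 : Real.log 4 ≤ 1.3864 := by
      rw [show (4 : ℝ) = 2 ^ 2 by norm_num, Real.log_pow]
      have := Real.log_two_lt_d9
      push_cast
      linarith
    have e2 := Real.exp_one_lt_d9
    rw [Real.exp_add]
    have e3 : Real.log 4 * Real.exp 1 ≤ 4 := by
      nlinarith [Real.log_nonneg (show (1 : ℝ) ≤ 4 by norm_num), Real.exp_pos 1]
    nlinarith [Real.exp_pos r]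
  rw [← Finset.sum_mul] at h1
  refine h1.trans ?_
  calc _ ≤ 4 * Real.exp r * (1 / (s * Real.exp r)) := by
        refine mul_le_mul_of_nonneg_right (h2.trans (h3.trans h4)) (by positivity)
    _ = 4 / s := by
      have := (Real.exp_pos r).ne'
      field_simp

/-! ### From mean square decay to mean value zero -/

section
open MeasureTheory

variable {g : ℕ → ℂ}

lemma integrableOn_logMean_sq (hg : ∀ n, 0 < n → ‖g n‖ ≤ 1) (a b : ℝ) :
    IntegrableOn (fun u => ‖logMean g u‖ ^ 2) (Set.Icc a b) := by
  refine Measure.integrableOn_of_bounded (M := 1) (by simp)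
    ((measurable_logMean g).norm.pow_const 2).aestronglyMeasurable
    (Eventually.of_forall fun u => ?_)
  rw [Real.norm_of_nonneg (by positivity)]
  exact pow_le_one₀ (norm_nonneg _) (norm_logMean_le hg u)

lemma setIntegral_shift (F : ℝ → ℝ) (a η : ℝ) :
    ∫ v in Set.Icc 0 η, F (a + v) = ∫ w, (Set.Icc a (a + η)).indicator F w := by
  rw [← integral_indicator measurableSet_Icc, 
    ← integral_add_left_eq_self ((Set.Icc a (a + η)).indicator F) a]
  refine integral_congr_ae (Eventually.of_forall fun v => ?_)
  simp only [Set.indicator, Set.mem_Icc, le_add_iff_nonneg_right, add_le_add_iff_left]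

/-- Exchange sum and integral. A point `w` lies in the interval attached to `p` only if `log p` is
in a window of length `1` starting at `U - w`, and such primes have total weight at most `4 / s`. So
averaging over shifted short intervals is dominated by one integral. -/
lemma sum_inv_mul_integral_shift_le (hg : ∀ n, 0 < n → ‖g n‖ ≤ 1) {s t U η : ℝ} (hs : 0 < s)
    (htU : t ≤ U) (hη1 : η ≤ 1) :
    ∑ p ∈ logPrimes s t, (1 / p : ℝ) * ∫ v in Set.Icc 0 η, ‖logMean g (U - Real.log p + v)‖ ^ 2 ≤
      4 / s * ∫ w in Set.Icc 0 (U + 1), ‖logMean g w‖ ^ 2 := by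
  have hint : ∀ p : ℕ, Integrable fun w => (1 / p : ℝ) *
      (Set.Icc (U - Real.log p) (U - Real.log p + η)).indicator (fun u => ‖logMean g u‖ ^ 2) w :=
    fun p => ((integrable_indicator_iff measurableSet_Icc).2
      (integrableOn_logMean_sq hg _ _)).const_mul _
  have hint2 : Integrable fun w =>
      (Set.Icc 0 (U + 1)).indicator (fun u => ‖logMean g u‖ ^ 2) w :=
    (integrable_indicator_iff measurableSet_Icc).2 (integrableOn_logMean_sq hg _ _)
  have h1 : ∑ p ∈ logPrimes s t, (1 / p : ℝ) *
      ∫ v in Set.Icc 0 η, ‖logMean g (U - Real.log p + v)‖ ^ 2 =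
      ∫ w, ∑ p ∈ logPrimes s t, (1 / p : ℝ) *
        (Set.Icc (U - Real.log p) (U - Real.log p + η)).indicator (fun u => ‖logMean g u‖ ^ 2) w := by
    rw [integral_finsetSum _ fun p _ => hint p]
    refine Finset.sum_congr rfl fun p _ => ?_
    rw [integral_const_mul, ← setIntegral_shift (fun u => ‖logMean g u‖ ^ 2)]
  rw [h1, ← integral_indicator measurableSet_Icc, ← integral_const_mul]
  refine integral_mono (integrable_finsetSum _ fun p _ => hint p) (hint2.const_mul _) fun w => ?_
  simp only
  by_cases hw : w ∈ Set.Icc 0 (U + 1)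
  · rw [Set.indicator_of_mem hw]
    calc _ ≤ ∑ p ∈ (logPrimes s t).filter
          (fun p : ℕ => U - w ≤ Real.log p ∧ Real.log p ≤ U - w + 1), (1 / p : ℝ) * ‖logMean g w‖ ^ 2 := by
          rw [Finset.sum_filter]
          refine Finset.sum_le_sum fun p _ => ?_
          by_cases hp : w ∈ Set.Icc (U - Real.log p) (U - Real.log p + η)
          · rw [Set.indicator_of_mem hp, if_pos ⟨by linarith [hp.1], by linarith [hp.2]⟩]
          · rw [Set.indicator_of_notMem hp, mul_zero]
            split_ifs <;> positivity
      _ ≤ _ := by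
        rw [← Finset.sum_mul]
        exact mul_le_mul_of_nonneg_right (sum_inv_logPrimes_window_le hs _) (by positivity)
  · rw [Set.indicator_of_notMem hw, mul_zero]
    refine le_of_eq (Finset.sum_eq_zero fun p hp => ?_)
    obtain ⟨_, hp2, hp3⟩ := mem_logPrimes.1 hp
    rw [Set.indicator_of_notMem, mul_zero]
    intro h
    exact hw ⟨by linarith [h.1], by linarith [h.2]⟩

lemma logMean_log_natCast (g : ℕ → ℂ) {N : ℕ} (hN : 0 < N) : logMean g (Real.log N) = avg g N := by
  have hN' : (0 : ℝ) < N := by exact_mod_cast hN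
  unfold logMean partialSum avg
  rw [Real.exp_neg, Real.exp_log hN', Nat.floor_natCast]
  push_cast
  rw [div_eq_mul_inv]

/-- A multiplicative function whose mean values are small in logarithmic mean square has mean
value zero. -/
theorem tendsto_avg_zero_of_logMean_sq (hg : IsMultOfModulusLeOne g)
    (hmean : Tendsto (fun U : ℝ => (∫ u in Set.Icc 0 U, ‖logMean g u‖ ^ 2) / U) atTop (𝓝 0)) :
    Tendsto (avg g) atTop (𝓝 0) := by
  have hg1 := hg.norm_le_one
  rw [Metric.tendsto_atTop]
  intro ε hε
  obtain ⟨s₀, c, hs₀, hc, hsum⟩ := exists_le_sum_inv_logPrimes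
  -- `J` is chosen so that the primes used have enough reciprocal mass, at least `J * c`, for a mean
  -- value of size `ε` at `U` to outweigh the Turán–Kubilius error.
  obtain ⟨J, hJ⟩ := exists_nat_ge ((2 * tkConst + 1) / (c * (ε ^ 2 / 4)))
  rw [div_le_iff₀ (by positivity)] at hJ
  set η := min 1 (ε / 8) with hη
  have hη0 : 0 < η := by positivity
  have hη1 : η ≤ 1 := min_le_left _ _
  have hη2 : η ≤ ε / 8 := min_le_right _ _
  -- With `s = U / 2 ^ (J + 1)` proportional to `U`, the bound `8 / s * I` is at most `16 / 20 * η`,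
  -- which gives the contradiction.
  set δ := η / (2 ^ (J + 1) * 20) with hδ
  have hδ0 : 0 < δ := by positivity
  have hev : ∀ᶠ U : ℝ in atTop, (∫ u in Set.Icc 0 (U + 1), ‖logMean g u‖ ^ 2) / (U + 1) < δ :=
    (tendsto_atTop_add_const_right atTop (1 : ℝ) tendsto_id).eventually
      (hmean.eventually (gt_mem_nhds hδ0))
  have hexp : ∀ᶠ U : ℝ in atTop, Real.exp (-U) < ε / 4 :=
    Real.tendsto_exp_neg_atTop_nhds_zero.eventually (gt_mem_nhds (by positivity))
  have hlog : Tendsto (fun N : ℕ => Real.log N) atTop atTop :=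
    Real.tendsto_log_atTop.comp tendsto_natCast_atTop_atTop
  have hall := hlog.eventually (hev.and (hexp.and
    ((eventually_ge_atTop 1).and (eventually_ge_atTop (2 ^ (J + 1) * s₀)))))
  obtain ⟨N₀, hN₀⟩ := eventually_atTop.1 (hall.and (eventually_gt_atTop 0))
  refine ⟨N₀, fun N hN => ?_⟩
  obtain ⟨⟨hI, hexpU, hU1, hUs⟩, hNpos⟩ := hN₀ N hN
  rw [dist_zero_right, ← logMean_log_natCast g hNpos]
  set U := Real.log N with hU
  by_contra! hcontra
  set s := U / 2 ^ (J + 1) with hs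
  have hs1 : s₀ ≤ s := by
    rw [hs, le_div_iff₀ (by positivity)]
    linarith
  have hs0 : 0 < s := hs₀.trans_le hs1
  have hsU : 2 ^ J * s = U / 2 := by
    rw [hs, pow_succ]
    field_simp
  have hL := hsum J s hs1
  rw [hsU] at hL
  set P := logPrimes s (U / 2) with hP
  have hPp : ∀ p ∈ P, p.Prime := fun p hp => (mem_logPrimes.1 hp).1
  -- By slow variation a large mean at `U` persists on `[U, U + η]`, and the approximate relation
  -- transfers it to `U - log p + v` for many primes. Integration over `v` then makes the mean
  -- square applicable.
  have hpt : ∀ v ∈ Set.Icc 0 η, 2 * tkConst + 1 ≤ 2 * tkConst +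
      2 * ∑ p ∈ P, (1 / p : ℝ) * ‖logMean g (U - Real.log p + v)‖ ^ 2 := by
    intro v hv
    have hlow : ε / 2 ≤ ‖logMean g (U + v)‖ := by
      have h1 := norm_logMean_add_sub_le hg1 U hv.1
      have h2 := norm_sub_norm_le (logMean g U) (logMean g (U + v))
      rw [norm_sub_rev] at h2
      linarith [hv.2]
    have htk := sum_norm_logMean_sub_sq_le hg (U + v) P hPp fun p hp => by
      have hp0 : (0 : ℝ) < p := by exact_mod_cast (hPp p hp).pos
      rw [← Real.log_le_iff_le_exp (by positivity), Real.log_pow]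
      have := (mem_logPrimes.1 hp).2.2
      push_cast
      linarith [hv.1]
    have hterm : ∀ p ∈ P, (1 / p : ℝ) * (ε ^ 2 / 4) ≤
        2 * ((1 / p : ℝ) * ‖logMean g (U + v) - g p * logMean g (U + v - Real.log p)‖ ^ 2) +
        2 * ((1 / p : ℝ) * ‖logMean g (U - Real.log p + v)‖ ^ 2) := by
      intro p hp
      rw [show U + v - Real.log p = U - Real.log p + v by ring]
      set A := logMean g (U + v) - g p * logMean g (U - Real.log p + v) with hA
      set B := logMean g (U - Real.log p + v) with hB
      have h1 : ε / 2 ≤ ‖A‖ + ‖B‖ := by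
        have h2 : ‖g p * B‖ ≤ ‖B‖ := by
          rw [norm_mul]
          exact mul_le_of_le_one_left (norm_nonneg _) (hg1 p (hPp p hp).pos)
        have h3 : logMean g (U + v) = A + g p * B := by rw [hA]; ring
        rw [h3] at hlow
        linarith [norm_add_le A (g p * B)]
      have h2 : ε ^ 2 / 4 ≤ 2 * ‖A‖ ^ 2 + 2 * ‖B‖ ^ 2 := by
        have h3 := pow_le_pow_left₀ (by positivity) h1 2
        nlinarith [sq_nonneg (‖A‖ - ‖B‖)]
      have h3 := mul_le_mul_of_nonneg_left h2 (show (0 : ℝ) ≤ 1 / p by positivity)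
      linarith
    have h1 := Finset.sum_le_sum hterm
    rw [← Finset.sum_mul, Finset.sum_add_distrib, ← Finset.mul_sum, ← Finset.mul_sum] at h1
    have h2 := mul_le_mul_of_nonneg_right hL (show 0 ≤ ε ^ 2 / 4 by positivity)
    linarith
  have hintp : ∀ p : ℕ, IntegrableOn (fun v => ‖logMean g (U - Real.log p + v)‖ ^ 2) (Set.Icc 0 η) := by
    intro p
    refine Measure.integrableOn_of_bounded (M := 1) (by simp)
      (((measurable_logMean g).comp (measurable_const_add _)).norm.pow_const 2).aestronglyMeasurable
      (Eventually.of_forall fun u => ?_)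
    rw [Real.norm_of_nonneg (by positivity)]
    exact pow_le_one₀ (norm_nonneg _) (norm_logMean_le hg1 _)
  have hInt : η ≤ 2 * ∑ p ∈ P, (1 / p : ℝ) *
      ∫ v in Set.Icc 0 η, ‖logMean g (U - Real.log p + v)‖ ^ 2 := by
    have h1 : ∫ _ in Set.Icc 0 η, (1 : ℝ) ≤ ∫ v in Set.Icc 0 η,
        2 * ∑ p ∈ P, (1 / p : ℝ) * ‖logMean g (U - Real.log p + v)‖ ^ 2 := by
      refine setIntegral_mono_on (by simp) ((integrable_finsetSum _ fun p _ =>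
        (hintp p).const_mul _).const_mul _) measurableSet_Icc fun v hv => ?_
      linarith [hpt v hv]
    rw [integral_const_mul, integral_finsetSum _ fun p _ => (hintp p).const_mul _] at h1
    simp_rw [integral_const_mul] at h1
    simpa [hη0.le] using h1
  have h2 := sum_inv_mul_integral_shift_le hg1 (t := U / 2) (U := U) hs0 (by linarith) hη1
  rw [div_lt_iff₀ (by linarith)] at hI
  set I := ∫ u in Set.Icc 0 (U + 1), ‖logMean g u‖ ^ 2 with hIdef
  have h3 : η ≤ 8 / s * I := by
    calc η ≤ 2 * (4 / s * I) := hInt.trans (mul_le_mul_of_nonneg_left h2 (by norm_num))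
      _ = _ := by ring
  have h4 : 8 / s * I < η := by
    calc 8 / s * I < 8 / s * (δ * (U + 1)) := mul_lt_mul_of_pos_left hI (by positivity)
      _ ≤ 8 / s * (δ * (2 * U)) := by gcongr; linarith
      _ = η * (16 / 20) := by
        rw [hs, hδ]
        have : U ≠ 0 := by linarith
        field_simp
        norm_num
      _ ≤ η := by linarith
  linarith

end

/-! ### Euler products and Dirichlet series near 1 -/

section
variable {a : ℕ → ℂ} {r : ℝ}

lemma summable_mul_pow (h1 : ∀ e, ‖a e‖ ≤ 1) (hr0 : 0 ≤ r) (hr1 : r < 1) :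
    Summable fun e => a e * (r : ℂ) ^ e := by
  refine Summable.of_norm_bounded (summable_geometric_of_lt_one hr0 hr1) fun e => ?_
  rw [norm_mul, norm_pow, Complex.norm_real, Real.norm_of_nonneg hr0]
  exact mul_le_of_le_one_left (by positivity) (h1 e)

lemma norm_tsum_sub_le (h0 : a 0 = 1) (h1 : ∀ e, ‖a e‖ ≤ 1) (hr0 : 0 ≤ r) (hr1 : r < 1) :
    ‖∑' e, a e * (r : ℂ) ^ e - (1 + a 1 * r)‖ ≤ r ^ 2 / (1 - r) := by
  rw [← (summable_mul_pow h1 hr0 hr1).sum_add_tsum_nat_add 2]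
  simp only [Finset.sum_range_succ, Finset.sum_range_zero, zero_add, pow_zero, mul_one, pow_one, h0,
    add_sub_cancel_left]
  refine tsum_of_norm_bounded (g := fun e => r ^ 2 * r ^ e)
    ((hasSum_geometric_of_lt_one hr0 hr1).mul_left _) fun e => ?_
  rw [norm_mul, norm_pow, Complex.norm_real, Real.norm_of_nonneg hr0, pow_add, mul_comm (r ^ e)]
  exact mul_le_of_le_one_left (by positivity) (h1 _)

lemma le_log_one_sub {x : ℝ} (hx : |x| ≤ 1 / 2) : -x - 2 * x ^ 2 ≤ Real.log (1 - x) := by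
  have h := Real.abs_log_sub_add_sum_range_le (x := x) (by linarith) 1
  simp only [Finset.sum_range_one, zero_add, pow_one, Nat.cast_zero, div_one] at h
  have h2 : |x| ^ (1 + 1) / (1 - |x|) ≤ 2 * x ^ 2 := by
    rw [div_le_iff₀ (by linarith), ← sq_abs x]
    norm_num only
    nlinarith [mul_nonneg (sq_nonneg |x|) (show 0 ≤ 1 - 2 * |x| by linarith)]
  linarith [(abs_le.1 h).1]

lemma inv_one_sub_le_exp (hr0 : 0 ≤ r) (hr1 : r ≤ 1 / 2) : (1 - r)⁻¹ ≤ Real.exp (r + 2 * r ^ 2) := by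
  have h := le_log_one_sub (x := r) (by rwa [abs_of_nonneg hr0])
  have h2 := Real.exp_le_exp.2 h
  rw [Real.exp_log (by linarith)] at h2
  rw [inv_le_comm₀ (by linarith) (Real.exp_pos _), ← Real.exp_neg]
  refine le_trans (Real.exp_le_exp.2 (by linarith)) h2

/-- Compare with the zeta factor `(1 - r)⁻¹`, with errors of order `r ^ 2`, summable over primes.
For `r ≤ 1 / 3` the first two terms dominate the tail. At `r = 1 / 2` the series can vanish (take `a
e = -1` for all `e > 0`), hence the extra assumption there. -/
lemma local_factor_ge (h0 : a 0 = 1) (h1 : ∀ e, ‖a e‖ ≤ 1) (hr0 : 0 ≤ r)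
    (hr : r ≤ 1 / 3 ∨ r ≤ 1 / 2 ∧ ∀ e, 0 < e → a e = 0) :
    (1 - r)⁻¹ * Real.exp (-((1 - (a 1).re) * r) - 8 * r ^ 2) ≤ ‖∑' e, a e * (r : ℂ) ^ e‖ := by
  have hr2 : r ≤ 1 / 2 := by rcases hr with h | h <;> linarith
  have hinv := inv_one_sub_le_exp hr0 hr2
  have hstep : (1 - r)⁻¹ * Real.exp (-((1 - (a 1).re) * r) - 8 * r ^ 2) ≤
      Real.exp ((a 1).re * r - 6 * r ^ 2) := by
    calc _ ≤ Real.exp (r + 2 * r ^ 2) * Real.exp (-((1 - (a 1).re) * r) - 8 * r ^ 2) := by gcongr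
      _ = _ := by
        rw [← Real.exp_add]
        congr 1
        ring
  refine hstep.trans ?_
  rcases hr with hr | ⟨_, hz⟩
  · set z := (a 1).re with hz
    have hz1 : |z| ≤ 1 := (Complex.abs_re_le_norm _).trans (h1 1)
    obtain ⟨hz2, hz3⟩ := abs_le.1 hz1
    set y := z * r - 3 / 2 * r ^ 2 with hy
    have hy1 : |y| ≤ 3 / 2 * r := by
      rw [abs_le]
      constructor <;> nlinarith
    have h2 := le_log_one_sub (x := -y) (by rw [abs_neg]; linarith)
    have h3 : y ^ 2 ≤ (3 / 2 * r) ^ 2 := by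
      rw [← sq_abs y]
      exact pow_le_pow_left₀ (abs_nonneg _) hy1 2
    have h4 : Real.exp (z * r - 6 * r ^ 2) ≤ 1 + y := by
      have hpos : 0 < 1 - -y := by linarith [(abs_le.1 hy1).1]
      have h5 := Real.exp_le_exp.2 h2
      rw [Real.exp_log hpos] at h5
      refine (Real.exp_le_exp.2 ?_).trans (h5.trans (by linarith))
      nlinarith
    have h5 := norm_tsum_sub_le h0 h1 hr0 (by linarith : r < 1)
    have h6 : r ^ 2 / (1 - r) ≤ 3 / 2 * r ^ 2 := by
      rw [div_le_iff₀ (by linarith)]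
      nlinarith [sq_nonneg r]
    have h7 : 1 + z * r ≤ ‖1 + a 1 * (r : ℂ)‖ := by
      refine le_trans (le_of_eq ?_) (Complex.re_le_norm _)
      simp [hz]
    have h8 := norm_sub_norm_le (1 + a 1 * (r : ℂ)) (∑' e, a e * (r : ℂ) ^ e)
    rw [norm_sub_rev] at h8
    linarith
  · have h2 : ∑' e, a e * (r : ℂ) ^ e = 1 := by
      rw [tsum_eq_single 0 fun e he => by rw [hz e (Nat.pos_of_ne_zero he), zero_mul], h0]
      simp
    rw [h2, norm_one, hz 1 one_pos, Real.exp_le_one_iff]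
    simp only [Complex.zero_re, zero_mul]
    nlinarith [sq_nonneg r]

/-- Bound the series by `1 + ‖a 1‖ * r + 2 * r ^ 2`, pass to the exponential, and trade `exp r` for
the zeta factor. -/
lemma local_factor_le (h0 : a 0 = 1) (h1 : ∀ e, ‖a e‖ ≤ 1) (hr0 : 0 ≤ r) (hr : r ≤ 1 / 2) :
    ‖∑' e, a e * (r : ℂ) ^ e‖ ≤ (1 - r)⁻¹ * Real.exp (-((1 - ‖a 1‖) * r) + 2 * r ^ 2) := by
  have h2 := norm_tsum_sub_le h0 h1 hr0 (by linarith : r < 1)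
  have h3 : r ^ 2 / (1 - r) ≤ 2 * r ^ 2 := by
    rw [div_le_iff₀ (by linarith)]
    nlinarith [sq_nonneg r]
  have h4 : ‖∑' e, a e * (r : ℂ) ^ e‖ ≤ 1 + ‖a 1‖ * r + 2 * r ^ 2 := by
    have h5 : ‖1 + a 1 * (r : ℂ)‖ ≤ 1 + ‖a 1‖ * r := by
      refine (norm_add_le _ _).trans ?_
      rw [norm_one, norm_mul, Complex.norm_real, Real.norm_of_nonneg hr0]
    have h6 := norm_sub_norm_le (∑' e, a e * (r : ℂ) ^ e) (1 + a 1 * (r : ℂ))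
    linarith
  have h5 : Real.exp r ≤ (1 - r)⁻¹ := by
    rw [le_inv_comm₀ (Real.exp_pos _) (by linarith), ← Real.exp_neg]
    linarith [Real.add_one_le_exp (-r), Real.one_sub_le_exp_neg r]
  calc _ ≤ 1 + ‖a 1‖ * r + 2 * r ^ 2 := h4
    _ ≤ Real.exp (‖a 1‖ * r + 2 * r ^ 2) := by
      linarith [Real.add_one_le_exp (‖a 1‖ * r + 2 * r ^ 2)]
    _ = Real.exp r * Real.exp (-((1 - ‖a 1‖) * r) + 2 * r ^ 2) := by
      rw [← Real.exp_add]
      congr 1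
      ring
    _ ≤ _ := by gcongr

end

section
variable {G : ℕ → ℂ}

lemma norm_natCast_rpow_term (n : ℕ) (σ : ℝ) :
    ‖(((n : ℝ) ^ (-σ) : ℝ) : ℂ)‖ = (n : ℝ) ^ (-σ) := by
  rw [Complex.norm_real, Real.norm_of_nonneg (by positivity)]

lemma summable_norm_mul_rpow (hG : ∀ n, 0 < n → ‖G n‖ ≤ 1) {σ : ℝ} (hσ : 1 < σ) :
    Summable fun n : ℕ => ‖G n * (((n : ℝ) ^ (-σ) : ℝ) : ℂ)‖ := by
  refine Summable.of_nonneg_of_le (fun n => norm_nonneg _) (fun n => ?_)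
    (Real.summable_nat_rpow.2 (by linarith : -σ < -1))
  rw [norm_mul, norm_natCast_rpow_term]
  rcases Nat.eq_zero_or_pos n with rfl | hn
  · have : (0 : ℝ) ^ (-σ) = 0 := Real.zero_rpow (by linarith)
    simp [this]
  · exact mul_le_of_le_one_left (by positivity) (hG n hn)

lemma hasProd_euler (hG : IsMultOfModulusLeOne G) (hG1 : G 1 = 1) {σ : ℝ} (hσ : 1 < σ) :
    HasProd (fun p : Nat.Primes =>
      ‖∑' e, G ((p : ℕ) ^ e) * ((((p : ℕ) : ℝ) ^ (-σ) : ℝ) : ℂ) ^ e‖)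
      ‖∑' n : ℕ, G n * (((n : ℝ) ^ (-σ) : ℝ) : ℂ)‖ := by
  have hz : (0 : ℝ) ^ (-σ) = 0 := Real.zero_rpow (by linarith)
  have h := EulerProduct.eulerProduct_hasProd
    (f := fun n : ℕ => G n * (((n : ℝ) ^ (-σ) : ℝ) : ℂ)) (by simp [hG1]) (fun {m n} hmn => by
      rcases Nat.eq_zero_or_pos m with rfl | hm
      · simp [hz]
      rcases Nat.eq_zero_or_pos n with rfl | hn
      · simp [hz]
      rw [hG.map_mul m n hm hn hmn, Nat.cast_mul, Real.mul_rpow (by positivity) (by positivity)]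
      push_cast
      ring) (summable_norm_mul_rpow hG.norm_le_one hσ) (by simp [hz])
  convert h.norm using 1
  funext p
  congr 1
  refine tsum_congr fun e => ?_
  rw [Nat.cast_pow, ← Real.rpow_pow_comm (Nat.cast_nonneg _)]
  push_cast
  rfl

lemma isMult_one : IsMultOfModulusLeOne fun _ => 1 :=
  ⟨fun _ _ _ _ _ => by simp, fun _ _ => by simp⟩

lemma prime_rpow_le_inv (p : Nat.Primes) {σ : ℝ} (hσ : 1 < σ) :
    ((p : ℕ) : ℝ) ^ (-σ) ≤ 1 / (p : ℕ) := by
  have hp : (1 : ℝ) ≤ (p : ℕ) := by exact_mod_cast p.2.one_lt.le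
  rw [one_div, ← Real.rpow_neg_one]
  exact Real.rpow_le_rpow_of_exponent_le hp (by linarith)

lemma prime_rpow_le_half (p : Nat.Primes) {σ : ℝ} (hσ : 1 < σ) :
    ((p : ℕ) : ℝ) ^ (-σ) ≤ 1 / 2 :=
  (prime_rpow_le_inv p hσ).trans
    (one_div_le_one_div_of_le (by norm_num) (by exact_mod_cast p.2.two_le))

lemma hasProd_zeta {σ : ℝ} (hσ : 1 < σ) :
    HasProd (fun p : Nat.Primes => (1 - ((p : ℕ) : ℝ) ^ (-σ))⁻¹) (∑' n : ℕ, 1 / (n : ℝ) ^ σ) := by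
  have h := hasProd_euler isMult_one rfl hσ
  simp only [one_mul] at h
  convert h using 1
  · funext p
    have hr0 : 0 ≤ ((p : ℕ) : ℝ) ^ (-σ) := by positivity
    have hr := prime_rpow_le_half p hσ
    rw [tsum_geometric_of_norm_lt_one (by
      rw [Complex.norm_real, Real.norm_of_nonneg hr0]
      linarith), ← Complex.ofReal_one, ← Complex.ofReal_sub, ← Complex.ofReal_inv,
      Complex.norm_real, Real.norm_of_nonneg (inv_nonneg.2 (by linarith))]
  · rw [← Complex.ofReal_tsum, Complex.norm_real, Real.norm_of_nonneg
      (tsum_nonneg fun n => by positivity)]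
    refine tsum_congr fun n => ?_
    rw [Real.rpow_neg (Nat.cast_nonneg n), one_div]

lemma summable_prime_inv_sq : Summable fun p : Nat.Primes => (1 / (p : ℕ) : ℝ) ^ 2 := by
  have h := (Nat.Primes.summable_rpow (r := -2)).2 (by norm_num)
  refine h.congr fun p => ?_
  rw [one_div, inv_pow, Real.rpow_neg (Nat.cast_nonneg _)]
  norm_num

lemma prime_rpow_sq_le (p : Nat.Primes) {σ : ℝ} (hσ : 1 < σ) :
    (((p : ℕ) : ℝ) ^ (-σ)) ^ 2 ≤ (1 / (p : ℕ) : ℝ) ^ 2 :=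
  pow_le_pow_left₀ (by positivity) (prime_rpow_le_inv p hσ) 2

/-- The sum `∑ 1 / p ^ 2` over the primes. -/
noncomputable def primeInvSq : ℝ := ∑' p : Nat.Primes, (1 / (p : ℕ) : ℝ) ^ 2

lemma norm_prime_pow_le (hG : IsMultOfModulusLeOne G) (p : Nat.Primes) (e : ℕ) :
    ‖G ((p : ℕ) ^ e)‖ ≤ 1 := hG.norm_le_one _ (Nat.pow_pos p.2.pos)

/-- A lower bound for a Dirichlet series whose coefficients at primes are close to `1`. -/
lemma exists_le_norm_tsum (hG : IsMultOfModulusLeOne G) (hG1 : G 1 = 1)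
    (hG2 : ∀ m, 0 < m → G (2 ^ m) = 0)
    (hsum : Summable fun p : Nat.Primes => (1 / (p : ℕ) : ℝ) * (1 - (G p).re)) :
    ∃ c : ℝ, 0 < c ∧ ∀ σ : ℝ, 1 < σ →
      c * ∑' n : ℕ, 1 / (n : ℝ) ^ σ ≤ ‖∑' n : ℕ, G n * (((n : ℝ) ^ (-σ) : ℝ) : ℂ)‖ := by
  set D := ∑' p : Nat.Primes, (1 / (p : ℕ) : ℝ) * (1 - (G p).re) with hD
  have hre : ∀ p : Nat.Primes, 0 ≤ 1 - (G p).re := fun p => by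
    linarith [(Complex.re_le_norm (G p)).trans (hG.norm_le_one p p.2.pos)]
  refine ⟨Real.exp (-(D + 8 * primeInvSq)), Real.exp_pos _, fun σ hσ => ?_⟩
  have h1 := hasProd_zeta hσ
  have h2 := hasProd_euler hG hG1 hσ
  refine le_of_tendsto_of_tendsto' (Tendsto.const_mul _ h1) h2 fun s => ?_
  have hfac : ∀ p ∈ s, (1 - ((p : ℕ) : ℝ) ^ (-σ))⁻¹ *
      Real.exp (-((1 - (G p).re) * ((p : ℕ) : ℝ) ^ (-σ)) - 8 * (((p : ℕ) : ℝ) ^ (-σ)) ^ 2) ≤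
      ‖∑' e, G ((p : ℕ) ^ e) * ((((p : ℕ) : ℝ) ^ (-σ) : ℝ) : ℂ) ^ e‖ := by
    intro p _
    have h3 := local_factor_ge (a := fun e => G ((p : ℕ) ^ e)) (r := ((p : ℕ) : ℝ) ^ (-σ))
      (by simp [hG1]) (norm_prime_pow_le hG p) (by positivity) (by
        by_cases hp : (p : ℕ) = 2
        · right
          refine ⟨prime_rpow_le_half p hσ, fun e he => ?_⟩
          simp only [hp]
          exact hG2 e he
        · left
          refine (prime_rpow_le_inv p hσ).trans (one_div_le_one_div_of_le (by norm_num) ?_)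
          have : 3 ≤ (p : ℕ) := by
            have := p.2.two_le
            omega
          exact_mod_cast this)
    simpa only [pow_one] using h3
  have hprod := Finset.prod_le_prod (fun p _ => mul_nonneg (inv_nonneg.2 (by
    linarith [prime_rpow_le_half p hσ])) (Real.exp_pos _).le) hfac
  rw [Finset.prod_mul_distrib, ← Real.exp_sum] at hprod
  refine le_trans ?_ hprod
  rw [mul_comm]
  refine mul_le_mul_of_nonneg_left (Real.exp_le_exp.2 ?_) (Finset.prod_nonneg fun p _ =>
    inv_nonneg.2 (by linarith [prime_rpow_le_half p hσ]))
  rw [Finset.sum_sub_distrib, Finset.sum_neg_distrib, ← Finset.mul_sum]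
  have e1 : ∑ p ∈ s, (1 - (G p).re) * ((p : ℕ) : ℝ) ^ (-σ) ≤ D := by
    refine le_trans (Finset.sum_le_sum fun p _ => ?_)
      (hsum.sum_le_tsum s fun p _ => mul_nonneg (by positivity) (hre p))
    rw [mul_comm]
    exact mul_le_mul_of_nonneg_right (prime_rpow_le_inv p hσ) (hre p)
  have e2 : ∑ p ∈ s, (((p : ℕ) : ℝ) ^ (-σ)) ^ 2 ≤ primeInvSq :=
    le_trans (Finset.sum_le_sum fun p _ => prime_rpow_sq_le p hσ)
      (summable_prime_inv_sq.sum_le_tsum s fun p _ => by positivity)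
  linarith

/-- An upper bound for a Dirichlet series with nonnegative coefficients, some of which are less
than `1` at primes. -/
lemma tsum_norm_mul_rpow_le (hG : IsMultOfModulusLeOne G) (hG1 : G 1 = 1) {σ : ℝ} (hσ : 1 < σ)
    (t : Finset Nat.Primes) :
    ∑' n : ℕ, ‖G n‖ * (n : ℝ) ^ (-σ) ≤
      Real.exp (-(∑ p ∈ t, (1 - ‖G p‖) * ((p : ℕ) : ℝ) ^ (-σ)) + 2 * primeInvSq) *
        ∑' n : ℕ, 1 / (n : ℝ) ^ σ := by
  have hH : IsMultOfModulusLeOne fun n => (‖G n‖ : ℂ) :=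
    ⟨fun m n hm hn hmn => by rw [hG.map_mul m n hm hn hmn, norm_mul]; push_cast; rfl,
      fun n hn => by simpa using hG.norm_le_one n hn⟩
  have h1 := hasProd_zeta hσ
  have h2 := hasProd_euler hH (by simp [hG1]) hσ
  have h3 : ‖∑' n : ℕ, (‖G n‖ : ℂ) * (((n : ℝ) ^ (-σ) : ℝ) : ℂ)‖ =
      ∑' n : ℕ, ‖G n‖ * (n : ℝ) ^ (-σ) := by
    simp_rw [← Complex.ofReal_mul]
    rw [← Complex.ofReal_tsum, Complex.norm_real, Real.norm_of_nonneg
      (tsum_nonneg fun n => by positivity)]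
  rw [h3] at h2
  refine le_of_tendsto_of_tendsto h2 (Tendsto.const_mul _ h1) ?_
  filter_upwards [eventually_ge_atTop t] with s hts
  have hfac : ∀ p ∈ s, ‖∑' e, (‖G ((p : ℕ) ^ e)‖ : ℂ) * ((((p : ℕ) : ℝ) ^ (-σ) : ℝ) : ℂ) ^ e‖ ≤
      (1 - ((p : ℕ) : ℝ) ^ (-σ))⁻¹ * Real.exp (-((1 - ‖G p‖) * ((p : ℕ) : ℝ) ^ (-σ)) +
        2 * (((p : ℕ) : ℝ) ^ (-σ)) ^ 2) := by
    intro p _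
    have h3 := local_factor_le (a := fun e => (‖G ((p : ℕ) ^ e)‖ : ℂ))
      (r := ((p : ℕ) : ℝ) ^ (-σ)) (by simp [hG1]) (norm_prime_pow_le hH p) (by positivity)
      (prime_rpow_le_half p hσ)
    simpa only [pow_one, Complex.norm_real, norm_norm] using h3
  have hprod := Finset.prod_le_prod (fun p _ => norm_nonneg _) hfac
  rw [Finset.prod_mul_distrib, ← Real.exp_sum] at hprod
  refine hprod.trans ?_
  rw [mul_comm]
  refine mul_le_mul_of_nonneg_right (Real.exp_le_exp.2 ?_) (Finset.prod_nonneg fun p _ =>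
    inv_nonneg.2 (by linarith [prime_rpow_le_half p hσ]))
  rw [Finset.sum_add_distrib, Finset.sum_neg_distrib, ← Finset.mul_sum]
  have e1 : ∑ p ∈ t, (1 - ‖G p‖) * ((p : ℕ) : ℝ) ^ (-σ) ≤
      ∑ p ∈ s, (1 - ‖G p‖) * ((p : ℕ) : ℝ) ^ (-σ) :=
    Finset.sum_le_sum_of_subset_of_nonneg hts fun p _ _ =>
      mul_nonneg (sub_nonneg.2 (hG.norm_le_one p p.2.pos)) (by positivity)
  have e2 : ∑ p ∈ s, (((p : ℕ) : ℝ) ^ (-σ)) ^ 2 ≤ primeInvSq :=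
    le_trans (Finset.sum_le_sum fun p _ => prime_rpow_sq_le p hσ)
      (summable_prime_inv_sq.sum_le_tsum s fun p _ => by positivity)
  linarith

/-- The Euler product loses a factor `exp (-M)` against zeta, where divergence makes `M` arbitrarily
large already on a finite set of primes; there the sum is continuous at `σ = 1`. Meanwhile `(σ - 1)`
times zeta stays bounded. -/
lemma tendsto_sub_mul_tsum_norm (hG : IsMultOfModulusLeOne G) (hG1 : G 1 = 1)
    (hdiv : ¬ Summable fun p : Nat.Primes => (1 / (p : ℕ) : ℝ) * (1 - ‖G p‖)) :
    Tendsto (fun σ : ℝ => (σ - 1) * ∑' n : ℕ, ‖G n‖ * (n : ℝ) ^ (-σ)) (𝓝[>] 1) (𝓝 0) := by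
  have hnn : ∀ p : Nat.Primes, 0 ≤ (1 / (p : ℕ) : ℝ) * (1 - ‖G p‖) := fun p =>
    mul_nonneg (by positivity) (sub_nonneg.2 (hG.norm_le_one p p.2.pos))
  rw [Metric.tendsto_nhds]
  intro ε hε
  have hexp : Tendsto (fun M : ℝ => 2 * Real.exp (2 * primeInvSq) * Real.exp (-M)) atTop
      (𝓝 (2 * Real.exp (2 * primeInvSq) * 0)) :=
    Real.tendsto_exp_neg_atTop_nhds_zero.const_mul _
  rw [mul_zero] at hexp
  obtain ⟨M, hM⟩ := (hexp.eventually (gt_mem_nhds hε)).exists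
  obtain ⟨t, ht⟩ : ∃ t : Finset Nat.Primes, M < ∑ p ∈ t, (1 / (p : ℕ) : ℝ) * (1 - ‖G p‖) := by
    by_contra! hc
    exact hdiv (summable_of_sum_le hnn hc)
  have hcont : Tendsto (fun σ : ℝ => ∑ p ∈ t, (1 - ‖G p‖) * ((p : ℕ) : ℝ) ^ (-σ)) (𝓝[>] 1)
      (𝓝 (∑ p ∈ t, (1 / (p : ℕ) : ℝ) * (1 - ‖G p‖))) := by
    refine tendsto_finsetSum _ fun p _ => ?_
    have hp : ((p : ℕ) : ℝ) ≠ 0 := by exact_mod_cast p.2.ne_zero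
    have h1 : ContinuousAt (fun σ : ℝ => (1 - ‖G p‖) * ((p : ℕ) : ℝ) ^ (-σ)) 1 :=
      continuousAt_const.mul ((Real.continuousAt_const_rpow hp).comp continuous_neg.continuousAt)
    have h2 := h1.tendsto.mono_left (nhdsWithin_le_nhds (s := Set.Ioi 1))
    rwa [Real.rpow_neg_one, ← one_div, mul_comm] at h2
  filter_upwards [hcont.eventually (lt_mem_nhds ht),
    tendsto_sub_mul_tsum_nat_rpow.eventually (gt_mem_nhds (show (1 : ℝ) < 2 by norm_num)),
    self_mem_nhdsWithin] with σ h1 h2 h3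
  have hσ : 1 < σ := h3
  have h4 := tsum_norm_mul_rpow_le hG hG1 hσ t
  rw [dist_zero_right, Real.norm_of_nonneg (mul_nonneg (by linarith)
    (tsum_nonneg fun n => by positivity))]
  refine lt_of_le_of_lt ?_ hM
  have hZ : 0 ≤ (σ - 1) * ∑' n : ℕ, 1 / (n : ℝ) ^ σ :=
    mul_nonneg (by linarith) (tsum_nonneg fun n => by positivity)
  calc _ ≤ (σ - 1) * (Real.exp (-(∑ p ∈ t, (1 - ‖G p‖) * ((p : ℕ) : ℝ) ^ (-σ)) + 2 * primeInvSq) *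
        ∑' n : ℕ, 1 / (n : ℝ) ^ σ) := mul_le_mul_of_nonneg_left h4 (by linarith)
    _ = Real.exp (-(∑ p ∈ t, (1 - ‖G p‖) * ((p : ℕ) : ℝ) ^ (-σ)) + 2 * primeInvSq) *
        ((σ - 1) * ∑' n : ℕ, 1 / (n : ℝ) ^ σ) := by ring
    _ ≤ Real.exp (-M + 2 * primeInvSq) * 2 := by
      refine mul_le_mul (Real.exp_le_exp.2 (by linarith)) h2.le hZ (Real.exp_pos _).le
    _ = _ := by
      rw [Real.exp_add]
      ring

/-- The mean value cannot vanish if the values at primes are close to `1` and the values at powers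
of `2` vanish. -/
theorem not_tendsto_avg_zero (hG : IsMultOfModulusLeOne G) (hG1 : G 1 = 1)
    (hG2 : ∀ m, 0 < m → G (2 ^ m) = 0)
    (hsum : Summable fun p : Nat.Primes => (1 / (p : ℕ) : ℝ) * (1 - (G p).re)) :
    ¬ Tendsto (avg G) atTop (𝓝 0) := by
  intro h
  obtain ⟨c, hc, hle⟩ := exists_le_norm_tsum hG hG1 hG2 hsum
  -- Abelian direction: mean value zero removes the pole at `1`, while the lower bound forces a
  -- limit of size at least `c`.
  have h1 : Tendsto (fun σ : ℝ => ((σ : ℂ) - 1) * LSeries G σ) (𝓝[>] 1) (𝓝 0) :=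
    LSeries_tendsto_sub_mul_nhds_one_of_tendsto_sum_div h fun s hs =>
      LSeriesSummable_of_bounded_of_one_lt_real (m := 1)
        (fun n hn => hG.norm_le_one n (Nat.pos_of_ne_zero hn)) hs
  have h2 := tendsto_sub_mul_tsum_nat_rpow.const_mul c
  rw [mul_one] at h2
  have h3 : c ≤ 0 := by
    refine le_of_tendsto_of_tendsto h2 (norm_zero (E := ℂ) ▸ h1.norm) ?_
    filter_upwards [self_mem_nhdsWithin] with σ hσ'
    have hσ : 1 < σ := hσ'
    have h4 : LSeries G σ = ∑' n : ℕ, G n * (((n : ℝ) ^ (-σ) : ℝ) : ℂ) := by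
      refine tsum_congr fun n => ?_
      rcases Nat.eq_zero_or_pos n with rfl | hn
      · have : (0 : ℝ) ^ (-σ) = 0 := Real.zero_rpow (by linarith)
        simp [this]
      · rw [LSeries.term_of_ne_zero hn.ne', Complex.ofReal_cpow (Nat.cast_nonneg n),
          div_eq_mul_inv, Complex.ofReal_neg, Complex.cpow_neg, Complex.ofReal_natCast]
    have h5 : ‖(σ : ℂ) - 1‖ = σ - 1 := by
      rw [← Complex.ofReal_one, ← Complex.ofReal_sub, Complex.norm_real,
        Real.norm_of_nonneg (by linarith)]
    rw [norm_mul, h5, h4]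
    have h6 := mul_le_mul_of_nonneg_left (hle σ hσ) (show 0 ≤ σ - 1 by linarith)
    linarith
  linarith

end

/-! ### Functions of small modulus at primes -/

section
open MeasureTheory

variable {g : ℕ → ℂ}

/-- One power of the mean is bounded by `1`; integrating the other over `u ≥ log n` gives `∑ ‖g n‖ /
n` up to `e ^ U`. Rankin's trick `1 / n ≤ e * n ^ {-(1 + 1 / U)}` in this range passes to the
Dirichlet series. -/
lemma integral_norm_logMean_le (hg : IsMultOfModulusLeOne g) {U : ℝ} (hU : 0 < U) :
    ∫ u in Set.Icc 0 U, ‖logMean g u‖ ^ 2 ≤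
      Real.exp 1 * ∑' n : ℕ, ‖g n‖ * (n : ℝ) ^ (-(1 + 1 / U)) := by
  have hg1 := hg.norm_le_one
  set N := ⌊Real.exp U⌋₊ with hN
  have hint : ∀ n : ℕ, Integrable fun u : ℝ =>
      ‖g n‖ * (Set.Ici (Real.log n)).indicator (fun u => Real.exp (-u)) u := fun n =>
    ((integrable_indicator_iff measurableSet_Ici).2
      ((integrableOn_Ici_iff_integrableOn_Ioi).2 (integrableOn_exp_neg_Ioi _))).const_mul _
  have hnn : ∀ (n : ℕ) (u : ℝ), 0 ≤ (Set.Ici (Real.log n)).indicator (fun u => Real.exp (-u)) u :=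
    fun n u => Set.indicator_nonneg (fun _ _ => (Real.exp_pos _).le) u
  have h1 : ∫ u in Set.Icc 0 U, ‖logMean g u‖ ^ 2 ≤ ∫ u, ∑ n ∈ Finset.Icc 1 N,
      ‖g n‖ * (Set.Ici (Real.log n)).indicator (fun u => Real.exp (-u)) u := by
    rw [← integral_indicator measurableSet_Icc]
    refine integral_mono_of_nonneg (Eventually.of_forall fun u => Set.indicator_nonneg
      (fun _ _ => by positivity) u) (integrable_finsetSum _ fun n _ => hint n)
      (Eventually.of_forall fun u => ?_)
    simp only
    by_cases hu : u ∈ Set.Icc 0 U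
    · rw [Set.indicator_of_mem hu]
      have h2 : ‖logMean g u‖ ^ 2 ≤ ‖logMean g u‖ := by
        rw [sq]
        exact mul_le_of_le_one_left (norm_nonneg _) (norm_logMean_le hg1 u)
      refine h2.trans ?_
      unfold logMean partialSum
      rw [norm_mul, Complex.norm_real, Real.norm_of_nonneg (Real.exp_pos _).le]
      refine (mul_le_mul_of_nonneg_right (norm_sum_le _ _) (Real.exp_pos _).le).trans ?_
      rw [Finset.sum_mul]
      have hsub : Finset.Icc 1 ⌊Real.exp u⌋₊ ⊆ Finset.Icc 1 N :=
        Finset.Icc_subset_Icc_right (Nat.floor_le_floor (Real.exp_le_exp.2 hu.2))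
      refine le_trans (Finset.sum_le_sum fun n hn => ?_)
        (Finset.sum_le_sum_of_subset_of_nonneg hsub fun n _ _ =>
          mul_nonneg (norm_nonneg _) (hnn n u))
      obtain ⟨hn1, hn2⟩ := Finset.mem_Icc.1 hn
      have hlog : Real.log n ≤ u := by
        rw [Real.log_le_iff_le_exp (by exact_mod_cast hn1)]
        exact (Nat.le_floor_iff (Real.exp_pos _).le).1 hn2
      rw [Set.indicator_of_mem (Set.mem_Ici.2 hlog)]
    · rw [Set.indicator_of_notMem hu]
      exact Finset.sum_nonneg fun n _ => mul_nonneg (norm_nonneg _) (hnn n u)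
  refine h1.trans ?_
  rw [integral_finsetSum _ fun n _ => hint n, ← tsum_mul_left]
  have hsm : Summable fun n : ℕ => Real.exp 1 * (‖g n‖ * (n : ℝ) ^ (-(1 + 1 / U))) := by
    refine Summable.mul_left _ ((summable_norm_mul_rpow hg1 (σ := 1 + 1 / U)
      (lt_add_of_pos_right _ (by positivity))).congr fun n => ?_)
    rw [norm_mul, norm_natCast_rpow_term]
  refine le_trans (Finset.sum_le_sum fun n hn => ?_)
    (hsm.sum_le_tsum (Finset.Icc 1 N) fun n _ => by positivity)
  obtain ⟨hn1, hn2⟩ := Finset.mem_Icc.1 hn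
  have hn0 : (0 : ℝ) < n := by exact_mod_cast hn1
  rw [integral_const_mul, integral_indicator measurableSet_Ici, integral_Ici_eq_integral_Ioi,
    integral_exp_neg_Ioi, mul_left_comm]
  refine mul_le_mul_of_nonneg_left ?_ (norm_nonneg _)
  have hlog : Real.log n ≤ U := by
    rw [Real.log_le_iff_le_exp hn0]
    exact (Nat.le_floor_iff (Real.exp_pos _).le).1 hn2
  rw [Real.rpow_def_of_pos hn0, ← Real.exp_add, Real.exp_le_exp]
  have : Real.log n / U ≤ 1 := (div_le_one hU).2 hlog
  have e : Real.log n * -(1 + 1 / U) = -Real.log n - Real.log n / U := by ring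
  rw [e]
  linarith

lemma IsMultOfModulusLeOne.map_one_eq (hg : IsMultOfModulusLeOne g) : g 1 = 0 ∨ g 1 = 1 := by
  have h := hg.map_mul 1 1 one_pos one_pos (Nat.coprime_one_left 1)
  rw [mul_one] at h
  by_cases h0 : g 1 = 0
  · exact Or.inl h0
  · exact Or.inr (mul_left_cancel₀ h0 (by rw [← h, mul_one]))

lemma IsMultOfModulusLeOne.eq_zero (hg : IsMultOfModulusLeOne g) (h1 : g 1 = 0) {n : ℕ}
    (hn : 0 < n) : g n = 0 := by
  have h := hg.map_mul 1 n one_pos hn (Nat.coprime_one_left n)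
  rwa [one_mul, h1, zero_mul] at h

/-- The logarithmic mean square of the mean values vanishes if the values at primes are small. -/
theorem tendsto_logMean_sq_zero_of_norm (hg : IsMultOfModulusLeOne g)
    (hdiv : ¬ Summable fun p : Nat.Primes => (1 / (p : ℕ) : ℝ) * (1 - ‖g p‖)) :
    Tendsto (fun U : ℝ => (∫ u in Set.Icc 0 U, ‖logMean g u‖ ^ 2) / U) atTop (𝓝 0) := by
  rcases hg.map_one_eq with h1 | h1
  · have hz : ∀ u, logMean g u = 0 := fun u => by
      unfold logMean partialSum
      rw [Finset.sum_eq_zero fun n hn => hg.eq_zero h1 (Finset.mem_Icc.1 hn).1, zero_mul]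
    simp [hz]
  have hσ : Tendsto (fun U : ℝ => 1 + 1 / U) atTop (𝓝[>] 1) := by
    refine tendsto_nhdsWithin_iff.2 ⟨?_, ?_⟩
    · have : Tendsto (fun U : ℝ => 1 + 1 / U) atTop (𝓝 (1 + 0)) :=
        tendsto_const_nhds.add (tendsto_const_nhds.div_atTop tendsto_id)
      rwa [add_zero] at this
    · filter_upwards [eventually_gt_atTop 0] with U hU
      change 1 < 1 + 1 / U
      exact lt_add_of_pos_right _ (by positivity)
  have h2 := ((tendsto_sub_mul_tsum_norm hg h1 hdiv).comp hσ).const_mul (Real.exp 1)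
  rw [mul_zero] at h2
  refine tendsto_of_tendsto_of_tendsto_of_le_of_le' tendsto_const_nhds h2 ?_ ?_
  · filter_upwards [eventually_gt_atTop 0] with U hU
    exact div_nonneg (integral_nonneg fun u => by positivity) hU.le
  · filter_upwards [eventually_gt_atTop 0] with U hU
    rw [div_le_iff₀ hU]
    refine (integral_norm_logMean_le hg hU).trans (le_of_eq ?_)
    simp only [Function.comp, add_sub_cancel_left]
    field_simp

end

/-! ### Halász's criterion and twists by `n ^ {it}` -/

section
variable {g : ℕ → ℂ}

/-- The multiplicative function `g n * n ^ {-it}`. -/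
noncomputable def archTwist (g : ℕ → ℂ) (t : ℝ) (n : ℕ) : ℂ :=
  g n * Complex.exp (-(Complex.I * t * Real.log n))

lemma isMult_archTwist (hg : IsMultOfModulusLeOne g) (t : ℝ) :
    IsMultOfModulusLeOne (archTwist g t) := by
  refine ⟨fun m n hm hn hmn => ?_, fun n hn => ?_⟩
  · have hm' : (m : ℝ) ≠ 0 := by exact_mod_cast hm.ne'
    have hn' : (n : ℝ) ≠ 0 := by exact_mod_cast hn.ne'
    unfold archTwist
    rw [hg.map_mul m n hm hn hmn, Nat.cast_mul, Real.log_mul hm' hn', Complex.ofReal_add, mul_add,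
      neg_add, Complex.exp_add]
    ring
  · unfold archTwist
    rw [norm_mul, norm_exp_neg_I_mul, mul_one]
    exact hg.norm_le_one n hn

/-- A multiplicative function of modulus at most `1` that is at infinite distance from every
`n ^ {it}` has mean value zero (Halász). -/
theorem tendsto_avg_zero_of_not_summable (hg : IsMultOfModulusLeOne g)
    (hdiv : ∀ t : ℝ, ¬ Summable fun p : Nat.Primes =>
      (1 / (p : ℕ) : ℝ) * (1 - (archTwist g t p).re)) :
    Tendsto (avg g) atTop (𝓝 0) := by
  refine tendsto_avg_zero_of_logMean_sq hg ?_
  -- Since `2 * (1 - Re z) = |1 - z| ^ 2 + (1 - |z| ^ 2)`, the two measures of distance diverge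
  -- together once `∑ (1 - ‖g p‖) / p` converges. Otherwise smallness of the moduli suffices by
  -- itself.
  by_cases hn : Summable fun p : Nat.Primes => (1 / (p : ℕ) : ℝ) * (1 - ‖g p‖)
  · refine tendsto_logMean_sq_zero hg fun t hs => hdiv t ?_
    have h1 := (hn.mul_left 2).add hs
    refine Summable.of_nonneg_of_le (fun p => ?_) (fun p => ?_) h1
    · have h2 := (Complex.re_le_norm _).trans ((isMult_archTwist hg t).norm_le_one p p.2.pos)
      exact mul_nonneg (by positivity) (by linarith)
    · set z := archTwist g t p with hz
      have hz1 : ‖z‖ = ‖g p‖ := by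
        rw [hz, archTwist, norm_mul, norm_exp_neg_I_mul, mul_one]
      have h2 : ‖1 - z‖ ^ 2 = 1 + ‖z‖ ^ 2 - 2 * z.re := by
        rw [← Complex.normSq_eq_norm_sq, ← Complex.normSq_eq_norm_sq, Complex.normSq_sub]
        simp
      have h3 : ‖g p‖ ≤ 1 := hg.norm_le_one p p.2.pos
      have h4 : 1 - z.re ≤ 2 * (1 - ‖g p‖) + ‖1 - z‖ ^ 2 := by
        have h5 := Complex.re_le_norm z
        rw [h2, hz1]
        rw [hz1] at h5
        nlinarith [sq_nonneg (1 - ‖g p‖)]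
      have h5 := mul_le_mul_of_nonneg_left h4 (show (0 : ℝ) ≤ 1 / (p : ℕ) by positivity)
      refine h5.trans (le_of_eq ?_)
      rw [mul_add, hz, archTwist]
      ring
  · exact tendsto_logMean_sq_zero_of_norm hg hn

lemma sum_mul_by_parts (g b : ℕ → ℂ) (N : ℕ) :
    ∑ n ∈ Finset.Icc 1 N, g n * b n = (∑ n ∈ Finset.Icc 1 N, g n) * b (N + 1) -
      ∑ n ∈ Finset.Icc 1 N, (∑ k ∈ Finset.Icc 1 n, g k) * (b (n + 1) - b n) := by
  induction N with
  | zero => simp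
  | succ N ih =>
    rw [Finset.sum_Icc_succ_top (by omega), ih, Finset.sum_Icc_succ_top (by omega),
      Finset.sum_Icc_succ_top (by omega) (f := fun n =>
        (∑ k ∈ Finset.Icc 1 n, g k) * (b (n + 1) - b n)), Finset.sum_Icc_succ_top (by omega)]
    ring

lemma norm_exp_log_succ_sub_le (t : ℝ) {n : ℕ} (hn : 0 < n) :
    ‖Complex.exp (-(Complex.I * t * Real.log (n + 1 : ℕ))) -
      Complex.exp (-(Complex.I * t * Real.log n))‖ ≤ |t| / n := by
  have hn0 : (0 : ℝ) < n := by exact_mod_cast hn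
  set d := Real.log (n + 1 : ℕ) - Real.log n with hd
  have hd0 : 0 ≤ d := sub_nonneg.2 (Real.log_le_log hn0 (by push_cast; linarith))
  have hd1 : d ≤ 1 / n := by
    rw [hd, ← Real.log_div (by positivity) hn0.ne']
    refine (Real.log_le_sub_one_of_pos (by positivity)).trans (le_of_eq ?_)
    push_cast
    field_simp
    ring
  have h1 : Complex.exp (-(Complex.I * t * Real.log (n + 1 : ℕ))) -
      Complex.exp (-(Complex.I * t * Real.log n)) = Complex.exp (-(Complex.I * t * Real.log n)) *
        (Complex.exp (Complex.I * ((-(t * d) : ℝ) : ℂ)) - 1) := by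
    rw [mul_sub, mul_one, ← Complex.exp_add]
    congr 2
    rw [hd]
    push_cast
    ring
  rw [h1, norm_mul, norm_exp_neg_I_mul, one_mul]
  refine Real.norm_exp_I_mul_ofReal_sub_one_le.trans ?_
  rw [Real.norm_eq_abs, abs_neg, abs_mul, abs_of_nonneg hd0, div_eq_mul_one_div]
  gcongr

/-- Mean value zero is preserved by twisting with `n ^ {-it}`. -/
theorem tendsto_avg_archTwist (hg : Tendsto (avg g) atTop (𝓝 0)) (t : ℝ) :
    Tendsto (avg (archTwist g t)) atTop (𝓝 0) := by
  have hces := hg.norm.cesaro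
  rw [norm_zero] at hces
  have hces' : Tendsto (fun N : ℕ => ‖avg g N‖ + |t| *
      ((((N + 1 : ℕ) : ℝ)⁻¹ * ∑ n ∈ Finset.range (N + 1), ‖avg g n‖) * 2)) atTop
      (𝓝 (0 + |t| * (0 * 2))) := by
    have h1 := hg.norm
    rw [norm_zero] at h1
    exact h1.add (((hces.comp (tendsto_add_atTop_nat 1)).mul_const 2).const_mul |t|)
  simp only [zero_mul, mul_zero, add_zero] at hces'
  refine squeeze_zero_norm' ?_ hces'
  filter_upwards [eventually_gt_atTop 0] with N hN
  have hN0 : (0 : ℝ) < N := by exact_mod_cast hN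
  set b : ℕ → ℂ := fun n => Complex.exp (-(Complex.I * t * Real.log n)) with hb
  have hS : ∀ n : ℕ, 0 < n → ‖∑ k ∈ Finset.Icc 1 n, g k‖ = n * ‖avg g n‖ := fun n hn => by
    have hn0 : (n : ℝ) ≠ 0 := by exact_mod_cast hn.ne'
    rw [avg, norm_div, Complex.norm_natCast]
    field_simp
  -- Summation by parts: `n ^ {-it}` changes by at most `|t| / n` from `n` to `n + 1`, which turns
  -- the partial sums of `g` into a Cesàro average of its mean values.
  have h1 : ‖∑ n ∈ Finset.Icc 1 N, archTwist g t n‖ ≤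
      N * ‖avg g N‖ + |t| * ∑ n ∈ Finset.range (N + 1), ‖avg g n‖ := by
    rw [show ∑ n ∈ Finset.Icc 1 N, archTwist g t n = ∑ n ∈ Finset.Icc 1 N, g n * b n from rfl,
      sum_mul_by_parts]
    refine (norm_sub_le _ _).trans (add_le_add ?_ ?_)
    · rw [norm_mul, hS N hN, hb]
      simp only [norm_exp_neg_I_mul, mul_one, le_refl]
    · rw [Finset.mul_sum]
      have hsub : Finset.Icc 1 N ⊆ Finset.range (N + 1) := fun n hn => by
        simp only [Finset.mem_Icc, Finset.mem_range] at hn ⊢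
        omega
      refine (norm_sum_le _ _).trans (le_trans (Finset.sum_le_sum fun n hn => ?_)
        (Finset.sum_le_sum_of_subset_of_nonneg hsub fun n _ _ => by positivity))
      have hn := (Finset.mem_Icc.1 hn).1
      have hn0 : (n : ℝ) ≠ 0 := by exact_mod_cast (show n ≠ 0 by omega)
      rw [norm_mul, hS n hn]
      calc _ ≤ n * ‖avg g n‖ * (|t| / n) :=
            mul_le_mul_of_nonneg_left (norm_exp_log_succ_sub_le t hn) (by positivity)
        _ = _ := by field_simp
  rw [avg, norm_div, Complex.norm_natCast, div_le_iff₀ hN0]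
  refine h1.trans ?_
  rw [add_mul, mul_comm (N : ℝ)]
  refine add_le_add le_rfl ?_
  rw [mul_assoc]
  refine mul_le_mul_of_nonneg_left ?_ (abs_nonneg t)
  have hsum : 0 ≤ ∑ n ∈ Finset.range (N + 1), ‖avg g n‖ := Finset.sum_nonneg fun _ _ => norm_nonneg _
  have hN1 : (1 : ℝ) ≤ N := by exact_mod_cast hN
  have h2 : 1 ≤ ((N + 1 : ℕ) : ℝ)⁻¹ * 2 * N := by
    push_cast
    rw [mul_assoc, inv_mul_eq_div, le_div_iff₀ (by positivity)]
    linarith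
  nlinarith

end

/-! ### Residue classes, additive characters and Dirichlet characters -/

section
variable {f : ℕ → ℂ}

/-- The function `f` has zero average along every residue class. -/
def HasZeroClassMeans (f : ℕ → ℂ) : Prop :=
  ∀ a : ℕ, 0 < a → ∀ c : ZMod a,
    Tendsto (avg fun n => if (n : ZMod a) = c then f n else 0) atTop (𝓝 0)

lemma sum_class_eq (f : ℕ → ℂ) {a : ℕ} (ha : 0 < a) (b M : ℕ) :
    ∑ n ∈ Finset.Icc 1 (a * M + b), (if (n : ZMod a) = (b : ZMod a) then f n else 0) =
      ∑ n ∈ Finset.Icc 1 b, (if (n : ZMod a) = (b : ZMod a) then f n else 0) +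
        ∑ m ∈ Finset.Icc 1 M, f (a * m + b) := by
  induction M with
  | zero => simp
  | succ M ih =>
    rw [Finset.sum_Icc_succ_top (by omega), ← add_assoc, ← ih]
    have h1 := Finset.sum_Ioc_consecutive
      (fun n : ℕ => if (n : ZMod a) = (b : ZMod a) then f n else 0) (Nat.zero_le (a * M + b))
      (show a * M + b ≤ a * (M + 1) + b by nlinarith)
    change _ = ∑ n ∈ Finset.Icc 1 (a * (M + 1) + b), _ at h1
    rw [← h1]
    congr 1
    rw [Finset.sum_eq_single (a * (M + 1) + b)]
    · simp
    · intro n hn hne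
      rw [Finset.mem_Ioc] at hn
      rw [if_neg]
      intro hc
      rw [ZMod.natCast_eq_natCast_iff, Nat.ModEq.comm] at hc
      have hd := (Nat.modEq_iff_dvd' (by nlinarith)).1 hc
      obtain ⟨k, hk⟩ := hd
      have hn' : n = a * k + b := by omega
      have h2 : M < k := by
        by_contra! hc
        nlinarith [hn.1, Nat.mul_le_mul_left a hc]
      have h3 : k ≤ M + 1 := by
        by_contra! hc
        nlinarith [hn.2, Nat.mul_le_mul_left a hc.le]
      exact hne (by rw [hn', show k = M + 1 by omega])
    · intro hn
      exact absurd (Finset.mem_Ioc.2 ⟨by nlinarith, le_rfl⟩) hn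

lemma sum_eq_mul_avg (g : ℕ → ℂ) {N : ℕ} (hN : 0 < N) :
    ∑ n ∈ Finset.Icc 1 N, g n = N * avg g N := by
  have hn0 : (N : ℂ) ≠ 0 := by exact_mod_cast hN.ne'
  rw [avg]
  field_simp

lemma hasZeroClassMeans_of_isAperiodic (hf : ∀ n, 0 < n → ‖f n‖ ≤ 1) (h : IsAperiodic f) :
    HasZeroClassMeans f := by
  intro a ha c
  have : NeZero a := ⟨ha.ne'⟩
  -- Adding `a` makes the representative positive, as aperiodicity requires.
  set b := c.val + a with hb
  have hbc : (b : ZMod a) = c := by simp [hb]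
  set F : ℕ → ℂ := fun n => if (n : ZMod a) = c then f n else 0 with hF
  have hF1 : ∀ n, 0 < n → ‖F n‖ ≤ 1 := fun n hn => by
    simp only [hF]
    split_ifs
    · exact hf n hn
    · simp
  set K := ∑ n ∈ Finset.Icc 1 b, F n with hK
  have hlim := (h a b ha (by omega)).norm
  rw [norm_zero] at hlim
  have hdiv : Tendsto (fun N : ℕ => (N - b) / a) atTop atTop :=
    (Nat.tendsto_div_const_atTop ha.ne').comp (tendsto_sub_atTop_nat b)
  have h1 : Tendsto (fun N : ℕ => (‖K‖ + a) / (N : ℝ) + ‖avg (fun n => f (a * n + b)) ((N - b) / a)‖)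
      atTop (𝓝 (0 + 0)) :=
    (tendsto_const_nhds.div_atTop tendsto_natCast_atTop_atTop).add (hlim.comp hdiv)
  rw [add_zero] at h1
  refine squeeze_zero_norm' ?_ h1
  filter_upwards [eventually_ge_atTop (a + b)] with N hN
  set M := (N - b) / a with hM
  have hM0 : 0 < M := Nat.div_pos (by omega) ha
  have hN0 : (0 : ℝ) < N := by exact_mod_cast (show 0 < N by omega)
  have hdm := Nat.div_add_mod (N - b) a
  have hml := Nat.mod_lt (N - b) ha
  rw [← hM] at hdm
  have hMN : a * M + b ≤ N := by omega
  have h2 : ∑ n ∈ Finset.Icc 1 N, F n = (K + ∑ m ∈ Finset.Icc 1 M, f (a * m + b)) +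
      ∑ n ∈ Finset.Ioc (a * M + b) N, F n := by
    have h3 := sum_class_eq f ha b M
    rw [hbc] at h3
    rw [hK, ← h3]
    exact (Finset.sum_Ioc_consecutive F (Nat.zero_le _) hMN).symm
  have h3 : ‖∑ n ∈ Finset.Ioc (a * M + b) N, F n‖ ≤ a := by
    refine (norm_sum_le_card hF1 _ fun n hn =>
      (Nat.zero_le _).trans_lt (Finset.mem_Ioc.1 hn).1).trans ?_
    rw [Nat.card_Ioc]
    exact_mod_cast (show N - (a * M + b) ≤ a by omega)
  rw [avg, norm_div, Complex.norm_natCast, div_le_iff₀ hN0, h2,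
    sum_eq_mul_avg (fun m => f (a * m + b)) hM0]
  set A := avg (fun n => f (a * n + b)) M with hA
  have h4 : ‖(M : ℂ) * A‖ ≤ N * ‖A‖ := by
    rw [norm_mul, Complex.norm_natCast]
    refine mul_le_mul_of_nonneg_right ?_ (norm_nonneg _)
    exact_mod_cast (show M ≤ N by nlinarith)
  calc _ ≤ ‖K‖ + ‖(M : ℂ) * A‖ + ‖∑ n ∈ Finset.Ioc (a * M + b) N, F n‖ := norm_add₃_le
    _ ≤ ‖K‖ + N * ‖A‖ + a := by gcongr
    _ = _ := by
      field_simp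
      ring

lemma isAperiodic_of_hasZeroClassMeans (h : HasZeroClassMeans f) : IsAperiodic f := by
  intro a b ha hb
  set F : ℕ → ℂ := fun n => if (n : ZMod a) = (b : ZMod a) then f n else 0 with hF
  set K := ∑ n ∈ Finset.Icc 1 b, F n with hK
  have hidx : Tendsto (fun M : ℕ => a * M + b) atTop atTop :=
    tendsto_atTop_mono (fun M => (Nat.le_mul_of_pos_left M ha).trans (Nat.le_add_right _ _))
      tendsto_id
  have hlim := ((h a ha b).comp hidx).norm
  rw [norm_zero] at hlim
  have h1 : Tendsto (fun M : ℕ => ‖avg F (a * M + b)‖ * (a + b) + ‖K‖ / (M : ℝ)) atTop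
      (𝓝 (0 * (a + b) + 0)) :=
    (hlim.mul_const _).add (tendsto_const_nhds.div_atTop tendsto_natCast_atTop_atTop)
  rw [zero_mul, add_zero] at h1
  refine squeeze_zero_norm' ?_ h1
  filter_upwards [eventually_gt_atTop 0] with M hM
  have hM0 : (1 : ℝ) ≤ M := by exact_mod_cast hM
  have h2 := sum_class_eq f ha b M
  have h3 : ∑ m ∈ Finset.Icc 1 M, f (a * m + b) =
      ((a * M + b : ℕ) : ℂ) * avg F (a * M + b) - K := by
    rw [← sum_eq_mul_avg F (by omega), h2]
    ring
  rw [avg, h3, norm_div, Complex.norm_natCast, div_le_iff₀ (by linarith)]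
  refine (norm_sub_le _ _).trans ?_
  rw [norm_mul, Complex.norm_natCast, add_mul, div_mul_cancel₀ _ (by linarith)]
  refine add_le_add_left ?_ _
  rw [mul_comm, mul_assoc]
  refine mul_le_mul_of_nonneg_left ?_ (norm_nonneg _)
  push_cast
  nlinarith [show (0 : ℝ) ≤ b from Nat.cast_nonneg b]

lemma avg_sum {ι : Type*} (s : Finset ι) (g : ι → ℕ → ℂ) (c : ι → ℂ) (N : ℕ) :
    avg (fun n => ∑ i ∈ s, c i * g i n) N = ∑ i ∈ s, c i * avg (g i) N := by
  unfold avg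
  rw [Finset.sum_comm, Finset.sum_div]
  refine Finset.sum_congr rfl fun i _ => ?_
  rw [← Finset.mul_sum, mul_div_assoc]

lemma tendsto_avg_sum {ι : Type*} (s : Finset ι) (g : ι → ℕ → ℂ) (c : ι → ℂ)
    (h : ∀ i ∈ s, Tendsto (avg (g i)) atTop (𝓝 0)) :
    Tendsto (avg fun n => ∑ i ∈ s, c i * g i n) atTop (𝓝 0) := by
  have h1 : Tendsto (fun N => ∑ i ∈ s, c i * avg (g i) N) atTop (𝓝 (∑ i ∈ s, c i * 0)) :=
    tendsto_finsetSum _ fun i hi => (h i hi).const_mul _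
  simp only [mul_zero, Finset.sum_const_zero] at h1
  exact h1.congr fun N => (avg_sum s g c N).symm

lemma HasZeroClassMeans.tendsto_avg_mul (h : HasZeroClassMeans f) {a : ℕ} (ha : 0 < a)
    (F : ZMod a → ℂ) : Tendsto (avg fun n => f n * F n) atTop (𝓝 0) := by
  have : NeZero a := ⟨ha.ne'⟩
  have h1 := tendsto_avg_sum Finset.univ
    (fun (c : ZMod a) (n : ℕ) => if (n : ZMod a) = c then f n else 0) F fun c _ => h a ha c
  refine h1.congr fun N => ?_
  congr 1
  funext n
  simp [mul_comm]

lemma expChar_eq_stdAddChar {q : ℕ} (hq : 0 < q) (n p : ℕ) :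
    expChar ((n : ℝ) * p / q) = (letI : NeZero q := ⟨hq.ne'⟩
      ZMod.stdAddChar ((p : ZMod q) * (n : ZMod q))) := by
  have : NeZero q := ⟨hq.ne'⟩
  have h := ZMod.stdAddChar_coe (N := q) ((p * n : ℕ) : ℤ)
  push_cast at h
  rw [h, expChar]
  push_cast
  congr 1
  ring

lemma HasZeroClassMeans.tendsto_avg_expChar (h : HasZeroClassMeans f) {q : ℕ} (hq : 0 < q)
    (p : ℕ) : Tendsto (avg fun n => f n * expChar ((n : ℝ) * p / q)) atTop (𝓝 0) := by
  have : NeZero q := ⟨hq.ne'⟩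
  simp_rw [expChar_eq_stdAddChar hq]
  exact h.tendsto_avg_mul hq fun x => ZMod.stdAddChar ((p : ZMod q) * x)

lemma hasZeroClassMeans_of_expChar
    (h : ∀ p q : ℕ, 0 < p → 0 < q →
      Tendsto (avg fun n => f n * expChar ((n : ℝ) * p / q)) atTop (𝓝 0)) :
    HasZeroClassMeans f := by
  intro a ha c
  have : NeZero a := ⟨ha.ne'⟩
  have h1 := tendsto_avg_sum Finset.univ
    -- Fourier inversion on `ZMod a`. The frequency is shifted by `a` because the hypothesis covers
    -- positive numerators only; the character is unchanged.
    (fun (j : ZMod a) (n : ℕ) => f n * expChar ((n : ℝ) * (j.val + a : ℕ) / a))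
    (fun j => (a : ℂ)⁻¹ * ZMod.stdAddChar (-(j * c))) fun j _ => h _ a (by omega) ha
  refine h1.congr fun N => ?_
  congr 1
  funext n
  have h2 : ∀ j : ZMod a, (a : ℂ)⁻¹ * ZMod.stdAddChar (-(j * c)) *
      (f n * expChar ((n : ℝ) * (j.val + a : ℕ) / a)) =
      (a : ℂ)⁻¹ * f n * ZMod.stdAddChar (j * ((n : ZMod a) - c)) := by
    intro j
    rw [expChar_eq_stdAddChar ha, mul_sub, sub_eq_add_neg (j * (n : ZMod a)),
      AddChar.map_add_eq_mul]
    have : ((j.val + a : ℕ) : ZMod a) = j := by simp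
    rw [this]
    ring
  have hac : (a : ℂ) ≠ 0 := by exact_mod_cast ha.ne'
  simp_rw [h2]
  rw [← Finset.mul_sum, AddChar.sum_mulShift _ (ZMod.isPrimitive_stdAddChar a), ZMod.card]
  by_cases hc : (n : ZMod a) = c
  · simp only [hc, sub_self, if_true]
    field_simp
  · simp [hc, sub_eq_zero]

lemma tendsto_avg_unit_class {a : ℕ} (ha : 0 < a)
    (h : ∀ χ : DirichletCharacter ℂ a, Tendsto (avg fun n => f n * χ (n : ZMod a)) atTop (𝓝 0))
    (u : (ZMod a)ˣ) :
    Tendsto (avg fun n => if (n : ZMod a) = u then f n else 0) atTop (𝓝 0) := by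
  have : NeZero a := ⟨ha.ne'⟩
  have h1 := tendsto_avg_sum Finset.univ
    (fun (χ : DirichletCharacter ℂ a) (n : ℕ) => f n * χ (n : ZMod a))
    (fun χ => (a.totient : ℂ)⁻¹ * χ (u : ZMod a)⁻¹) fun χ _ => h χ
  refine h1.congr fun N => ?_
  congr 1
  funext n
  have h2 := DirichletCharacter.sum_char_inv_mul_char_eq ℂ u.isUnit (n : ZMod a)
  have hac : (a.totient : ℂ) ≠ 0 := by exact_mod_cast (Nat.totient_pos.2 ha).ne'
  calc _ = (a.totient : ℂ)⁻¹ * f n * ∑ χ : DirichletCharacter ℂ a,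
        χ (u : ZMod a)⁻¹ * χ (n : ZMod a) := by
        rw [Finset.mul_sum]
        exact Finset.sum_congr rfl fun χ _ => by ring
    _ = _ := by
      rw [h2]
      by_cases hu : (u : ZMod a) = n
      · rw [if_pos hu, if_pos hu.symm]
        field_simp
      · rw [if_neg hu, if_neg (Ne.symm hu), mul_zero]

lemma exists_factored_mul_coprime {a : ℕ} (ha : 0 < a) {n : ℕ} (hn : 0 < n) :
    ∃ m k, m ∈ Nat.factoredNumbers a.primeFactors ∧ k.Coprime a ∧ m * k = n := by
  induction n using Nat.strong_induction_on with
  | _ n ih =>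
    by_cases hc : n.Coprime a
    · exact ⟨1, n, Nat.mem_factoredNumbers'.2 fun p hp h1 =>
        absurd (Nat.dvd_one.1 h1) hp.one_lt.ne', hc, one_mul n⟩
    · set g := n.gcd a with hg
      have hg0 : 0 < g := Nat.gcd_pos_of_pos_left a hn
      have hg1 : 1 < g := by
        have : g ≠ 1 := hc
        omega
      obtain ⟨n', hn'⟩ := Nat.gcd_dvd_left n a
      rw [← hg] at hn'
      have hn'0 : 0 < n' := Nat.pos_of_ne_zero fun h0 => by rw [h0] at hn'; omega
      obtain ⟨m, k, hm, hk, hmk⟩ := ih n' (by nlinarith) hn'0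
      refine ⟨g * m, k, Nat.mul_mem_factoredNumbers ?_ hm, hk, by rw [mul_assoc, hmk, ← hn']⟩
      rw [Nat.mem_factoredNumbers']
      exact fun p hp hpg =>
        Nat.mem_primeFactors.2 ⟨hp, hpg.trans (Nat.gcd_dvd_right n a), ha.ne'⟩

lemma coprime_of_factored {a m k : ℕ} (hm : m ∈ Nat.factoredNumbers a.primeFactors)
    (hk : k.Coprime a) : m.Coprime k := by
  refine Nat.coprime_of_dvd fun p hp hpm hpk => ?_
  have h1 := Nat.mem_factoredNumbers'.1 hm p hp hpm
  have h2 := Nat.dvd_gcd hpk (Nat.dvd_of_mem_primeFactors h1)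
  rw [hk] at h2
  exact hp.one_lt.ne' (Nat.dvd_one.1 h2)

lemma factored_mul_coprime_inj {a m k m' k' : ℕ} (hm : m ∈ Nat.factoredNumbers a.primeFactors)
    (hm' : m' ∈ Nat.factoredNumbers a.primeFactors) (hk : k.Coprime a) (hk' : k'.Coprime a)
    (h : m * k = m' * k') : m = m' :=
  Nat.dvd_antisymm
    ((coprime_of_factored hm hk').dvd_of_dvd_mul_right (h ▸ dvd_mul_right m k))
    ((coprime_of_factored hm' hk).dvd_of_dvd_mul_right (h ▸ dvd_mul_right m' k'))

open Classical in
lemma sum_eq_sum_factored {a : ℕ} (ha : 0 < a) (F : ℕ → ℂ) (N : ℕ) :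
    ∑ n ∈ Finset.Icc 1 N, F n =
      ∑ m ∈ (Finset.Icc 1 N).filter (· ∈ Nat.factoredNumbers a.primeFactors),
        ∑ k ∈ (Finset.Icc 1 (N / m)).filter (·.Coprime a), F (m * k) := by
  rw [Finset.sum_sigma']
  symm
  refine Finset.sum_bij (fun x _ => x.1 * x.2) ?_ ?_ ?_ ?_
  · rintro ⟨m, k⟩ hx
    simp only [Finset.mem_sigma, Finset.mem_filter, Finset.mem_Icc] at hx ⊢
    refine ⟨Nat.mul_pos hx.1.1.1 hx.2.1.1, ?_⟩
    rw [mul_comm]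
    exact (Nat.le_div_iff_mul_le hx.1.1.1).1 hx.2.1.2
  · rintro ⟨m, k⟩ hx ⟨m', k'⟩ hx' h
    simp only [Finset.mem_sigma, Finset.mem_filter, Finset.mem_Icc] at hx hx' h
    have h1 := factored_mul_coprime_inj hx.1.2 hx'.1.2 hx.2.2 hx'.2.2 h
    subst h1
    have h2 := Nat.eq_of_mul_eq_mul_left hx.1.1.1 h
    rw [h2]
  · intro n hn
    rw [Finset.mem_Icc] at hn
    obtain ⟨m, k, hm, hk, hmk⟩ := exists_factored_mul_coprime ha hn.1
    have hm0 : 0 < m := Nat.pos_of_ne_zero (Nat.ne_zero_of_mem_factoredNumbers hm)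
    have hk0 : 0 < k := Nat.pos_of_ne_zero fun h0 => by
      rw [h0, mul_zero] at hmk
      omega
    refine ⟨⟨m, k⟩, ?_, hmk⟩
    simp only [Finset.mem_sigma, Finset.mem_filter, Finset.mem_Icc]
    refine ⟨⟨⟨hm0, by nlinarith⟩, hm⟩, ⟨hk0, ?_⟩, hk⟩
    rw [Nat.le_div_iff_mul_le hm0, mul_comm, hmk]
    exact hn.2
  · intro _ _
    rfl

/-- The sum is a finite product of geometric series over the primes dividing `a`. -/
lemma summable_factored_inv (a : ℕ) :
    Summable fun m : Nat.factoredNumbers a.primeFactors => 1 / ((m : ℕ) : ℝ) := by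
  let φ : ℕ →* ℝ :=
    { toFun := fun n => 1 / (n : ℝ)
      map_one' := by simp
      map_mul' := fun m n => by push_cast; field_simp }
  have h := (EulerProduct.summable_and_hasSum_factoredNumbers_prod_filter_prime_geometric (f := φ)
    (fun {p} hp => by
      have : (1 : ℝ) < p := by exact_mod_cast hp.one_lt
      change ‖1 / (p : ℝ)‖ < 1
      rw [Real.norm_of_nonneg (by positivity), div_lt_one (by linarith)]
      exact this) a.primeFactors).1
  refine h.congr fun m => ?_
  change ‖1 / ((m : ℕ) : ℝ)‖ = _
  rw [Real.norm_of_nonneg (by positivity)]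

lemma tendsto_natDiv_ratio {R : ℕ → ℝ} (hR : Tendsto (fun N : ℕ => R N / N) atTop (𝓝 0))
    (h0 : ∀ N, 0 ≤ R N) {m : ℕ} (hm : 0 < m) :
    Tendsto (fun N : ℕ => R (N / m) / N) atTop (𝓝 0) := by
  refine squeeze_zero' (Eventually.of_forall fun N => div_nonneg (h0 _) (Nat.cast_nonneg _)) ?_
    (hR.comp (Nat.tendsto_div_const_atTop hm.ne'))
  filter_upwards [eventually_ge_atTop m] with N hN
  have h1 : 0 < N / m := Nat.div_pos hN hm
  exact div_le_div_of_nonneg_left (h0 _) (by exact_mod_cast h1)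
    (by exact_mod_cast Nat.div_le_self N m)

/-- Split `n = m * k` with `m` built from the primes of `a` and `k` coprime to `a`. Dividing by `gcd
n a` alone would not do, as `f` need not be completely multiplicative. For fixed `m` the sum over
`k` is governed by the invertible classes, and dominated convergence handles the sum over `m`. -/
lemma hasZeroClassMeans_of_characters (hf : IsMultOfModulusLeOne f)
    (h : ∀ q : ℕ, 0 < q → ∀ χ : DirichletCharacter ℂ q,
      Tendsto (avg fun n => f n * χ (n : ZMod q)) atTop (𝓝 0)) :
    HasZeroClassMeans f := by
  classical
  intro a ha c
  have : NeZero a := ⟨ha.ne'⟩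
  set A : (ZMod a)ˣ → ℕ → ℂ := fun u M =>
    ∑ k ∈ Finset.Icc 1 M, (if (k : ZMod a) = u then f k else 0) with hA
  set R : ℕ → ℝ := fun M => ∑ u, ‖A u M‖ with hR
  have hR0 : ∀ M, 0 ≤ R M := fun M => Finset.sum_nonneg fun u _ => norm_nonneg _
  have hRle : ∀ M : ℕ, R M ≤ Fintype.card (ZMod a)ˣ * M := fun M => by
    have h1 : ∀ u ∈ (Finset.univ : Finset (ZMod a)ˣ), ‖A u M‖ ≤ M := fun u _ => by
      refine (norm_sum_le_card (fun k hk => ?_) _ fun n hn => (Finset.mem_Icc.1 hn).1).trans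
        (by simp)
      split_ifs
      · exact hf.norm_le_one k hk
      · simp
    refine (Finset.sum_le_card_nsmul _ _ _ h1).trans ?_
    rw [nsmul_eq_mul, Finset.card_univ]
  have hRlim : Tendsto (fun N : ℕ => R N / N) atTop (𝓝 0) := by
    have h1 : Tendsto (fun N : ℕ => ∑ u : (ZMod a)ˣ,
        ‖avg (fun n => if (n : ZMod a) = u then f n else 0) N‖) atTop
        (𝓝 (∑ _u : (ZMod a)ˣ, ‖(0 : ℂ)‖)) :=
      tendsto_finsetSum _ fun u _ => (tendsto_avg_unit_class ha (h a ha) u).norm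
    simp only [norm_zero, Finset.sum_const_zero] at h1
    refine h1.congr fun N => ?_
    simp only [hR, hA, avg, norm_div, Complex.norm_natCast]
    rw [Finset.sum_div]
  have hinner : ∀ (m M : ℕ), m ∈ Nat.factoredNumbers a.primeFactors →
      ‖∑ k ∈ (Finset.Icc 1 M).filter (·.Coprime a),
        (if ((m * k : ℕ) : ZMod a) = c then f (m * k) else 0)‖ ≤ R M := by
    intro m M hm
    have hm0 : 0 < m := Nat.pos_of_ne_zero (Nat.ne_zero_of_mem_factoredNumbers hm)
    have h1 : ∑ k ∈ (Finset.Icc 1 M).filter (·.Coprime a),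
        (if ((m * k : ℕ) : ZMod a) = c then f (m * k) else 0) =
        f m * ∑ u : (ZMod a)ˣ, if (m : ZMod a) * u = c then A u M else 0 := by
      have h2 : ∀ u : (ZMod a)ˣ, (if (m : ZMod a) * u = c then A u M else 0) =
          ∑ k ∈ Finset.Icc 1 M,
            if (k : ZMod a) = u then (if (m : ZMod a) * u = c then f k else 0) else 0 := by
        intro u
        by_cases hu : (m : ZMod a) * u = c
        · simp only [hu, if_true, hA]
        · simp [hu]
      simp only [h2]
      rw [Finset.sum_comm, Finset.mul_sum, Finset.sum_filter]
      refine Finset.sum_congr rfl fun k hk => ?_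
      have hk0 : 0 < k := (Finset.mem_Icc.1 hk).1
      by_cases hka : k.Coprime a
      · rw [if_pos hka, Finset.sum_eq_single (ZMod.unitOfCoprime k hka),
          if_pos (ZMod.coe_unitOfCoprime k hka).symm, ZMod.coe_unitOfCoprime, Nat.cast_mul,
          hf.map_mul m k hm0 hk0 (coprime_of_factored hm hka), mul_ite, mul_zero]
        · intro u _ hu
          rw [if_neg]
          intro h3
          exact hu (Units.ext (by rw [ZMod.coe_unitOfCoprime, h3]))
        · intro h3
          exact absurd (Finset.mem_univ _) h3
      · rw [if_neg hka, Finset.sum_eq_zero, mul_zero]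
        intro u _
        rw [if_neg]
        intro h3
        exact hka ((ZMod.isUnit_iff_coprime k a).1 (h3 ▸ u.isUnit))
    rw [h1, norm_mul]
    refine (mul_le_of_le_one_left (norm_nonneg _) (hf.norm_le_one m hm0)).trans ?_
    refine (norm_sum_le _ _).trans (Finset.sum_le_sum fun u _ => ?_)
    split_ifs
    · exact le_rfl
    · simp
  have hdom : ∀ N : ℕ, 0 < N → ∀ m : Nat.factoredNumbers a.primeFactors,
      R (N / (m : ℕ)) / N ≤ Fintype.card (ZMod a)ˣ * (1 / ((m : ℕ) : ℝ)) := by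
    intro N hN m
    have hN0 : (0 : ℝ) < N := by exact_mod_cast hN
    rw [div_le_iff₀ hN0, mul_assoc, one_div_mul_eq_div]
    exact (hRle _).trans (mul_le_mul_of_nonneg_left Nat.cast_div_le (Nat.cast_nonneg _))
  have htan : Tendsto (fun N : ℕ => ∑' m : Nat.factoredNumbers a.primeFactors,
      R (N / (m : ℕ)) / N) atTop (𝓝 (∑' _ : Nat.factoredNumbers a.primeFactors, (0 : ℝ))) := by
    refine tendsto_tsum_of_dominated_convergence
      (bound := fun m : Nat.factoredNumbers a.primeFactors =>
        Fintype.card (ZMod a)ˣ * (1 / ((m : ℕ) : ℝ)))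
      ((summable_factored_inv a).mul_left _)
      (fun m => tendsto_natDiv_ratio hRlim hR0
        (Nat.pos_of_ne_zero (Nat.ne_zero_of_mem_factoredNumbers m.2))) ?_
    filter_upwards [eventually_gt_atTop 0] with N hN m
    rw [Real.norm_of_nonneg (div_nonneg (hR0 _) (Nat.cast_nonneg _))]
    exact hdom N hN m
  rw [tsum_zero] at htan
  refine squeeze_zero_norm' ?_ htan
  filter_upwards [eventually_gt_atTop 0] with N hN
  have hnn : ∀ m : Nat.factoredNumbers a.primeFactors, 0 ≤ R (N / (m : ℕ)) / N := fun m =>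
    div_nonneg (hR0 _) (Nat.cast_nonneg _)
  have hsum : Summable fun m : Nat.factoredNumbers a.primeFactors => R (N / (m : ℕ)) / N :=
    Summable.of_nonneg_of_le hnn (hdom N hN) ((summable_factored_inv a).mul_left _)
  rw [avg, sum_eq_sum_factored ha, norm_div, Complex.norm_natCast]
  calc _ ≤ (∑ m ∈ (Finset.Icc 1 N).filter (· ∈ Nat.factoredNumbers a.primeFactors),
        R (N / m)) / N := by
        refine div_le_div_of_nonneg_right ((norm_sum_le _ _).trans
          (Finset.sum_le_sum fun m hm => ?_)) (Nat.cast_nonneg _)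
        exact hinner m (N / m) (Finset.mem_filter.1 hm).2
    _ = ∑ m ∈ (Finset.Icc 1 N).subtype (· ∈ Nat.factoredNumbers a.primeFactors),
        R (N / (m : ℕ)) / N := by
      rw [Finset.sum_div, ← Finset.sum_subtype_eq_sum_filter]
    _ ≤ _ := hsum.sum_le_tsum _ fun m _ => hnn m

end

/-! ### Distances to twisted characters and the prime 2 -/

section
variable {f : ℕ → ℂ}

lemma IsMultOfModulusLeOne.mul_character (hf : IsMultOfModulusLeOne f) {q : ℕ}
    (χ : DirichletCharacter ℂ q) : IsMultOfModulusLeOne fun n => f n * χ (n : ZMod q) where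
  map_mul m n hm hn hmn := by
    rw [hf.map_mul m n hm hn hmn, Nat.cast_mul, MulHomClass.map_mul χ]
    ring
  norm_le_one n hn := by
    rw [norm_mul]
    exact mul_le_one₀ (hf.norm_le_one n hn) (norm_nonneg _) (χ.norm_le_one _)

lemma mul_conj_character_mul_cpow (f : ℕ → ℂ) {q : ℕ} (χ : DirichletCharacter ℂ q) (t : ℝ)
    {n : ℕ} (hn : 0 < n) :
    f n * starRingEnd ℂ (χ (n : ZMod q) * (n : ℂ) ^ (Complex.I * (t : ℂ))) =
      archTwist (fun n => f n * χ⁻¹ (n : ZMod q)) t n := by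
  have hn0 : (n : ℂ) ≠ 0 := by exact_mod_cast hn.ne'
  have h1 : starRingEnd ℂ (χ (n : ZMod q)) = χ⁻¹ (n : ZMod q) := MulChar.star_apply' χ _
  rw [map_mul, h1, archTwist, Complex.cpow_def_of_ne_zero hn0, ← Complex.exp_conj,
    ← Complex.natCast_log]
  simp only [map_mul, Complex.conj_ofReal, Complex.conj_I]
  rw [mul_assoc]
  congr 3
  ring

lemma mulDist_eq_top_iff (hf : IsMultOfModulusLeOne f) {q : ℕ} (χ : DirichletCharacter ℂ q)
    (t : ℝ) :
    mulDist f (fun n => χ (n : ZMod q) * (n : ℂ) ^ (Complex.I * (t : ℂ))) = ⊤ ↔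
      ¬ Summable fun p : Nat.Primes => (1 / (p : ℕ) : ℝ) *
        (1 - (archTwist (fun n => f n * χ⁻¹ (n : ZMod q)) t p).re) := by
  have hnn : ∀ p : Nat.Primes, 0 ≤ (1 / (p : ℕ) : ℝ) *
      (1 - (archTwist (fun n => f n * χ⁻¹ (n : ZMod q)) t p).re) := fun p => by
    have h1 := (isMult_archTwist (hf.mul_character χ⁻¹) t).norm_le_one p p.2.pos
    have h2 := (Complex.re_le_norm _).trans h1
    exact mul_nonneg (by positivity) (by linarith)
  rw [mulDist]
  have hterm : ∀ p : Nat.Primes, (1 / ((p : ℕ) : ℝ)) * (1 - (f p * starRingEnd ℂ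
      (χ ((p : ℕ) : ZMod q) * ((p : ℕ) : ℂ) ^ (Complex.I * (t : ℂ)))).re) = (1 / (p : ℕ) : ℝ) *
        (1 - (archTwist (fun n => f n * χ⁻¹ (n : ZMod q)) t p).re) := fun p => by
    rw [mul_conj_character_mul_cpow f χ t p.2.pos]
  rw [tsum_congr fun p => congrArg ENNReal.ofReal (hterm p), ENNReal.rpow_eq_top_iff_of_pos (by norm_num), ← not_iff_not, not_not]
  constructor
  · intro h
    have := ENNReal.summable_toReal h
    exact this.congr fun p => ENNReal.toReal_ofReal (hnn p)
  · intro h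
    rw [← ENNReal.ofReal_tsum_of_nonneg hnn h]
    exact ENNReal.ofReal_ne_top

/-- The character modulo `2 * q` induced by `χ`. -/
noncomputable def evenLift {q : ℕ} (χ : DirichletCharacter ℂ q) : DirichletCharacter ℂ (2 * q) :=
  DirichletCharacter.changeLevel (dvd_mul_left q 2) χ

lemma evenLift_inv {q : ℕ} (χ : DirichletCharacter ℂ q) : evenLift χ⁻¹ = (evenLift χ)⁻¹ :=
  map_inv _ _

lemma evenLift_two_pow {q : ℕ} (χ : DirichletCharacter ℂ q) {m : ℕ} (hm : 0 < m) :
    evenLift χ ((2 ^ m : ℕ) : ZMod (2 * q)) = 0 := by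
  refine MulChar.map_nonunit _ fun h => ?_
  rw [ZMod.isUnit_iff_coprime] at h
  exact absurd (Nat.dvd_gcd (dvd_pow_self 2 hm.ne') (dvd_mul_right 2 q))
    (by rw [h]; norm_num)

lemma evenLift_prime {q : ℕ} (χ : DirichletCharacter ℂ q) {p : ℕ} (hp : p.Prime) (h2 : p ≠ 2) :
    evenLift χ (p : ZMod (2 * q)) = χ (p : ZMod q) := by
  have hp2 : p.Coprime 2 := (Nat.coprime_primes hp Nat.prime_two).2 h2
  by_cases hpq : p.Coprime q
  · have h := DirichletCharacter.changeLevel_eq_cast_of_dvd χ (dvd_mul_left q 2)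
      (ZMod.unitOfCoprime p (hp2.mul_right hpq))
    rw [ZMod.coe_unitOfCoprime, ZMod.cast_natCast (dvd_mul_left q 2)] at h
    exact h
  · rw [MulChar.map_nonunit, MulChar.map_nonunit]
    · rwa [ZMod.isUnit_iff_coprime]
    · rw [ZMod.isUnit_iff_coprime]
      exact fun h => hpq (h.coprime_dvd_right (dvd_mul_left q 2))

/-- Only the term at the prime `2` can change. -/
lemma summable_evenLift_iff (f : ℕ → ℂ) {q : ℕ} (χ : DirichletCharacter ℂ q) (t : ℝ) :
    (Summable fun p : Nat.Primes => (1 / (p : ℕ) : ℝ) *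
        (1 - (archTwist (fun n => f n * evenLift χ (n : ZMod (2 * q))) t p).re)) ↔
      Summable fun p : Nat.Primes => (1 / (p : ℕ) : ℝ) *
        (1 - (archTwist (fun n => f n * χ (n : ZMod q)) t p).re) := by
  refine summable_congr_cofinite ?_
  filter_upwards [(Set.finite_singleton (⟨2, Nat.prime_two⟩ : Nat.Primes)).compl_mem_cofinite]
    with p hp
  have h2 : (p : ℕ) ≠ 2 := fun h => hp (Subtype.ext h)
  simp only [archTwist, evenLift_prime χ p.2 h2]

/-- A finite distance would persist after lifting the inverse character modulo `2 * q` and twisting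
by `n ^ {-it}`. The resulting function has mean zero by hypothesis and vanishes at powers of `2`,
against `not_tendsto_avg_zero`. -/
lemma mulDist_eq_top_of_tendsto (hf : IsMultOfModulusLeOne f)
    (h : ∀ q : ℕ, 0 < q → ∀ χ : DirichletCharacter ℂ q,
      Tendsto (avg fun n => f n * χ (n : ZMod q)) atTop (𝓝 0))
    (t : ℝ) {q : ℕ} (hq : 0 < q) (χ : DirichletCharacter ℂ q) :
    mulDist f (fun n => χ (n : ZMod q) * (n : ℂ) ^ (Complex.I * (t : ℂ))) = ⊤ := by
  rw [mulDist_eq_top_iff hf]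
  intro hs
  rcases hf.map_one_eq with h1 | h1
  -- If `f 1 = 0` then `f` vanishes, and the squared distance is the divergent sum of `1 / p`.
  · refine Nat.Primes.not_summable_one_div (hs.congr fun p => ?_)
    simp [archTwist, hf.eq_zero h1 p.2.pos]
  · have hg := hf.mul_character (evenLift χ⁻¹)
    refine not_tendsto_avg_zero (isMult_archTwist hg t) ?_ ?_
      ((summable_evenLift_iff f χ⁻¹ t).2 hs)
      (tendsto_avg_archTwist (h (2 * q) (by omega) (evenLift χ⁻¹)) t)
    · simp [archTwist, h1]
    · intro m hm
      simp only [archTwist, evenLift_two_pow χ⁻¹ hm, mul_zero, zero_mul]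

/-- Apply the hypothesis to the lift of `χ⁻¹`: its value at `2` is zero, so the exceptional
alternative would make a power of `2` vanish. Infinite distance remains, for every `t`, and Halász's
criterion applies. -/
lemma tendsto_avg_character_of_mulDist (hf : IsMultOfModulusLeOne f)
    (h : ∀ t : ℝ, ∀ q : ℕ, 0 < q → ∀ χ : DirichletCharacter ℂ q,
        mulDist f (fun n => χ (n : ZMod q) * (n : ℂ) ^ (Complex.I * (t : ℂ))) = ⊤ ∨
          ∀ m : ℕ, 0 < m →
            f (2 ^ m) * χ ((2 ^ m : ℕ) : ZMod q) =
              -(2 : ℂ) ^ (-(Complex.I * (m : ℂ) * (t : ℂ))))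
    {q : ℕ} (hq : 0 < q) (χ : DirichletCharacter ℂ q) :
    Tendsto (avg fun n => f n * χ (n : ZMod q)) atTop (𝓝 0) := by
  refine tendsto_avg_zero_of_not_summable (hf.mul_character χ) fun t hs => ?_
  rcases h t (2 * q) (by omega) (evenLift χ⁻¹) with h1 | h1
  · rw [mulDist_eq_top_iff hf, ← evenLift_inv, inv_inv] at h1
    exact h1 ((summable_evenLift_iff f χ t).2 hs)
  · have h2 := h1 1 one_pos
    rw [evenLift_two_pow _ one_pos, mul_zero, eq_comm, neg_eq_zero, Complex.cpow_eq_zero_iff] at h2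
    exact two_ne_zero h2.1

end

theorem proposition2p7 (f : ℕ → ℂ) (hf : IsMultOfModulusLeOne f) :
    List.TFAE [
      IsAperiodic f,
      ∀ p q : ℕ, 0 < p → 0 < q →
        Tendsto (avg fun n => f n * expChar ((n : ℝ) * p / q)) atTop (𝓝 0),
      ∀ q : ℕ, 0 < q → ∀ χ : DirichletCharacter ℂ q,
        Tendsto (avg fun n => f n * χ (n : ZMod q)) atTop (𝓝 0),
      ∀ t : ℝ, ∀ q : ℕ, 0 < q → ∀ χ : DirichletCharacter ℂ q,
        mulDist f (fun n => χ (n : ZMod q) * (n : ℂ) ^ (Complex.I * (t : ℂ))) = ⊤ ∨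
          ∀ m : ℕ, 0 < m →
            f (2 ^ m) * χ ((2 ^ m : ℕ) : ZMod q) =
              -(2 : ℂ) ^ (-(Complex.I * (m : ℂ) * (t : ℂ)))] := by
  tfae_have 1 → 2 := fun h p q _ hq =>
    (hasZeroClassMeans_of_isAperiodic hf.norm_le_one h).tendsto_avg_expChar hq p
  tfae_have 2 → 3 := fun h q hq χ => (hasZeroClassMeans_of_expChar h).tendsto_avg_mul hq χ
  tfae_have 3 → 1 := fun h => isAperiodic_of_hasZeroClassMeans (hasZeroClassMeans_of_characters hf h)
  tfae_have 3 → 4 := fun h t q hq χ => Or.inl (mulDist_eq_top_of_tendsto hf h t hq χ)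
  tfae_have 4 → 3 := fun h q hq χ => tendsto_avg_character_of_mulDist hf h hq χ
  tfae_finish
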